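/- **Setting.** Let $M$ be a smooth manifold diffeomorphic to $\mathbb R^4$, $C^\infty$ its algebra of real smooth functions, and $W$ a free $C^\infty$-module of rank $4$ with a conformal inner product of signature $-{+}{+}{+}$, that is, a class, modulo multiplication by positive functions, of symmetric $C^\infty$-bilinear forms on $W$ that have this signature at every point. Tensor and exterior products are over $C^\infty$. Let $\mathrm{CDerEnd}(W)$ be the $C^\infty$-module of all $\delta=(\delta_{C^\infty},\delta_W)$, with $\delta_{C^\infty}$ an $\mathbb R$-derivation of $C^\infty$ and $\delta_W\in\mathrm{End}_{\mathbb R}(W)$, such that $\delta(fw)=\delta(f)w+f\delta(w)$ and such that for every representative $\langle-,-\rangle$ there is $f\in C^\infty$ with $\delta\langle x,y\rangle=\langle\delta x,y\rangle+\langle x,\delta y\rangle+f\langle x,y\rangle$ for all $x,y\in W$. Let $\lambda(\delta)$ be the extension of $\delta$ to a derivation of $\wedge W$. The graded $\wedge W$-module $\mathcal L=(\wedge W)\otimes\mathrm{CDerEnd}(W)$ has the bracket $$[\omega\delta,\omega'\delta']=\omega\omega'[\delta,\delta']+(\omega\lambda(\delta)(\omega'))\delta'-(\lambda(\delta')(\omega)\omega')\delta$$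 and the anchor $\mathcal L\to\mathrm{Der}(\wedge W)$, $\omega\delta\mapsto\omega\lambda(\delta)$. Fix a representative $\langle-,-\rangle$. Let $\mathrm{Cl}$ be the $C^\infty$-algebra generated by $W$ with relations $wv+vw+2\langle v,w\rangle=0$, with its $\mathbb Z_2$-grading and the filtration $\mathrm{Cl}^{\le k}$ by products of at most $k$ elements of $W$ ($\mathrm{Cl}^{\le k}=0$ for $k<0$). Write $X^{\lhd k}$ for the elements of $X^{\le k}$ of the parity of $k$. Put $\bar L=\mathrm{Cl}\otimes\mathrm{CDerEnd}(W)$ with the induced filtration and $\mathbb Z_2$-grading, and $\Omega=\wedge^4W$. Let $\bar P$ be the $\mathrm{Cl}$-module of triples of $\mathbb R$-linear maps $\delta_{C^\infty}:C^\infty\to\mathrm{Cl}$, $\delta_W:W\to\mathrm{Cl}$, $\delta_\Omega:\Omega\to\mathrm{Cl}\otimes\Omega$ with $$\delta_{C^\infty}(ff')=f'\delta_{C^\infty}(f)+f\delta_{C^\infty}(f'),\quad \delta_W(fw)=\delta_{C^\infty}(f)w+f\delta_W(w),\quad \delta_\Omega(f\eta)=\delta_{C^\infty}(f)\otimes\eta+f\delta_\Omega(\eta),$$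 where $\bar P^{\lhd k}$ consists of the triples with values in $\mathrm{Cl}^{\lhd k}$, $\mathrm{Cl}^{\lhd k+1}$ and $\mathrm{Cl}^{\lhd k}\otimes\Omega$ respectively. Let $f:\bar L\to\bar P$ be the $\mathrm{Cl}$-linear map that sends $\omega\delta$ to the triple $\omega\,\delta(-)$, $\omega\,\delta(-)$, $\omega\otimes\lambda(\delta)(-)$. Let $\bar I=\ker f$ with the induced filtration and $\bar E=\bar L/\bar I$ with the quotient filtration. For a filtered $\mathrm{Cl}$-module $X$, the associated graded $\mathrm{Gr}\,X=\bigoplus_k X^{\le k}/X^{\le k-1}$ is a graded module over $\wedge W=\mathrm{Gr}\,\mathrm{Cl}$. **Theorem.** $f$ maps $\bar L^{\lhd k}$ to $\bar P^{\lhd k}$ for all $k$. The $\wedge W$-linear map $\mathrm{Gr}\,\bar I\to\mathrm{Gr}\,\bar L$ has a $C^\infty$-linear left inverse of degree zero, so $\mathrm{Gr}\,\bar I$ is a graded $\wedge W$-submodule that is a direct summand of $\mathrm{Gr}\,\bar L$ as a graded $C^\infty$-module. There is a canonical isomorphism of graded $\wedge W$-modules $i:\mathrm{Gr}\,\bar L\to\mathcal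 L$, inverse to the $\wedge W$-linear map that sends $1\otimes\delta$ to the class of $1\otimes\delta$ in degree $0$. Put $\mathcal I=i(\mathrm{Gr}\,\bar I)$ and $\mathcal I^k=\mathcal I\cap\mathcal L^k$. Then: * $\mathcal I^0=\mathcal I^1=0$. * Let $\theta_0,\dots,\theta_3$ be a $C^\infty$-basis of $W$ that is orthonormal for some representative ($\langle\theta_0,\theta_0\rangle=-1$, $\langle\theta_0,\theta_i\rangle=0$, $\langle\theta_i,\theta_j\rangle=\delta_{ij}$ for $i,j=1,2,3$), and let $\sigma_i,\sigma_{ij}\in\mathrm{CDerEnd}(W)$ be the $C^\infty$-linear maps with $\sigma_i(\theta_0)=\theta_i$, $\sigma_i(\theta_j)=\delta_{ij}\theta_0$, $\sigma_{ij}(\theta_0)=0$, $\sigma_{ij}(\theta_k)=\delta_{jk}\theta_i-\delta_{ik}\theta_j$. For a symmetric traceless $S\in\mathbb C^{3\times3}$ set $$m(S)=\mathrm{Re}\left[\begin{pmatrix}\theta_0\theta_1+i\theta_2\theta_3\\ \theta_0\theta_2+i\theta_3\theta_1\\ \theta_0\theta_3+i\theta_1\theta_2\end{pmatrix}^{T}S\begin{pmatrix}\sigma_1+i\sigma_{23}\\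 \sigma_2+i\sigma_{31}\\ \sigma_3+i\sigma_{12}\end{pmatrix}\right]\in\mathcal L^2.$$ If $S$ runs over a basis of the real vector space of symmetric traceless matrices in $\mathbb C^{3\times 3}$, then the $m(S)$ are a $C^\infty$-basis of $\mathcal I^2$. * $\mathcal I=(\wedge W)\mathcal I^2$. * $\mathcal I$ is contained in the kernel of the anchor of $\mathcal L$, and $[\mathcal L,\mathcal I]\subset\mathcal I$. * Put $\mathcal E=\mathcal L/\mathcal I$. Canonically $\mathcal E\simeq\mathrm{Gr}\,\bar L/\mathrm{Gr}\,\bar I\simeq\mathrm{Gr}\,\bar E$ as graded $\wedge W$-modules, and with the induced bracket and anchor $\mathcal E$ is a $\wedge W$-graded Lie algebroid. -/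

import Mathlib

open scoped TensorProduct Manifold ContDiff DirectSum

noncomputable section

namespace CliffordGR

set_option linter.unusedSectionVars false

section ModuleDerivations

variable (R : Type*) (W : Type*) [CommRing R] [Algebra ℝ R] [AddCommGroup W] [Module R W]
  [Module ℝ W] [IsScalarTower ℝ R W]

/-- Module derivations of `W`: pairs of a derivation of `R` and a real-linear endomorphism
of `W` satisfying the Leibniz rule. -/
def DerEnd : Submodule R (Derivation ℝ R R × (W →ₗ[ℝ] W)) where
  carrier := {δ | ∀ (r : R) (w : W), δ.2 (r • w) = δ.1 r • w + r • δ.2 w}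
  zero_mem' := by intro r w; simp
  add_mem' := by
    intro a b ha hb r w
    change ∀ (r : R) (w : W), a.2 (r • w) = a.1 r • w + r • a.2 w at ha
    change ∀ (r : R) (w : W), b.2 (r • w) = b.1 r • w + r • b.2 w at hb
    simp only [Prod.snd_add, Prod.fst_add, LinearMap.add_apply, Derivation.add_apply, ha, hb]
    module
  smul_mem' := by
    intro c a ha r w
    change ∀ (r : R) (w : W), a.2 (r • w) = a.1 r • w + r • a.2 w at ha
    simp only [Prod.smul_snd, Prod.smul_fst, LinearMap.smul_apply, Derivation.smul_apply, ha,
      smul_eq_mul]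
    module

variable {R W}

/-- The module derivations that preserve the conformal inner product whose set of
representatives is `C`. -/
def CDerEnd (C : Set (LinearMap.BilinForm R W)) :
    Submodule R (Derivation ℝ R R × (W →ₗ[ℝ] W)) where
  carrier := {δ | δ ∈ DerEnd R W ∧ ∀ g ∈ C, ∃ f : R, ∀ x y : W,
    δ.1 (g x y) = g (δ.2 x) y + g x (δ.2 y) + f * g x y}
  zero_mem' := ⟨zero_mem _, fun g _ => ⟨0, by simp⟩⟩
  add_mem' := by
    rintro a b ⟨ha, ha'⟩ ⟨hb, hb'⟩
    refine ⟨add_mem ha hb, fun g hg => ?_⟩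
    obtain ⟨f, hf⟩ := ha' g hg
    obtain ⟨f', hf'⟩ := hb' g hg
    refine ⟨f + f', fun x y => ?_⟩
    simp only [Prod.snd_add, Prod.fst_add, LinearMap.add_apply, Derivation.add_apply, hf, hf',
      map_add]
    ring
  smul_mem' := by
    rintro c a ⟨ha, ha'⟩
    refine ⟨Submodule.smul_mem _ _ ha, fun g hg => ?_⟩
    obtain ⟨f, hf⟩ := ha' g hg
    refine ⟨c * f, fun x y => ?_⟩
    simp only [Prod.smul_snd, Prod.smul_fst, LinearMap.smul_apply, Derivation.smul_apply, hf,
      map_smul, smul_eq_mul]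
    ring

/-- The commutator of conformal module derivations. -/
def CDerEnd.comm {C : Set (LinearMap.BilinForm R W)} (δ ε : CDerEnd C) : CDerEnd C :=
  ⟨(⁅δ.1.1, ε.1.1⁆, δ.1.2 ∘ₗ ε.1.2 - ε.1.2 ∘ₗ δ.1.2), by
    obtain ⟨⟨d, D⟩, h, h'⟩ := δ
    obtain ⟨⟨e, E⟩, k, k'⟩ := ε
    change ∀ (r : R) (w : W), D (r • w) = d r • w + r • D w at h
    change ∀ (r : R) (w : W), E (r • w) = e r • w + r • E w at k
    refine ⟨fun r w => ?_, fun g hg => ?_⟩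
    · simp only [LinearMap.sub_apply, LinearMap.comp_apply, Derivation.commutator_apply, h, k,
        map_add]
      module
    · obtain ⟨f, hf⟩ := h' g hg
      obtain ⟨f', hf'⟩ := k' g hg
      dsimp only at hf hf'
      refine ⟨d f' - e f, fun x y => ?_⟩
      simp only [LinearMap.sub_apply, LinearMap.comp_apply, Derivation.commutator_apply, hf, hf',
        map_add, map_sub, Derivation.leibniz, smul_eq_mul]
      ring⟩

/-- The real algebra of dual numbers over `⋀ W`, with scalars of `R` acting through
`r ↦ r + ε d r`. -/
def Tw (_d : Derivation ℝ R R) (W : Type*) [AddCommGroup W] [Module R W] : Type _ :=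
  TrivSqZeroExt (ExteriorAlgebra R W) (ExteriorAlgebra R W)

instance (d : Derivation ℝ R R) : Ring (Tw d W) :=
  inferInstanceAs (Ring (TrivSqZeroExt (ExteriorAlgebra R W) (ExteriorAlgebra R W)))

/-- The ring morphism `r ↦ r + ε d r`. -/
def Tw.ringHom (d : Derivation ℝ R R) (W : Type*) [AddCommGroup W] [Module R W] : R →+* Tw d W where
  toFun r := (algebraMap R (ExteriorAlgebra R W) r, algebraMap R (ExteriorAlgebra R W) (d r))
  map_one' := by simp; rfl
  map_zero' := by simp; rfl
  map_add' a b := by simp; rfl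
  map_mul' a b := by
    refine Prod.ext ?_ ?_
    · exact map_mul _ _ _
    · change algebraMap R (ExteriorAlgebra R W) (d (a * b)) =
        algebraMap R (ExteriorAlgebra R W) a • algebraMap R (ExteriorAlgebra R W) (d b) +
        MulOpposite.op (algebraMap R (ExteriorAlgebra R W) b) • algebraMap R (ExteriorAlgebra R W) (d a)
      rw [Derivation.leibniz, map_add, smul_eq_mul, smul_eq_mul, map_mul, map_mul, smul_eq_mul,
        op_smul_eq_mul, Algebra.commutes b]

instance (d : Derivation ℝ R R) : Algebra R (Tw d W) :=
  (Tw.ringHom d W).toAlgebra' (by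
    intro c x
    refine Prod.ext ?_ ?_
    · exact Algebra.commutes c x.1
    · change algebraMap R (ExteriorAlgebra R W) c • x.2 +
        MulOpposite.op x.1 • algebraMap R (ExteriorAlgebra R W) (d c) =
        x.1 • algebraMap R (ExteriorAlgebra R W) (d c) +
        MulOpposite.op (algebraMap R (ExteriorAlgebra R W) c) • x.2
      simp only [smul_eq_mul, op_smul_eq_mul]
      rw [Algebra.commutes c, Algebra.commutes (d c), add_comm])

theorem Tw.smul_fst (d : Derivation ℝ R R) (r : R) (x : Tw d W) :
    (r • x : Tw d W).1 = r • x.1 := by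
  rw [Algebra.smul_def, Algebra.smul_def]; rfl

theorem Tw.smul_snd (d : Derivation ℝ R R) (r : R) (x : Tw d W) :
    (r • x : Tw d W).2 = r • x.2 + d r • x.1 := by
  rw [Algebra.smul_def (d r), Algebra.smul_def r x, Algebra.smul_def r x.2]
  change algebraMap R (ExteriorAlgebra R W) r • x.2 +
        MulOpposite.op x.1 • algebraMap R (ExteriorAlgebra R W) (d r) = _
  simp only [smul_eq_mul, op_smul_eq_mul]

/-- The algebra morphism `a ↦ a + ε δ(a)` that defines the extension of `δ` to `⋀ W`. -/
def twHom (δ : DerEnd R W) : ExteriorAlgebra R W →ₐ[R] Tw δ.1.1 W :=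
  ExteriorAlgebra.lift R
    ⟨{ toFun := fun w => (ExteriorAlgebra.ι R w, ExteriorAlgebra.ι R (δ.1.2 w))
       map_add' := fun x y => by simp; rfl
       map_smul' := fun r x => by
        refine Prod.ext ?_ ?_
        · exact (map_smul (ExteriorAlgebra.ι R) r x).trans (Tw.smul_fst δ.1.1 r
            (ExteriorAlgebra.ι R x, ExteriorAlgebra.ι R (δ.1.2 x))).symm
        · refine Eq.trans ?_ (Tw.smul_snd δ.1.1 r _).symm
          dsimp only
          rw [δ.2 r x, map_add, map_smul, map_smul, add_comm] },
     fun w => by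
      refine Prod.ext ?_ ?_
      · exact ExteriorAlgebra.ι_sq_zero w
      · exact ExteriorAlgebra.ι_add_mul_swap w (δ.1.2 w)⟩

theorem twHom_ι (δ : DerEnd R W) (w : W) : twHom δ (ExteriorAlgebra.ι R w) =
    (ExteriorAlgebra.ι R w, ExteriorAlgebra.ι R (δ.1.2 w)) := by
  exact ExteriorAlgebra.lift_ι_apply R _ _ w

theorem twHom_fst (δ : DerEnd R W) (a : ExteriorAlgebra R W) : (twHom δ a).1 = a := by
  induction a using ExteriorAlgebra.induction with
  | algebraMap r => rw [AlgHom.commutes]; rfl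
  | ι w => rw [twHom_ι]
  | mul a b ha hb =>
    rw [map_mul]
    change (twHom δ a).1 * (twHom δ b).1 = _
    rw [ha, hb]
  | add a b ha hb =>
    rw [map_add]
    change (twHom δ a).1 + (twHom δ b).1 = _
    rw [ha, hb]

theorem twHom_mul_snd (δ : DerEnd R W) (a b : ExteriorAlgebra R W) :
    (twHom δ (a * b)).2 = (twHom δ a).2 * b + a * (twHom δ b).2 := by
  rw [map_mul]
  change (twHom δ a).1 • (twHom δ b).2 + MulOpposite.op (twHom δ b).1 • (twHom δ a).2 = _
  rw [twHom_fst, twHom_fst, smul_eq_mul, op_smul_eq_mul, add_comm]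

theorem twHom_algebraMap_snd (δ : DerEnd R W) (r : R) :
    (twHom δ (algebraMap R _ r)).2 = algebraMap R (ExteriorAlgebra R W) (δ.1.1 r) := by
  rw [AlgHom.commutes]; rfl

/-- The extension of a module derivation `δ` of `W` to a derivation of `⋀ W`, as a real-linear
map. -/
def extDer (δ : DerEnd R W) : ExteriorAlgebra R W →ₗ[ℝ] ExteriorAlgebra R W where
  toFun a := (twHom δ a).2
  map_add' a b := by rw [map_add]; rfl
  map_smul' c a := by
    rw [← algebraMap_smul R c a, map_smul, Tw.smul_snd, Derivation.map_algebraMap, zero_smul,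
      add_zero, algebraMap_smul, RingHom.id_apply]

theorem extDer_algebraMap (δ : DerEnd R W) (r : R) :
    extDer δ (algebraMap R _ r) = algebraMap R (ExteriorAlgebra R W) (δ.1.1 r) :=
  twHom_algebraMap_snd δ r

theorem extDer_ι (δ : DerEnd R W) (w : W) :
    extDer δ (ExteriorAlgebra.ι R w) = ExteriorAlgebra.ι R (δ.1.2 w) :=
  congrArg Prod.snd (twHom_ι δ w)

theorem extDer_mul (δ : DerEnd R W) (a b : ExteriorAlgebra R W) :
    extDer δ (a * b) = extDer δ a * b + a * extDer δ b :=
  twHom_mul_snd δ a b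

theorem extDer_smul_right (δ : DerEnd R W) (r : R) (a : ExteriorAlgebra R W) :
    extDer δ (r • a) = δ.1.1 r • a + r • extDer δ a := by
  rw [Algebra.smul_def, extDer_mul, extDer_algebraMap, Algebra.smul_def, Algebra.smul_def]

theorem extDer_add (δ ε : DerEnd R W) : extDer (δ + ε) = extDer δ + extDer ε := by
  ext a
  induction a using ExteriorAlgebra.induction with
  | algebraMap r => simp [extDer_algebraMap]
  | ι w => simp [extDer_ι]
  | mul a b ha hb =>
    simp only [LinearMap.add_apply] at ha hb ⊢
    simp only [extDer_mul, ha, hb]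
    noncomm_ring
  | add a b ha hb => rw [map_add, map_add, ha, hb]

theorem extDer_smul (r : R) (δ : DerEnd R W) : extDer (r • δ) = r • extDer δ := by
  ext a
  induction a using ExteriorAlgebra.induction with
  | algebraMap s => simp [extDer_algebraMap, Algebra.smul_def]
  | ι w => simp [extDer_ι]
  | mul a b ha hb =>
    simp only [LinearMap.smul_apply] at ha hb ⊢
    simp only [extDer_mul, ha, hb, smul_add, smul_mul_assoc, mul_smul_comm]
  | add a b ha hb => rw [map_add, map_add, ha, hb]

theorem extDer_mem (δ : DerEnd R W) (n : ℕ) (a : ExteriorAlgebra R W) (ha : a ∈ ⋀[R]^n W) :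
    extDer δ a ∈ ⋀[R]^n W := by
  induction ha using Submodule.pow_induction_on_left' with
  | algebraMap r =>
    rw [extDer_algebraMap]
    exact Submodule.mem_one.2 ⟨_, rfl⟩
  | add x y i hx hy h1 h2 => rw [map_add]; exact add_mem h1 h2
  | mem_mul m hm i x hx h =>
    obtain ⟨w, rfl⟩ := hm
    have hp : ⋀[R]^(i + 1) W = LinearMap.range (ExteriorAlgebra.ι R) * (⋀[R]^i W) := pow_succ' _ _
    rw [extDer_mul, extDer_ι, Nat.succ_eq_add_one, hp]
    exact add_mem (Submodule.mul_mem_mul ⟨_, rfl⟩ hx) (Submodule.mul_mem_mul ⟨_, rfl⟩ h)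

variable (C : Set (LinearMap.BilinForm R W))

/-- The morphism `λ : CDerEnd(W) → Der⁰(⋀ W)`. -/
def lam : CDerEnd C →ₗ[R] (ExteriorAlgebra R W →ₗ[ℝ] ExteriorAlgebra R W) where
  toFun δ := extDer ⟨δ.1, δ.2.1⟩
  map_add' δ ε := extDer_add ⟨δ.1, δ.2.1⟩ ⟨ε.1, ε.2.1⟩
  map_smul' r δ := extDer_smul r ⟨δ.1, δ.2.1⟩

end ModuleDerivations

section BaseChange

variable {R : Type*} {A D N : Type*} [CommRing R] [Ring A] [Algebra R A] [AddCommGroup D]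
  [Module R D] [AddCommMonoid N] [Module R N] [Module A N] [IsScalarTower R A N]

/-- The `A`-linear map `A ⊗ D → N`, `a ⊗ x ↦ a • l x` (the algebra `A` need not be
commutative). -/
def baseLift (l : D →ₗ[R] N) : A ⊗[R] D →ₗ[A] N :=
  TensorProduct.AlgebraTensorModule.lift
    { toFun := fun a => a • l
      map_add' := fun a b => add_smul a b l
      map_smul' := fun a b => mul_smul a b l }

theorem baseLift_tmul (l : D →ₗ[R] N) (a : A) (x : D) :
    baseLift l (a ⊗ₜ[R] x) = a • l x := rfl

variable (D) in
/-- The image of `S ⊗ D` in `A ⊗ D`. -/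
def tensorRange (S : Submodule R A) : Submodule R (A ⊗[R] D) :=
  LinearMap.range (LinearMap.rTensor D S.subtype)

theorem tmul_mem_tensorRange {S : Submodule R A} {a : A} (ha : a ∈ S) (x : D) :
    a ⊗ₜ[R] x ∈ tensorRange D S := ⟨(⟨a, ha⟩ : S) ⊗ₜ[R] x, rfl⟩

theorem tensorRange_mono {S T : Submodule R A} (h : S ≤ T) :
    tensorRange D S ≤ tensorRange D T := by
  rintro _ ⟨x, rfl⟩
  induction x with
  | zero => simp
  | tmul a x => exact tmul_mem_tensorRange (h a.2) x
  | add x y hx hy => rw [map_add]; exact add_mem hx hy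

theorem smul_mem_tensorRange {S T : Submodule R A} {a : A} (h : ∀ b ∈ S, a * b ∈ T)
    {x : A ⊗[R] D} (hx : x ∈ tensorRange D S) : a • x ∈ tensorRange D T := by
  obtain ⟨x, rfl⟩ := hx
  induction x with
  | zero => simp
  | tmul b x => exact tmul_mem_tensorRange (h b b.2) x
  | add x y hx hy => rw [map_add, smul_add]; exact add_mem hx hy

end BaseChange

section Laoid

variable {R W : Type*} [CommRing R] [Algebra ℝ R] [AddCommGroup W] [Module R W]
  [Module ℝ W] [IsScalarTower ℝ R W] (C : Set (LinearMap.BilinForm R W))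

/-- The base change `⋀ W ⊗ CDerEnd(W)`. -/
abbrev Lmod : Type _ := ExteriorAlgebra R W ⊗[R] CDerEnd C

/-- The anchor `ω δ ↦ (ω' ↦ ω λ(δ)(ω'))`. -/
def anchor : Lmod C →ₗ[ExteriorAlgebra R W] (ExteriorAlgebra R W →ₗ[ℝ] ExteriorAlgebra R W) :=
  baseLift (lam C)

variable {C}

/-- The expression `ωω'[δ,δ'] + (ω λ(δ)(ω'))δ' - (λ(δ')(ω)ω')δ`. -/
def brTerm (b : ExteriorAlgebra R W) (y : CDerEnd C) (b' : ExteriorAlgebra R W)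
    (y' : CDerEnd C) : Lmod C :=
  (b * b') ⊗ₜ[R] CDerEnd.comm y y' + (b * lam C y b') ⊗ₜ[R] y' - (lam C y' b * b') ⊗ₜ[R] y

theorem CDerEnd.comm_add_left (x y z : CDerEnd C) :
    CDerEnd.comm (x + y) z = CDerEnd.comm x z + CDerEnd.comm y z := by
  apply Subtype.ext
  refine Prod.ext ?_ ?_
  · simp [CDerEnd.comm]
  · ext w
    simp [CDerEnd.comm]
    abel

theorem CDerEnd.comm_swap (x y : CDerEnd C) : CDerEnd.comm x y = - CDerEnd.comm y x := by
  apply Subtype.ext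
  refine Prod.ext ?_ ?_
  · simp [CDerEnd.comm]
  · simp [CDerEnd.comm]

theorem CDerEnd.comm_smul_right (x : CDerEnd C) (r : R) (y : CDerEnd C) :
    CDerEnd.comm x (r • y) = r • CDerEnd.comm x y + x.1.1 r • y := by
  apply Subtype.ext
  refine Prod.ext ?_ ?_
  · ext s
    simp [CDerEnd.comm, Derivation.commutator_apply]
  · ext w
    have h := x.2.1 r (y.1.2 w)
    simp [CDerEnd.comm, h, smul_sub]
    abel

theorem CDerEnd.comm_add_right (x y z : CDerEnd C) :
    CDerEnd.comm x (y + z) = CDerEnd.comm x y + CDerEnd.comm x z := by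
  rw [CDerEnd.comm_swap, CDerEnd.comm_add_left, CDerEnd.comm_swap x y, CDerEnd.comm_swap x z,
    neg_add]

theorem CDerEnd.comm_smul_left (r : R) (x y : CDerEnd C) :
    CDerEnd.comm (r • x) y = r • CDerEnd.comm x y - y.1.1 r • x := by
  rw [CDerEnd.comm_swap, CDerEnd.comm_smul_right, CDerEnd.comm_swap x y, smul_neg]
  abel

theorem lam_smul (y : CDerEnd C) (r : R) (a : ExteriorAlgebra R W) :
    lam C y (r • a) = y.1.1 r • a + r • lam C y a :=
  extDer_smul_right _ r a

/-- The bracket of `ω δ` with an arbitrary element. -/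
def brAux (b : ExteriorAlgebra R W) (y : CDerEnd C) : Lmod C →+ Lmod C :=
  TensorProduct.liftAddHom
    (AddMonoidHom.mk' (fun b' => AddMonoidHom.mk' (fun y' => brTerm b y b' y') (by
        intro x z
        simp only [brTerm, CDerEnd.comm_add_right, TensorProduct.tmul_add, map_add, add_mul,
          TensorProduct.add_tmul, LinearMap.add_apply]
        abel)) (by
      intro x z
      ext y'
      simp only [brTerm, mul_add, TensorProduct.add_tmul, map_add, AddMonoidHom.mk'_apply,
        AddMonoidHom.add_apply]
      abel))
    (by
      intro r b' y'
      simp only [brTerm, AddMonoidHom.mk'_apply, CDerEnd.comm_smul_right, lam_smul,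
        map_smul, LinearMap.smul_apply, mul_smul_comm, mul_add,
        TensorProduct.add_tmul, TensorProduct.tmul_add, TensorProduct.tmul_smul,
        TensorProduct.smul_tmul', smul_mul_assoc]
      abel)

theorem brAux_tmul (b : ExteriorAlgebra R W) (y : CDerEnd C) (b' : ExteriorAlgebra R W)
    (y' : CDerEnd C) : brAux b y (b' ⊗ₜ[R] y') = brTerm b y b' y' := rfl

variable (C) in
/-- The bracket `[ωδ,ω'δ'] = ωω'[δ,δ'] + (ω λ(δ)(ω'))δ' - (λ(δ')(ω)ω')δ`. -/
def bracket : Lmod C →+ Lmod C →+ Lmod C :=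
  TensorProduct.liftAddHom
    (AddMonoidHom.mk' (fun b => AddMonoidHom.mk' (fun y => brAux b y) (by
        intro x z
        refine AddMonoidHom.ext fun t => ?_
        induction t using TensorProduct.induction_on with
        | zero => simp
        | tmul b' y' =>
          simp only [AddMonoidHom.add_apply, brAux_tmul, brTerm, CDerEnd.comm_add_left,
            TensorProduct.tmul_add, map_add, LinearMap.add_apply, mul_add, TensorProduct.add_tmul]
          abel
        | add s t hs ht => rw [map_add, map_add, hs, ht])) (by
      intro x z
      refine AddMonoidHom.ext fun y => AddMonoidHom.ext fun t => ?_
      simp only [AddMonoidHom.mk'_apply, AddMonoidHom.add_apply]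
      induction t using TensorProduct.induction_on with
      | zero => simp
      | tmul b' y' =>
        simp only [brAux_tmul, brTerm, add_mul, TensorProduct.add_tmul, map_add]
        abel
      | add s t hs ht => rw [map_add, map_add, map_add, hs, ht]; abel))
    (by
      intro r b y
      refine AddMonoidHom.ext fun t => ?_
      simp only [AddMonoidHom.mk'_apply]
      induction t using TensorProduct.induction_on with
      | zero => simp
      | tmul b' y' =>
        simp only [brAux_tmul, brTerm, CDerEnd.comm_smul_left, lam_smul, map_smul,
          LinearMap.smul_apply, mul_smul_comm, smul_mul_assoc, add_mul,
          TensorProduct.add_tmul, TensorProduct.tmul_sub, TensorProduct.tmul_smul,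
          TensorProduct.smul_tmul']
        abel
      | add s t hs ht => rw [map_add, map_add, hs, ht])

theorem bracket_tmul (b : ExteriorAlgebra R W) (y : CDerEnd C) (b' : ExteriorAlgebra R W)
    (y' : CDerEnd C) : bracket C (b ⊗ₜ[R] y) (b' ⊗ₜ[R] y') =
      (b * b') ⊗ₜ[R] CDerEnd.comm y y' + (b * lam C y b') ⊗ₜ[R] y'
        - (lam C y' b * b') ⊗ₜ[R] y := rfl

end Laoid

section Filtered

variable {R W : Type*} [CommRing R] [AddCommGroup W] [Module R W] (Q : QuadraticForm R W)

/-- The filtration of the Clifford algebra: products of at most `k` vectors. -/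
def clFil : ℤ → Submodule R (CliffordAlgebra Q)
  | .ofNat n => (1 ⊔ LinearMap.range (CliffordAlgebra.ι Q)) ^ n
  | .negSucc _ => ⊥

variable (R W) in
/-- The grading of the exterior algebra, with index set `ℤ`. -/
def extGr : ℤ → Submodule R (ExteriorAlgebra R W)
  | .ofNat n => ⋀[R]^n W
  | .negSucc _ => ⊥

theorem clFil_mono : Monotone (clFil Q) := by
  intro i j h
  match i, j, h with
  | .negSucc _, _, _ => exact bot_le
  | .ofNat m, .negSucc n, h => exact absurd h (by simp; omega)
  | .ofNat m, .ofNat n, h => exact pow_le_pow_right₀ le_sup_left (Int.ofNat_le.1 h)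

theorem ι_mul_mem_clFil (w : W) (k : ℤ) (a : CliffordAlgebra Q) (ha : a ∈ clFil Q k) :
    CliffordAlgebra.ι Q w * a ∈ clFil Q (k + 1) := by
  match k, ha with
  | .negSucc n, ha =>
    have : a = 0 := ha
    rw [this, mul_zero]
    exact zero_mem _
  | .ofNat n, ha =>
    change _ ∈ (1 ⊔ LinearMap.range (CliffordAlgebra.ι Q)) ^ (n + 1)
    rw [pow_succ']
    exact Submodule.mul_mem_mul (Submodule.mem_sup_right ⟨w, rfl⟩) ha

/-- A filtration, indexed by `ℤ`, of a module over the filtered algebra `Cl`. Since `Cl` is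
generated by `W`, the second condition says that multiplication respects the filtrations. -/
structure ClFiltration (X : Type*) [AddCommGroup X] [Module R X] [Module (CliffordAlgebra Q) X] where
  F : ℤ → Submodule R X
  mono : Monotone F
  ι_smul_mem : ∀ (w : W) (k : ℤ) (x : X), x ∈ F k → CliffordAlgebra.ι Q w • x ∈ F (k + 1)

variable {Q}
variable {X Y : Type*} [AddCommGroup X] [Module R X] [Module (CliffordAlgebra Q) X]
  [IsScalarTower R (CliffordAlgebra Q) X] [AddCommGroup Y] [Module R Y]
  [Module (CliffordAlgebra Q) Y] [IsScalarTower R (CliffordAlgebra Q) Y]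

namespace ClFiltration

/-- The degree `k` part `X^{≤k} / X^{≤k-1}` of the associated graded. -/
abbrev piece (Φ : ClFiltration Q X) (k : ℤ) : Type _ :=
  Φ.F k ⧸ (Φ.F (k - 1)).submoduleOf (Φ.F k)

/-- The associated graded module. -/
def Gr (Φ : ClFiltration Q X) : Type _ := ⨁ k : ℤ, Φ.piece k

variable (Φ : ClFiltration Q X) (Ψ : ClFiltration Q Y)

instance : AddCommGroup Φ.Gr := inferInstanceAs (AddCommGroup (⨁ k : ℤ, Φ.piece k))
instance : Module R Φ.Gr := inferInstanceAs (Module R (⨁ k : ℤ, Φ.piece k))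

/-- The class of `x ∈ X^{≤k}` in degree `k` of the associated graded. -/
def symb (k : ℤ) : Φ.F k →ₗ[R] Φ.Gr :=
  (DirectSum.lof R ℤ Φ.piece k) ∘ₗ ((Φ.F (k - 1)).submoduleOf (Φ.F k)).mkQ

/-- The homogeneous submodule of degree `k` of the associated graded. -/
def grPiece (k : ℤ) : Submodule R Φ.Gr := LinearMap.range (Φ.symb k)

theorem symb_eq_zero (k : ℤ) (x : Φ.F k) (hx : (x : X) ∈ Φ.F (k - 1)) : Φ.symb k x = 0 := by
  have : ((Φ.F (k - 1)).submoduleOf (Φ.F k)).mkQ x = 0 := by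
    rw [Submodule.mkQ_apply, Submodule.Quotient.mk_eq_zero]
    exact hx
  change DirectSum.lof R ℤ Φ.piece k (((Φ.F (k - 1)).submoduleOf (Φ.F k)).mkQ x) = 0
  rw [this, map_zero]

variable {Φ} in
/-- Maps out of the associated graded. -/
def grLift {N : Type*} [AddCommGroup N] [Module R N] (φ : ∀ k, Φ.F k →ₗ[R] N)
    (h : ∀ k (x : Φ.F k), (x : X) ∈ Φ.F (k - 1) → φ k x = 0) : Φ.Gr →ₗ[R] N :=
  DirectSum.toModule R ℤ N fun k => Submodule.liftQ _ (φ k) (fun x hx => h k x hx)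

variable {Φ} in
theorem grLift_symb {N : Type*} [AddCommGroup N] [Module R N] (φ : ∀ k, Φ.F k →ₗ[R] N)
    (h : ∀ k (x : Φ.F k), (x : X) ∈ Φ.F (k - 1) → φ k x = 0) (k : ℤ) (x : Φ.F k) :
    grLift φ h (Φ.symb k x) = φ k x := by
  exact (DirectSum.toModule_lof R (ι := ℤ) (M := Φ.piece) (φ := fun k =>
    Submodule.liftQ _ (φ k) (fun x hx => h k x hx)) k _).trans rfl

variable {Φ} in
theorem gr_ext {N : Type*} [AddCommGroup N] [Module R N] {φ ψ : Φ.Gr →ₗ[R] N}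
    (h : ∀ k x, φ (Φ.symb k x) = ψ (Φ.symb k x)) : φ = ψ := by
  refine DirectSum.linearMap_ext R fun k => ?_
  refine Submodule.linearMap_qext _ ?_
  exact LinearMap.ext fun x => h k x

/-- Left multiplication by `w` as a map `X^{≤k} → X^{≤k+1}`. -/
def mulι (w : W) (k : ℤ) : Φ.F k →ₗ[R] Φ.F (k + 1) where
  toFun x := ⟨CliffordAlgebra.ι Q w • (x : X), Φ.ι_smul_mem w k x x.2⟩
  map_add' _ _ := Subtype.ext (smul_add _ _ _)
  map_smul' r x := Subtype.ext (smul_comm _ r (x : X))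

/-- The action of `W` on the associated graded. -/
def grι : W →ₗ[R] Module.End R Φ.Gr where
  toFun w := grLift (fun k => Φ.symb (k + 1) ∘ₗ Φ.mulι w k) (by
    intro k x hx
    refine Φ.symb_eq_zero _ _ ?_
    have := Φ.ι_smul_mem w _ _ hx
    exact Φ.mono (by omega) this)
  map_add' v w := by
    refine gr_ext fun k x => ?_
    rw [LinearMap.add_apply, grLift_symb, grLift_symb, grLift_symb, LinearMap.comp_apply,
      LinearMap.comp_apply, LinearMap.comp_apply, ← map_add]
    congr 1
    apply Subtype.ext
    change CliffordAlgebra.ι Q (v + w) • (x : X) = _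
    rw [map_add, add_smul]
    rfl
  map_smul' r w := by
    refine gr_ext fun k x => ?_
    rw [RingHom.id_apply, LinearMap.smul_apply, grLift_symb, grLift_symb, LinearMap.comp_apply,
      LinearMap.comp_apply, ← map_smul]
    congr 1
    apply Subtype.ext
    change CliffordAlgebra.ι Q (r • w) • (x : X) = r • CliffordAlgebra.ι Q w • (x : X)
    rw [map_smul, smul_assoc]

theorem grι_symb (w : W) (k : ℤ) (x : Φ.F k) :
    Φ.grι w (Φ.symb k x) = Φ.symb (k + 1) (Φ.mulι w k x) := grLift_symb _ _ k x

/-- The action of `⋀ W = Gr Cl` on the associated graded. -/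
def grAct : ExteriorAlgebra R W →ₐ[R] Module.End R Φ.Gr :=
  ExteriorAlgebra.lift R ⟨Φ.grι, fun w => by
    refine gr_ext fun k x => ?_
    rw [Module.End.mul_apply, grι_symb, grι_symb, LinearMap.zero_apply]
    refine Φ.symb_eq_zero _ _ ?_
    change CliffordAlgebra.ι Q w • CliffordAlgebra.ι Q w • (x : X) ∈ _
    rw [← mul_smul, CliffordAlgebra.ι_sq_scalar, algebraMap_smul]
    exact Submodule.smul_mem _ _ (Φ.mono (by omega) x.2)⟩

instance : Module (ExteriorAlgebra R W) Φ.Gr :=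
  Module.compHom Φ.Gr (Φ.grAct : ExteriorAlgebra R W →+* Module.End R Φ.Gr)

theorem ext_smul_def (a : ExteriorAlgebra R W) (x : Φ.Gr) : a • x = Φ.grAct a x := rfl

instance : IsScalarTower R (ExteriorAlgebra R W) Φ.Gr where
  smul_assoc r a x := by
    rw [ext_smul_def, ext_smul_def, map_smul, LinearMap.smul_apply]

theorem ι_smul_symb (w : W) (k : ℤ) (x : Φ.F k) :
    ExteriorAlgebra.ι R w • Φ.symb k x = Φ.symb (k + 1) (Φ.mulι w k x) := by
  rw [ext_smul_def, grAct, ExteriorAlgebra.lift_ι_apply, grι_symb]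

theorem linear_of_ι {M N : Type*} [AddCommGroup M] [Module R M] [Module (ExteriorAlgebra R W) M]
    [IsScalarTower R (ExteriorAlgebra R W) M] [AddCommGroup N] [Module R N]
    [Module (ExteriorAlgebra R W) N] [IsScalarTower R (ExteriorAlgebra R W) N] (φ : M →ₗ[R] N)
    (h : ∀ (w : W) (x : M), φ (ExteriorAlgebra.ι R w • x) = ExteriorAlgebra.ι R w • φ x)
    (a : ExteriorAlgebra R W) : ∀ x, φ (a • x) = a • φ x := by
  induction a using ExteriorAlgebra.induction with
  | algebraMap r => intro x; rw [algebraMap_smul, algebraMap_smul, map_smul]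
  | ι w => exact h w
  | mul a b ha hb => intro x; rw [mul_smul, mul_smul, ha, hb]
  | add a b ha hb => intro x; rw [add_smul, add_smul, map_add, ha, hb]

/-- The functor `Gr` on morphisms of filtered modules. -/
def grMap (φ : X →ₗ[CliffordAlgebra Q] Y) (h : ∀ k, ∀ x ∈ Φ.F k, φ x ∈ Ψ.F k) :
    Φ.Gr →ₗ[ExteriorAlgebra R W] Ψ.Gr :=
  let φ' : Φ.Gr →ₗ[R] Ψ.Gr := grLift
    (fun k => Ψ.symb k ∘ₗ ((φ.restrictScalars R).restrict (h k)))
    (fun k x hx => Ψ.symb_eq_zero _ _ (h _ _ hx))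
  { toFun := φ'
    map_add' := φ'.map_add
    map_smul' := linear_of_ι φ' (by
      intro w x
      have : φ' ∘ₗ Φ.grAct (ExteriorAlgebra.ι R w) = Ψ.grAct (ExteriorAlgebra.ι R w) ∘ₗ φ' := by
        refine gr_ext fun k x => ?_
        rw [LinearMap.comp_apply, LinearMap.comp_apply, ← ext_smul_def, ← ext_smul_def, ι_smul_symb,
          grLift_symb, grLift_symb, LinearMap.comp_apply, LinearMap.comp_apply, ι_smul_symb]
        congr 1
        exact Subtype.ext (map_smul φ _ _)
      exact LinearMap.congr_fun this x) }

theorem grMap_symb (φ : X →ₗ[CliffordAlgebra Q] Y) (h : ∀ k, ∀ x ∈ Φ.F k, φ x ∈ Ψ.F k)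
    (k : ℤ) (x : Φ.F k) :
    grMap Φ Ψ φ h (Φ.symb k x) = Ψ.symb k ⟨φ x, h k x x.2⟩ := grLift_symb _ _ k x

/-- The induced filtration of a submodule. -/
def sub (N : Submodule (CliffordAlgebra Q) X) : ClFiltration Q N where
  F k := (Φ.F k).comap (N.subtype.restrictScalars R)
  mono _ _ h := Submodule.comap_mono (Φ.mono h)
  ι_smul_mem w k x hx := Φ.ι_smul_mem w k x hx

/-- The induced filtration of a quotient module. -/
def quot (N : Submodule (CliffordAlgebra Q) X) : ClFiltration Q (X ⧸ N) where
  F k := (Φ.F k).map (N.mkQ.restrictScalars R)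
  mono _ _ h := Submodule.map_mono (Φ.mono h)
  ι_smul_mem := by
    rintro w k _ ⟨x, hx, rfl⟩
    exact ⟨_, Φ.ι_smul_mem w k x hx, map_smul N.mkQ _ _⟩

/-- `Gr N → Gr X` for a submodule `N` with the induced filtration. -/
def grIncl (N : Submodule (CliffordAlgebra Q) X) :
    (Φ.sub N).Gr →ₗ[ExteriorAlgebra R W] Φ.Gr :=
  grMap (Φ.sub N) Φ N.subtype (fun _ _ hx => hx)

/-- `Gr X → Gr (X / N)` for a quotient with the induced filtration. -/
def grProj (N : Submodule (CliffordAlgebra Q) X) :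
    Φ.Gr →ₗ[ExteriorAlgebra R W] (Φ.quot N).Gr :=
  grMap Φ (Φ.quot N) N.mkQ (fun _ _ hx => ⟨_, hx, rfl⟩)

end ClFiltration

variable (Q) in
/-- The filtration of `Cl ⊗ D` for an `R`-module `D`. -/
def tensorFil (D : Type*) [AddCommGroup D] [Module R D] :
    ClFiltration Q (CliffordAlgebra Q ⊗[R] D) where
  F k := tensorRange D (clFil Q k)
  mono _ _ h := tensorRange_mono (clFil_mono Q h)
  ι_smul_mem w k _ hx := smul_mem_tensorRange (ι_mul_mem_clFil Q w k) hx

end Filtered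

section Objects

variable {R W : Type*} [CommRing R] [Algebra ℝ R] [AddCommGroup W] [Module R W]
  [Module ℝ W] [IsScalarTower ℝ R W]

/-- The quadratic form `w ↦ -⟨w,w⟩`; its Clifford algebra has the relations
`wv + vw + 2⟨v,w⟩ = 0`. -/
def negQuad (g : LinearMap.BilinForm R W) : QuadraticForm R W :=
  -(LinearMap.BilinMap.toQuadraticMap g)

/-- The Clifford algebra `Cl(W)` for the representative `g`. -/
abbrev Cl (g : LinearMap.BilinForm R W) : Type _ := CliffordAlgebra (negQuad g)

/-- The subspace `Cl^{≤k} ∩ Cl^{odd}` for `k` odd, `Cl^{≤k} ∩ Cl^{even}` for `k` even. -/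
def clTri (g : LinearMap.BilinForm R W) (k : ℤ) : Submodule R (Cl g) :=
  clFil (negQuad g) k ⊓ CliffordAlgebra.evenOdd (negQuad g) (k : ZMod 2)

variable (R W) in
/-- The module `Ω = ⋀⁴ W`. -/
abbrev Om : Type _ := ⋀[R]^4 W

/-- The Clifford module of triples `δ_{C^∞} ⊕ δ_W ⊕ δ_Ω` satisfying the Leibniz rules. -/
def Pbar (g : LinearMap.BilinForm R W) :
    Submodule (Cl g) ((R →ₗ[ℝ] Cl g) × (W →ₗ[ℝ] Cl g) × (Om R W →ₗ[ℝ] Cl g ⊗[R] Om R W)) where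
  carrier := {δ |
    (∀ r s : R, δ.1 (r * s) = s • δ.1 r + r • δ.1 s) ∧
    (∀ (r : R) (w : W),
      δ.2.1 (r • w) = δ.1 r * CliffordAlgebra.ι (negQuad g) w + r • δ.2.1 w) ∧
    (∀ (r : R) (η : Om R W), δ.2.2 (r • η) = δ.1 r ⊗ₜ[R] η + r • δ.2.2 η)}
  zero_mem' := by
    refine ⟨fun r s => ?_, fun r w => ?_, fun r η => ?_⟩ <;> simp
  add_mem' := by
    rintro x y ⟨h1, h2, h3⟩ ⟨k1, k2, k3⟩
    refine ⟨fun r s => ?_, fun r w => ?_, fun r η => ?_⟩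
    · simp only [Prod.fst_add, LinearMap.add_apply, h1, k1, smul_add]
      abel
    · simp only [Prod.fst_add, Prod.snd_add, LinearMap.add_apply, h2, k2, smul_add, add_mul]
      abel
    · simp only [Prod.fst_add, Prod.snd_add, LinearMap.add_apply, h3, k3, smul_add,
        TensorProduct.add_tmul]
      abel
  smul_mem' := by
    rintro a x ⟨h1, h2, h3⟩
    refine ⟨fun r s => ?_, fun r w => ?_, fun r η => ?_⟩
    · simp only [Prod.smul_fst, LinearMap.smul_apply, h1, smul_add, smul_comm a]
    · simp only [Prod.smul_fst, Prod.smul_snd, LinearMap.smul_apply, h2, smul_eq_mul, mul_assoc,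
        mul_add, mul_smul_comm]
    · simp only [Prod.smul_fst, Prod.smul_snd, LinearMap.smul_apply, h3, smul_add, smul_comm a,
        TensorProduct.smul_tmul']

/-- The part `P̄^{◁k}` of `P̄`; filtration and parity of `P̄` are determined by
`P̄^{≤k} = P̄^{◁k} ⊕ P̄^{◁k-1}`. -/
def pbarTri (g : LinearMap.BilinForm R W) (k : ℤ) : Set (Pbar g) :=
  {δ | (∀ r, δ.1.1 r ∈ clTri g k) ∧ (∀ w, δ.1.2.1 w ∈ clTri g (k + 1)) ∧
    (∀ η, δ.1.2.2 η ∈ tensorRange (Om R W) (clTri g k))}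

variable (C : Set (LinearMap.BilinForm R W)) (g : LinearMap.BilinForm R W)

/-- The Clifford module `L̄ = Cl ⊗ CDerEnd(W)`. -/
abbrev Lbar : Type _ := Cl g ⊗[R] CDerEnd C

/-- The filtration of `L̄`. -/
def lbarFil : ClFiltration (negQuad g) (Lbar C g) := tensorFil (negQuad g) (CDerEnd C)

/-- The part `L̄^{◁k}`: elements of `L̄^{≤k}` whose parity is that of `k`. -/
def lbarTri (k : ℤ) : Submodule R (Lbar C g) :=
  (lbarFil C g).F k ⊓ tensorRange (CDerEnd C) (CliffordAlgebra.evenOdd (negQuad g) (k : ZMod 2))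

/-- The action of a module derivation on `Ω`. -/
def omDer : CDerEnd C →ₗ[R] (Om R W →ₗ[ℝ] Om R W) where
  toFun δ := (lam C δ).restrict (p := (⋀[R]^4 W).restrictScalars ℝ)
    (q := (⋀[R]^4 W).restrictScalars ℝ) (fun η hη => extDer_mem ⟨δ.1, δ.2.1⟩ 4 η hη)
  map_add' δ ε := by
    ext η
    exact LinearMap.congr_fun (map_add (lam C) δ ε) η.1
  map_smul' r δ := by
    ext η
    exact LinearMap.congr_fun (map_smul (lam C) r δ) η.1

/-- The `C^∞`-linear map `δ ↦ δ_{C^∞} ⊕ δ_W ⊕ δ_Ω` that defines `f`. -/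
def fAux : CDerEnd C →ₗ[R] Pbar g where
  toFun δ := ⟨(((Algebra.linearMap R (Cl g)).restrictScalars ℝ) ∘ₗ (δ.1.1 : R →ₗ[ℝ] R),
      ((CliffordAlgebra.ι (negQuad g)).restrictScalars ℝ) ∘ₗ δ.1.2,
      ((TensorProduct.mk R (Cl g) (Om R W) 1).restrictScalars ℝ) ∘ₗ omDer C δ), by
    refine ⟨fun r s => ?_, fun r w => ?_, fun r η => ?_⟩
    · simp [Algebra.smul_def, add_comm]
    · have h := δ.2.1 r w
      simp [h, Algebra.smul_def]
    · have h : omDer C δ (r • η) = δ.1.1 r • η + r • omDer C δ η :=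
        Subtype.ext (lam_smul δ r η.1)
      simp only [LinearMap.comp_apply, LinearMap.restrictScalars_apply, h, map_add, map_smul,
        TensorProduct.mk_apply, Derivation.coeFn_coe, Algebra.linearMap_apply]
      rw [Algebra.algebraMap_eq_smul_one, TensorProduct.smul_tmul', TensorProduct.smul_tmul']⟩
  map_add' δ ε := by
    refine Subtype.ext (Prod.ext ?_ (Prod.ext ?_ ?_))
    · ext r; simp
    · ext w; simp
    · refine LinearMap.ext fun η => ?_
      simp [TensorProduct.tmul_add]
  map_smul' c δ := by
    refine Subtype.ext (Prod.ext ?_ (Prod.ext ?_ ?_))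
    · ext r; simp [Algebra.smul_def]
    · ext w; simp
    · refine LinearMap.ext fun η => ?_
      simp

/-- The morphism `f : L̄ → P̄`, `ωδ ↦ δ_{C^∞} ⊕ δ_W ⊕ δ_Ω`, where `δ_{C^∞} = ω δ(-)`,
`δ_W = ω δ(-)` and `δ_Ω = ω ⊗ δ(-)`. -/
def fMor : Lbar C g →ₗ[Cl g] Pbar g := baseLift (R := R) (A := Cl g) (D := CDerEnd C) (N := Pbar g) (fAux C g)

/-- The kernel `Ī` of `f`. -/
def Ibar : Submodule (Cl g) (Lbar C g) := LinearMap.ker (fMor C g)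

/-- `Gr Ī → Gr L̄`. -/
abbrev grIbar : ((lbarFil C g).sub (Ibar C g)).Gr →ₗ[ExteriorAlgebra R W] (lbarFil C g).Gr :=
  (lbarFil C g).grIncl (Ibar C g)

/-- `Gr L̄ → Gr Ē` for `Ē = L̄ / Ī`. -/
abbrev grEbar : (lbarFil C g).Gr →ₗ[ExteriorAlgebra R W] ((lbarFil C g).quot (Ibar C g)).Gr :=
  (lbarFil C g).grProj (Ibar C g)

theorem one_tmul_mem (δ : CDerEnd C) : (1 : Cl g) ⊗ₜ[R] δ ∈ (lbarFil C g).F 0 :=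
  tmul_mem_tensorRange (Submodule.one_le.1 (le_of_eq (pow_zero _).symm)) δ

/-- The canonical map `L → Gr L̄`, inverse to the isomorphism `i`: it is the `⋀ W`-linear map that
sends `1 ⊗ δ` to the class of `1 ⊗ δ` in degree zero, hence `(w₁ ∧ ⋯ ∧ wₖ) ⊗ δ` to the class of
`w₁ ⋯ wₖ ⊗ δ` in degree `k`. -/
def canon : Lmod C →ₗ[ExteriorAlgebra R W] (lbarFil C g).Gr :=
  baseLift
    { toFun := fun δ => (lbarFil C g).symb 0 ⟨1 ⊗ₜ[R] δ, one_tmul_mem C g δ⟩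
      map_add' := fun δ ε => by
        rw [← map_add]
        exact congrArg _ (Subtype.ext (TensorProduct.tmul_add _ _ _))
      map_smul' := fun r δ => by
        rw [RingHom.id_apply, ← map_smul]
        exact congrArg _ (Subtype.ext (TensorProduct.tmul_smul _ _ _)) }

/-- The submodule `I = i(Gr Ī)` of `L`. -/
def idealI : Submodule (ExteriorAlgebra R W) (Lmod C) :=
  (LinearMap.range (grIbar C g)).comap (canon C g)

/-- The homogeneous part `L^k` of `L`. -/
def lGr (k : ℤ) : Submodule R (Lmod C) := tensorRange (CDerEnd C) (extGr R W k)

/-- The homogeneous part `I^k` of `I`. -/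
def iGr (k : ℤ) : Submodule R (Lmod C) := (idealI C g).restrictScalars R ⊓ lGr C k

/-- The quotient `E = L / I`. -/
abbrev Emod : Type _ := Lmod C ⧸ idealI C g

/-- The homogeneous part `E^k` of `E`, the image of `L^k`. -/
def eGr (k : ℤ) : Submodule ℝ (Emod C g) :=
  ((lGr C k).restrictScalars ℝ).map ((idealI C g).mkQ.restrictScalars ℝ)

end Objects

section GradedLieAlgebroid

/-- The axioms of an `A`-graded Lie algebroid on the `A`-module `X`, where `A` is a graded
commutative real algebra with homogeneous parts `𝒜 k`, and `X` has homogeneous parts `𝒳 k`,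
bracket `br` and anchor `ρ`. -/
structure IsGLaoid {A X : Type*} [Ring A] [Algebra ℝ A] [AddCommGroup X] [Module ℝ X] [Module A X]
    (𝒜 : ℤ → Submodule ℝ A) (𝒳 : ℤ → Submodule ℝ X) (br : X →ₗ[ℝ] X →ₗ[ℝ] X)
    (ρ : X →ₗ[A] (A →ₗ[ℝ] A)) : Prop where
  internal : DirectSum.IsInternal 𝒳
  smul_mem : ∀ i j, ∀ a ∈ 𝒜 i, ∀ x ∈ 𝒳 j, a • x ∈ 𝒳 (i + j)
  br_mem : ∀ i j, ∀ x ∈ 𝒳 i, ∀ y ∈ 𝒳 j, br x y ∈ 𝒳 (i + j)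
  br_skew : ∀ i j, ∀ x ∈ 𝒳 i, ∀ y ∈ 𝒳 j, br x y = -((i * j).negOnePow • br y x)
  jacobi : ∀ i j k, ∀ x ∈ 𝒳 i, ∀ y ∈ 𝒳 j, ∀ z ∈ 𝒳 k,
    br x (br y z) + (i * (j + k)).negOnePow • br y (br z x)
      + (k * (i + j)).negOnePow • br z (br x y) = 0
  anchor_mem : ∀ i j, ∀ x ∈ 𝒳 i, ∀ a ∈ 𝒜 j, ρ x a ∈ 𝒜 (i + j)
  anchor_mul : ∀ i j, ∀ x ∈ 𝒳 i, ∀ a ∈ 𝒜 j, ∀ b,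
    ρ x (a * b) = ρ x a * b + (i * j).negOnePow • (a * ρ x b)
  anchor_br : ∀ i j, ∀ x ∈ 𝒳 i, ∀ y ∈ 𝒳 j,
    ρ (br x y) = ρ x ∘ₗ ρ y - (i * j).negOnePow • (ρ y ∘ₗ ρ x)
  leibniz : ∀ i j, ∀ x ∈ 𝒳 i, ∀ a ∈ 𝒜 j, ∀ y,
    br x (a • y) = ρ x a • y + (i * j).negOnePow • (a • br x y)

end GradedLieAlgebroid

section Frames

variable {R W : Type*} [CommRing R] [Algebra ℝ R] [AddCommGroup W] [Module R W]
  [Module ℝ W] [IsScalarTower ℝ R W]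

/-- The matrix of the inner product in an orthonormal basis. -/
def eta : Matrix (Fin 4) (Fin 4) ℝ := Matrix.diagonal ![-1, 1, 1, 1]

/-- A basis of `W` that is orthonormal for some representative. -/
def IsConfOrthonormal (C : Set (LinearMap.BilinForm R W)) (θ : Module.Basis (Fin 4) R W) : Prop :=
  ∃ g ∈ C, ∀ i j, g (θ i) (θ j) = algebraMap ℝ R (eta i j)

/-- The boosts: `boost θ 0`, `boost θ 1`, `boost θ 2` are `σ₁`, `σ₂`, `σ₃`. -/
def boost (θ : Module.Basis (Fin 4) R W) (a : Fin 3) : W →ₗ[R] W :=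
  θ.constr R (Fin.cons (θ a.succ) (fun j : Fin 3 => if a = j then θ 0 else 0))

/-- The rotations: `rot θ 0`, `rot θ 1`, `rot θ 2` are `σ₂₃`, `σ₃₁`, `σ₁₂`
(the index `a` is cyclic). -/
def rot (θ : Module.Basis (Fin 4) R W) (a : Fin 3) : W →ₗ[R] W :=
  θ.constr R (Fin.cons 0 (fun k : Fin 3 =>
    (if a + 2 = k then θ (a + 1).succ else 0) - (if a + 1 = k then θ (a + 2).succ else 0)))

/-- A `C^∞`-linear endomorphism that is skew for all representatives, as an element of
`CDerEnd(W)`. -/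
def vertical {C : Set (LinearMap.BilinForm R W)} (T : W →ₗ[R] W)
    (h : ∀ g ∈ C, ∀ x y, g (T x) y + g x (T y) = 0) : CDerEnd C :=
  ⟨(0, T.restrictScalars ℝ), fun r w => by simp, fun g hg => ⟨0, fun x y => by
    simp [h g hg x y]⟩⟩

theorem skew_of_basis {C : Set (LinearMap.BilinForm R W)}
    (hC : ∀ g ∈ C, ∀ g' ∈ C, ∃ u : R, g' = u • g) {θ : Module.Basis (Fin 4) R W} (T : W →ₗ[R] W)
    (h : ∀ g : LinearMap.BilinForm R W, (∀ i j, g (θ i) (θ j) = algebraMap ℝ R (eta i j)) →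
      ∀ i j, g (T (θ i)) (θ j) + g (θ i) (T (θ j)) = 0)
    (hθ : IsConfOrthonormal C θ) : ∀ g ∈ C, ∀ x y, g (T x) y + g x (T y) = 0 := by
  obtain ⟨g₀, hg₀, hb⟩ := hθ
  have key : g₀ ∘ₗ T + g₀.compl₂ T = 0 :=
    θ.ext fun i => θ.ext fun j => by simpa using h g₀ hb i j
  intro g hg x y
  obtain ⟨u, rfl⟩ := hC g₀ hg₀ g hg
  have := LinearMap.congr_fun (LinearMap.congr_fun key x) y
  simp only [LinearMap.add_apply, LinearMap.comp_apply, LinearMap.compl₂_apply,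
    LinearMap.zero_apply] at this
  simp only [LinearMap.smul_apply, ← smul_add, this, smul_zero]

theorem eta_zero_zero : eta 0 0 = -1 := by simp [eta]

theorem eta_zero_succ (j : Fin 3) : eta 0 j.succ = 0 := by
  simp [eta, (Fin.succ_ne_zero j).symm]

theorem eta_succ_zero (j : Fin 3) : eta j.succ 0 = 0 := by
  simp [eta, Fin.succ_ne_zero j]

theorem eta_succ_succ (i j : Fin 3) : eta i.succ j.succ = if i = j then 1 else 0 := by
  rw [eta, Matrix.diagonal_apply]
  simp only [Fin.succ_inj]
  split_ifs with h
  · fin_cases i <;> rfl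
  · rfl

theorem boost_zero (θ : Module.Basis (Fin 4) R W) (a : Fin 3) : boost θ a (θ 0) = θ a.succ := by
  simp [boost]

theorem boost_succ (θ : Module.Basis (Fin 4) R W) (a j : Fin 3) :
    boost θ a (θ j.succ) = if a = j then θ 0 else 0 := by
  rw [boost, Module.Basis.constr_basis, Fin.cons_succ]

theorem rot_zero (θ : Module.Basis (Fin 4) R W) (a : Fin 3) : rot θ a (θ 0) = 0 := by
  simp [rot]

theorem rot_succ (θ : Module.Basis (Fin 4) R W) (a k : Fin 3) :
    rot θ a (θ k.succ) =
      (if a + 2 = k then θ (a + 1).succ else 0) - (if a + 1 = k then θ (a + 2).succ else 0) := by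
  rw [rot, Module.Basis.constr_basis, Fin.cons_succ]

theorem boost_skew (θ : Module.Basis (Fin 4) R W) (a : Fin 3) (g : LinearMap.BilinForm R W)
    (hg : ∀ i j, g (θ i) (θ j) = algebraMap ℝ R (eta i j)) (i j : Fin 4) :
    g (boost θ a (θ i)) (θ j) + g (θ i) (boost θ a (θ j)) = 0 := by
  refine Fin.cases ?_ (fun i => ?_) i <;> refine Fin.cases ?_ (fun j => ?_) j
  · simp [boost_zero, hg, eta_zero_succ, eta_succ_zero]
  · rw [boost_zero, boost_succ, hg, eta_succ_succ]
    split_ifs <;> simp [hg, eta_zero_zero]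
  · rw [boost_zero, boost_succ, hg, eta_succ_succ]
    simp only [eq_comm (a := i)]
    split_ifs <;> simp [hg, eta_zero_zero]
  · rw [boost_succ, boost_succ]
    split_ifs <;> simp [hg, eta_zero_succ, eta_succ_zero]

theorem rot_skew (θ : Module.Basis (Fin 4) R W) (a : Fin 3) (g : LinearMap.BilinForm R W)
    (hg : ∀ i j, g (θ i) (θ j) = algebraMap ℝ R (eta i j)) (i j : Fin 4) :
    g (rot θ a (θ i)) (θ j) + g (θ i) (rot θ a (θ j)) = 0 := by
  have h1 : ∀ (c : Prop) [Decidable c] (b k : Fin 3), g (if c then θ b.succ else 0) (θ k.succ) =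
      if c ∧ b = k then 1 else 0 := by
    intro c _ b k
    by_cases hc : c <;> simp [hc, hg, eta_succ_succ, apply_ite (algebraMap ℝ R)]
  have h2 : ∀ (c : Prop) [Decidable c] (b k : Fin 3), g (θ k.succ) (if c then θ b.succ else 0) =
      if c ∧ b = k then 1 else 0 := by
    intro c _ b k
    by_cases hc : c <;> simp [hc, hg, eta_succ_succ, apply_ite (algebraMap ℝ R), eq_comm (a := k)]
  refine Fin.cases ?_ (fun i => ?_) i <;> refine Fin.cases ?_ (fun j => ?_) j
  · simp [rot_zero]
  · rw [rot_zero, rot_succ]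
    split_ifs <;> simp [hg, eta_zero_succ]
  · rw [rot_zero, rot_succ]
    split_ifs <;> simp [hg, eta_succ_zero]
  · rw [rot_succ, rot_succ, map_sub, map_sub, LinearMap.sub_apply, h1, h1, h2, h2]
    simp only [and_comm (a := a + 2 = j), and_comm (a := a + 1 = j)]
    abel

variable {C : Set (LinearMap.BilinForm R W)} (hC : ∀ g ∈ C, ∀ g' ∈ C, ∃ u : R, g' = u • g)
  (θ : Module.Basis (Fin 4) R W) (hθ : IsConfOrthonormal C θ)

/-- The elements `σ₁`, `σ₂`, `σ₃` of `CDerEnd(W)`. -/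
def sigmaBoost (a : Fin 3) : CDerEnd C :=
  vertical (boost θ a) (skew_of_basis hC (boost θ a) (boost_skew θ a) hθ)

/-- The elements `σ₂₃`, `σ₃₁`, `σ₁₂` of `CDerEnd(W)`. -/
def sigmaRot (a : Fin 3) : CDerEnd C :=
  vertical (rot θ a) (skew_of_basis hC (rot θ a) (rot_skew θ a) hθ)

/-- `θ₀θ₁`, `θ₀θ₂`, `θ₀θ₃`. -/
def thetaRe (a : Fin 3) : ExteriorAlgebra R W :=
  ExteriorAlgebra.ι R (θ 0) * ExteriorAlgebra.ι R (θ a.succ)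

/-- `θ₂θ₃`, `θ₃θ₁`, `θ₁θ₂`. -/
def thetaIm (a : Fin 3) : ExteriorAlgebra R W :=
  ExteriorAlgebra.ι R (θ (a + 1).succ) * ExteriorAlgebra.ι R (θ (a + 2).succ)

/-- The element `Re [ ∑ (θ₀θ_a + i θ_{a+1}θ_{a+2}) S_ab (σ_b + i σ_{b+1,b+2}) ]` of `L`, the sum over
`a, b` and indices cyclic in `1, 2, 3`, written out in real and imaginary parts. -/
def weylElt (S : Matrix (Fin 3) (Fin 3) ℂ) : Lmod C :=
  ∑ a, ∑ b,
    ((S a b).re • (thetaRe θ a ⊗ₜ[R] sigmaBoost hC θ hθ b - thetaIm θ a ⊗ₜ[R] sigmaRot hC θ hθ b)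
    - (S a b).im •
      (thetaRe θ a ⊗ₜ[R] sigmaRot hC θ hθ b + thetaIm θ a ⊗ₜ[R] sigmaBoost hC θ hθ b))

/-- The real vector space of symmetric traceless complex matrices. -/
def symTraceless : Submodule ℝ (Matrix (Fin 3) (Fin 3) ℂ) where
  carrier := {S | S.IsSymm ∧ S.trace = 0}
  zero_mem' := ⟨Matrix.isSymm_zero, Matrix.trace_zero _ _⟩
  add_mem' := by
    rintro S T ⟨hS, hS'⟩ ⟨hT, hT'⟩
    exact ⟨hS.add hT, by rw [Matrix.trace_add, hS', hT', add_zero]⟩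
  smul_mem' := by
    rintro c S ⟨hS, hS'⟩
    exact ⟨hS.smul c, by rw [Matrix.trace_smul, hS', smul_zero]⟩

end Frames

section Manifold

/-- The smooth real functions on `M`. -/
abbrev Cinf (M : Type*) [TopologicalSpace M] [ChartedSpace (EuclideanSpace ℝ (Fin 4)) M] : Type _ :=
  C^∞⟮𝓡 4, M; ℝ⟯

variable (M : Type*) [TopologicalSpace M] [ChartedSpace (EuclideanSpace ℝ (Fin 4)) M]
  (W : Type*) [AddCommGroup W] [Module (Cinf M) W]

/-- A conformal inner product of signature `-+++` on the module `W` of sections of a rank 4 bundle: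
an equivalence class of symmetric bilinear forms modulo positive functions, having at every point
the matrix `diag(-1,1,1,1)` with respect to suitable vectors. -/
structure ConformalInnerProduct where
  reps : Set (LinearMap.BilinForm (Cinf M) W)
  nonempty : reps.Nonempty
  symm : ∀ g ∈ reps, ∀ x y, g x y = g y x
  signature : ∀ g ∈ reps, ∀ p : M, ∃ e : Fin 4 → W, ∀ i j, (g (e i) (e j)) p = eta i j
  conformal : ∀ g ∈ reps, ∀ g', g' ∈ reps ↔ ∃ u : Cinf M, (∀ p, 0 < u p) ∧ g' = u • g

variable {M W}

theorem ConformalInnerProduct.proportional (c : ConformalInnerProduct M W) :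
    ∀ g ∈ c.reps, ∀ g' ∈ c.reps, ∃ u : Cinf M, g' = u • g := fun g hg g' hg' =>
  let ⟨u, _, h⟩ := (c.conformal g hg g').1 hg'
  ⟨u, h⟩

end Manifold

end CliffordGR

end

/-!
The Clifford algebra of an orthonormal frame `θ₀, …, θ₃` is free on the sixteen products of distinct
`θ_i` (`monBasis`), and its filtration is given by the number of factors, so everything becomes
linear algebra over `R = C^∞`. Write `σ_b` for the boosts, `ρ_b` for the rotations and `ω` for the
product of the `θ_i`.

*The kernel of `f`.* Let `x ∈ L̄` with `f(x) = 0`. Looking at `δ_{C^∞}` and `δ_Ω`, the coefficients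
of `x` have no component along the vector fields and no scaling component, so `x` is a combination
of the `σ_b` and `ρ_b`. Looking at `δ_W(θ_j)`, it has the form `x = ∑ a_b τ_b` with
`τ_b = σ_b - ω ρ_b`, where `f(τ_b)` acts on `W` as left multiplication by `-θ₀θ_b`; hence `ker f`
corresponds to the solutions of `∑ a_b θ₀θ_b = 0` (`eq_tauSum_of_mem_Ibar`, `tauSum_mem_Ibar`). The
solutions that are combinations of bivectors are given by pairs of symmetric traceless matrices, that
is, by a complex symmetric traceless matrix `S` (`weylBar`), and every solution is obtained from them
by multiplication with at most two vectors (`gen_zero_smul_kcoef`, `sol_decomposition`). Explicit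
formulas for the solution in terms of coordinates give an `R`-linear projection `projI` of `L̄` onto
`ker f` that respects the filtrations. The point is that the boost and the rotation coordinates of
`∑ a_b τ_b` are `a_b` and `-a_b ω`, so that an element of filtration degree `k` has no components of
`a_b` of degree above `k` or below `4 - k`.

*The ideal.* Antisymmetrization of products identifies `⋀ W` with `Cl`, and hence `L` with `Gr L̄`
(`canon_bijective`). Passing to symbols, the previous paragraph yields the splitting of `Gr Ī → Gr L̄`,
`I⁰ = I¹ = 0`, the description of `I²` by the elements `m(S)` (`iGr_two`) and `I = (⋀ W) I²`
(`idealI_eq_span`).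

*Anchor and bracket.* The elements `m(S)` act on functions and on `W`, hence on `⋀ W`, by zero. By
the Leibniz rule `[L, I] ⊂ I` follows from `[δ, m(S)] = m(S')` with
`S' = δ(S) + 2 λ S + A S + S Aᵀ`, where `λ` is the scaling component of `δ` and `A` the antisymmetric
complex matrix of its Lorentz part, under the isomorphism of the Lorentz algebra with `so(3, ℂ)`
(`bracket_one_tmul_weylMap`). So bracket and anchor descend to `E = L / I`.

*Frames.* A global orthonormal frame exists (`exists_isON`): the choice of a half of the light cone
at each point is a section of a double covering of the simply connected manifold `M`, a partition of
unity produces a timelike vector field `v`, and left multiplication by the quaternion units completes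
`v` to a frame, which the Gram-Schmidt process makes orthonormal. Rescaling makes a
frame that is orthonormal for one representative orthonormal for any other, and does not change the
span of the elements `m(S)` (`weylSub_unitsSMul`).
-/

noncomputable section

namespace CliffordGR

set_option linter.unusedSectionVars false

/-! ### Associated graded modules -/

section GradedFiltered

variable {R W : Type*} [CommRing R] [AddCommGroup W] [Module R W] {Q : QuadraticForm R W}
  {X Y : Type*} [AddCommGroup X] [Module R X] [Module (CliffordAlgebra Q) X]
  [IsScalarTower R (CliffordAlgebra Q) X] [AddCommGroup Y] [Module R Y]
  [Module (CliffordAlgebra Q) Y] [IsScalarTower R (CliffordAlgebra Q) Y]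

namespace ClFiltration

variable (Φ : ClFiltration Q X) (Ψ : ClFiltration Q Y)

theorem gr_induction {P : Φ.Gr → Prop} (zero : P 0) (symb : ∀ k x, P (Φ.symb k x))
    (add : ∀ x y, P x → P y → P (x + y)) (x : Φ.Gr) : P x := by
  refine DirectSum.induction_on (β := Φ.piece) x zero (fun k y => ?_) add
  obtain ⟨y, rfl⟩ := Submodule.mkQ_surjective _ y
  exact symb k y

theorem symb_eq_zero_iff (k : ℤ) (x : Φ.F k) : Φ.symb k x = 0 ↔ (x : X) ∈ Φ.F (k - 1) := by
  refine ⟨fun h => ?_, Φ.symb_eq_zero k x⟩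
  have h2 := (DFinsupp.single_eq_zero (β := Φ.piece)).1 h
  rw [Submodule.mkQ_apply, Submodule.Quotient.mk_eq_zero] at h2
  exact h2

theorem symb_congr {k : ℤ} {x y : Φ.F k} (h : (x : X) - y ∈ Φ.F (k - 1)) :
    Φ.symb k x = Φ.symb k y := by
  rw [← sub_eq_zero, ← map_sub, symb_eq_zero_iff]
  exact h

/-- The projection of the associated graded to its degree `k` part, as an endomorphism. -/
def grComp (k : ℤ) : Φ.Gr →ₗ[R] Φ.Gr :=
  grLift (fun j => if j = k then Φ.symb j else 0) (by
    intro j x hx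
    split_ifs
    · exact Φ.symb_eq_zero _ _ hx
    · rfl)

theorem grComp_symb_self (k : ℤ) (x : Φ.F k) : Φ.grComp k (Φ.symb k x) = Φ.symb k x := by
  rw [grComp, grLift_symb, if_pos rfl]

theorem grComp_symb_ne {j k : ℤ} (h : j ≠ k) (x : Φ.F j) : Φ.grComp k (Φ.symb j x) = 0 := by
  rw [grComp, grLift_symb, if_neg h, LinearMap.zero_apply]

theorem grComp_mem (k : ℤ) (x : Φ.Gr) : Φ.grComp k x ∈ Φ.grPiece k := by
  induction x using Φ.gr_induction with
  | zero => rw [map_zero]; exact zero_mem _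
  | symb j x =>
    rcases eq_or_ne j k with rfl | h
    · rw [grComp_symb_self]; exact ⟨x, rfl⟩
    · rw [grComp_symb_ne _ h]; exact zero_mem _
  | add x y hx hy => rw [map_add]; exact add_mem hx hy

theorem grComp_of_mem {k : ℤ} {x : Φ.Gr} (hx : x ∈ Φ.grPiece k) : Φ.grComp k x = x := by
  obtain ⟨y, rfl⟩ := hx
  exact Φ.grComp_symb_self k y

theorem grComp_of_mem_ne {j k : ℤ} (h : j ≠ k) {x : Φ.Gr} (hx : x ∈ Φ.grPiece j) :
    Φ.grComp k x = 0 := by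
  obtain ⟨y, rfl⟩ := hx
  exact Φ.grComp_symb_ne h y

theorem exists_sum_grComp (x : Φ.Gr) :
    ∃ s : Finset ℤ, ∀ t, s ⊆ t → ∑ k ∈ t, Φ.grComp k x = x := by
  induction x using Φ.gr_induction with
  | zero => exact ⟨∅, fun t _ => by simp⟩
  | symb j x =>
    refine ⟨{j}, fun t ht => ?_⟩
    rw [Finset.sum_eq_single_of_mem j (ht (Finset.mem_singleton_self j)) (fun k _ hk =>
      Φ.grComp_symb_ne hk.symm x), grComp_symb_self]
  | add x y hx hy =>
    obtain ⟨s, hs⟩ := hx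
    obtain ⟨s', hs'⟩ := hy
    refine ⟨s ∪ s', fun t ht => ?_⟩
    simp only [map_add, Finset.sum_add_distrib]
    rw [hs t (Finset.union_subset_left ht), hs' t (Finset.union_subset_right ht)]

theorem mem_of_grComp_mem {S : Submodule R Φ.Gr} {x : Φ.Gr} (h : ∀ k, Φ.grComp k x ∈ S) :
    x ∈ S := by
  obtain ⟨s, hs⟩ := Φ.exists_sum_grComp x
  rw [← hs s subset_rfl]
  exact Submodule.sum_mem _ fun k _ => h k

theorem grMap_grComp (φ : X →ₗ[CliffordAlgebra Q] Y) (h : ∀ k, ∀ x ∈ Φ.F k, φ x ∈ Ψ.F k)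
    (k : ℤ) (x : Φ.Gr) : grMap Φ Ψ φ h (Φ.grComp k x) = Ψ.grComp k (grMap Φ Ψ φ h x) := by
  induction x using Φ.gr_induction with
  | zero => simp only [map_zero]
  | symb j x =>
    rw [grMap_symb]
    rcases eq_or_ne j k with rfl | hj
    · rw [grComp_symb_self, grComp_symb_self, grMap_symb]
    · rw [grComp_symb_ne _ hj, grComp_symb_ne _ hj, map_zero]
  | add x y hx hy => simp only [map_add, hx, hy]

variable (N : Submodule (CliffordAlgebra Q) X)

theorem grIncl_symb (k : ℤ) (x : (Φ.sub N).F k) :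
    Φ.grIncl N ((Φ.sub N).symb k x) = Φ.symb k ⟨x.1.1, x.2⟩ := grMap_symb _ _ _ _ k x

theorem grProj_symb (k : ℤ) (x : Φ.F k) :
    Φ.grProj N (Φ.symb k x) = (Φ.quot N).symb k ⟨N.mkQ x.1, x.1, x.2, rfl⟩ :=
  grMap_symb _ _ _ _ k x

theorem grIncl_grComp (k : ℤ) (x : (Φ.sub N).Gr) :
    Φ.grIncl N ((Φ.sub N).grComp k x) = Φ.grComp k (Φ.grIncl N x) := grMap_grComp _ _ _ _ k x

theorem grProj_grComp (k : ℤ) (x : Φ.Gr) :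
    Φ.grProj N (Φ.grComp k x) = (Φ.quot N).grComp k (Φ.grProj N x) := grMap_grComp _ _ _ _ k x

/-- A homogeneous element of `Gr X` lying in `Gr N` is the class of an element of `N`. -/
theorem exists_of_mem_range_grIncl {k : ℤ} {x : Φ.Gr} (hx : x ∈ LinearMap.range (Φ.grIncl N)) :
    ∃ (y : X) (hy : y ∈ Φ.F k), y ∈ N ∧ Φ.grComp k x = Φ.symb k ⟨y, hy⟩ := by
  obtain ⟨z, rfl⟩ := hx
  obtain ⟨y, hy⟩ := (Φ.sub N).grComp_mem k z
  refine ⟨y.1.1, y.2, y.1.2, ?_⟩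
  rw [← grIncl_grComp, ← hy, grIncl_symb]

theorem symb_mem_range_grIncl {k : ℤ} (x : Φ.F k) (hx : (x : X) ∈ N) :
    Φ.symb k x ∈ LinearMap.range (Φ.grIncl N) :=
  ⟨(Φ.sub N).symb k ⟨⟨x, hx⟩, x.2⟩, Φ.grIncl_symb N k _⟩

theorem grComp_mem_range_grIncl (k : ℤ) {x : Φ.Gr} (hx : x ∈ LinearMap.range (Φ.grIncl N)) :
    Φ.grComp k x ∈ LinearMap.range (Φ.grIncl N) := by
  obtain ⟨y, hy, hN, h⟩ := Φ.exists_of_mem_range_grIncl N (k := k) hx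
  rw [h]
  exact Φ.symb_mem_range_grIncl N _ hN

theorem map_grProj_grPiece (k : ℤ) {y : (Φ.quot N).Gr} (hy : y ∈ (Φ.quot N).grPiece k) :
    ∃ x ∈ Φ.grPiece k, Φ.grProj N x = y := by
  obtain ⟨⟨_, x, hx, rfl⟩, rfl⟩ := hy
  exact ⟨Φ.symb k ⟨x, hx⟩, ⟨_, rfl⟩, Φ.grProj_symb N k _⟩

theorem grProj_surjective : Function.Surjective (Φ.grProj N) := by
  intro y
  induction y using (Φ.quot N).gr_induction with
  | zero => exact ⟨0, map_zero _⟩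
  | symb k x =>
    obtain ⟨z, _, hz⟩ := Φ.map_grProj_grPiece N k ⟨x, rfl⟩
    exact ⟨z, hz⟩
  | add x y hx hy =>
    obtain ⟨a, rfl⟩ := hx
    obtain ⟨b, rfl⟩ := hy
    exact ⟨a + b, map_add _ _ _⟩

/-- Exactness of `Gr N → Gr X → Gr (X / N)`; it holds because the filtrations of `N` and `X / N`
are the induced ones. -/
theorem ker_grProj : LinearMap.ker (Φ.grProj N) = LinearMap.range (Φ.grIncl N) := by
  apply le_antisymm
  · intro x hx
    rw [LinearMap.mem_ker] at hx
    refine Φ.mem_of_grComp_mem (S := (LinearMap.range (Φ.grIncl N)).restrictScalars R)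
      fun k => ?_
    rw [Submodule.restrictScalars_mem]
    obtain ⟨y, hy⟩ := Φ.grComp_mem k x
    have h : Φ.grProj N (Φ.grComp k x) = 0 := by
      rw [grProj_grComp, hx, map_zero]
    rw [← hy, grProj_symb, symb_eq_zero_iff] at h
    obtain ⟨z, hz, hzy⟩ := h
    have hN : (y : X) - z ∈ N := by
      rw [← Submodule.Quotient.mk_eq_zero N, Submodule.Quotient.mk_sub, sub_eq_zero]
      exact hzy.symm
    have hz' : z ∈ Φ.F k := Φ.mono (by omega) hz
    rw [← hy, Φ.symb_congr (x := y) (y := y - ⟨z, hz'⟩) (by simpa using hz)]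
    exact Φ.symb_mem_range_grIncl N _ hN
  · rintro _ ⟨x, rfl⟩
    rw [LinearMap.mem_ker]
    induction x using (Φ.sub N).gr_induction with
    | zero => simp only [map_zero]
    | symb k x =>
      rw [grIncl_symb, grProj_symb, symb_eq_zero_iff]
      have : N.mkQ x.1.1 = 0 := by simp
      simp only [this]
      exact zero_mem _
    | add x y hx hy => rw [map_add, map_add, hx, hy, add_zero]

end ClFiltration

end GradedFiltered

/-! ### The associated graded of the Clifford algebra -/

section Quantization

open CliffordAlgebra in
theorem contractLeft_mem_clFil {R W : Type*} [CommRing R] [AddCommGroup W] [Module R W]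
    {Q : QuadraticForm R W} (d : Module.Dual R W) (k : ℤ) :
    ∀ {a : CliffordAlgebra Q}, a ∈ clFil Q k → contractLeft d a ∈ clFil Q (k - 1) := by
  match k with
  | .negSucc n =>
    intro a ha
    have : a = 0 := ha
    rw [this, map_zero]
    exact zero_mem _
  | .ofNat n =>
    induction n with
    | zero =>
      intro a ha
      obtain ⟨r, rfl⟩ := Submodule.mem_one.1 (show a ∈ (1 : Submodule R _) by simpa [clFil] using ha)
      rw [contractLeft_algebraMap]
      exact zero_mem _
    | succ n ih =>
      intro a ha
      have ha' : a ∈ (1 ⊔ LinearMap.range (ι Q)) * clFil Q n := by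
        rw [show clFil Q n = (1 ⊔ LinearMap.range (ι Q)) ^ n from rfl, ← pow_succ']
        exact ha
      have hn : (Int.ofNat (n + 1) : ℤ) - 1 = n := by simp
      rw [hn]
      refine Submodule.mul_induction_on ha' (fun m hm x hx => ?_) (fun x y hx hy => ?_)
      · have hx' : contractLeft d x ∈ clFil Q ((n : ℤ) - 1) := ih hx
        obtain ⟨y, hy, z, ⟨w, rfl⟩, rfl⟩ := Submodule.mem_sup.1 hm
        obtain ⟨r, rfl⟩ := Submodule.mem_one.1 hy
        rw [add_mul, map_add, contractLeft_algebraMap_mul, contractLeft_ι_mul,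
          ← Algebra.smul_def]
        refine add_mem (Submodule.smul_mem _ _ (clFil_mono Q (by omega) hx'))
          (sub_mem (Submodule.smul_mem _ _ hx) ?_)
        have := ι_mul_mem_clFil Q w _ _ hx'
        rwa [sub_add_cancel] at this
      · rw [map_add]
        exact add_mem hx hy

open CliffordAlgebra in
/-- A change of the quadratic form respects the filtrations of the Clifford algebras. -/
theorem changeForm_mem_clFil {R W : Type*} [CommRing R] [AddCommGroup W] [Module R W]
    {Q Q' : QuadraticForm R W} {B : LinearMap.BilinForm R W} (h : B.toQuadraticMap = Q' - Q)
    (k : ℤ) :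
    ∀ {a : CliffordAlgebra Q}, a ∈ clFil Q k → changeForm h a ∈ clFil Q' k := by
  match k with
  | .negSucc n =>
    intro a ha
    have : a = 0 := ha
    rw [this, map_zero]
    exact zero_mem _
  | .ofNat n =>
    induction n with
    | zero =>
      intro a ha
      obtain ⟨r, rfl⟩ := Submodule.mem_one.1 (show a ∈ (1 : Submodule R _) by simpa [clFil] using ha)
      rw [changeForm_algebraMap, Algebra.algebraMap_eq_smul_one]
      exact Submodule.smul_mem _ _ (Submodule.one_le.1 (le_of_eq (pow_zero _).symm))
    | succ n ih =>
      intro a ha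
      have ha' : a ∈ (1 ⊔ LinearMap.range (ι Q)) * clFil Q n := by
        rw [show clFil Q n = (1 ⊔ LinearMap.range (ι Q)) ^ n from rfl, ← pow_succ']
        exact ha
      have hn : (Int.ofNat (n + 1) : ℤ) = n + 1 := by simp
      rw [hn]
      refine Submodule.mul_induction_on ha' (fun m hm x hx => ?_) (fun x y hx hy => ?_)
      · have hx' : changeForm h x ∈ clFil Q' n := ih hx
        obtain ⟨y, hy, z, ⟨w, rfl⟩, rfl⟩ := Submodule.mem_sup.1 hm
        obtain ⟨r, rfl⟩ := Submodule.mem_one.1 hy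
        rw [add_mul, map_add, ← Algebra.smul_def, map_smul, changeForm_ι_mul]
        exact add_mem (Submodule.smul_mem _ _ (clFil_mono Q' (by omega) hx'))
          (sub_mem (ι_mul_mem_clFil Q' w _ _ hx')
            (clFil_mono Q' (by omega) (contractLeft_mem_clFil _ _ hx')))
      · rw [map_add]
        exact add_mem hx hy

variable {R W : Type*} [CommRing R] [AddCommGroup W] [Module R W]

theorem extGr_le_clFil (k : ℤ) : extGr R W k ≤ clFil (0 : QuadraticForm R W) k := by
  match k with
  | .negSucc n => exact le_rfl
  | .ofNat n => exact pow_le_pow_left' le_sup_right n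

theorem clFil_zero_le (k : ℤ) : clFil (0 : QuadraticForm R W) k ≤
    extGr R W k ⊔ clFil (0 : QuadraticForm R W) (k - 1) := by
  match k with
  | .negSucc n => exact bot_le
  | .ofNat n =>
    induction n with
    | zero => exact le_trans (le_of_eq (by simp [clFil, extGr])) le_sup_left
    | succ n ih =>
      have hn : (Int.ofNat (n + 1) : ℤ) - 1 = Int.ofNat n := by simp
      rw [hn]
      change (1 ⊔ LinearMap.range (CliffordAlgebra.ι 0)) ^ (n + 1) ≤ _
      rw [pow_succ', Submodule.sup_mul, one_mul]
      refine sup_le le_sup_right ?_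
      refine (mul_le_mul_right ih _).trans ?_
      rw [Submodule.mul_sup]
      refine sup_le ?_ ?_
      · refine le_trans (le_of_eq ?_) le_sup_left
        exact (pow_succ' _ _).symm
      · refine le_trans ?_ le_sup_right
        refine Submodule.mul_le.2 ?_
        rintro _ ⟨w, rfl⟩ x hx
        have := ι_mul_mem_clFil 0 w _ _ hx
        rwa [sub_add_cancel] at this

variable (R W) in
/-- The projection of `⋀ W` to its degree `k` part, as an endomorphism. -/
def extProj : ℤ → (ExteriorAlgebra R W →ₗ[R] ExteriorAlgebra R W)
  | .ofNat n => GradedAlgebra.proj (fun i : ℕ => ⋀[R]^i W) n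
  | .negSucc _ => 0

theorem extProj_mem (k : ℤ) (a : ExteriorAlgebra R W) : extProj R W k a ∈ extGr R W k := by
  match k with
  | .negSucc n => exact zero_mem _
  | .ofNat n => exact SetLike.coe_mem _

theorem extProj_of_mem {k : ℤ} {a : ExteriorAlgebra R W} (ha : a ∈ extGr R W k) :
    extProj R W k a = a := by
  match k, ha with
  | .negSucc n, ha => exact (show a = 0 from ha).symm
  | .ofNat n, ha => exact DirectSum.decompose_of_mem_same (fun i : ℕ => ⋀[R]^i W) ha

theorem extProj_of_mem_ne {j k : ℤ} (h : j ≠ k) {a : ExteriorAlgebra R W}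
    (ha : a ∈ extGr R W j) : extProj R W k a = 0 := by
  match j, k, ha with
  | .negSucc n, k, ha => rw [show a = 0 from ha, map_zero]
  | .ofNat n, .negSucc m, ha => rfl
  | .ofNat n, .ofNat m, ha =>
    exact DirectSum.decompose_of_mem_ne (fun i : ℕ => ⋀[R]^i W) ha (fun e => h (by rw [e]))

theorem iSup_extGr : ⨆ k, extGr R W k = ⊤ := by
  rw [eq_top_iff, ← (DirectSum.Decomposition.isInternal
    (fun i : ℕ => ⋀[R]^i W)).submodule_iSup_eq_top]
  exact iSup_le fun n => le_iSup (extGr R W) (Int.ofNat n)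

theorem extProj_of_mem_clFil {j k : ℤ} (h : j < k) {a : ExteriorAlgebra R W}
    (ha : a ∈ clFil (0 : QuadraticForm R W) j) : extProj R W k a = 0 := by
  suffices H : ∀ (n : ℕ) (j : ℤ), j < n → j < k → clFil (0 : QuadraticForm R W) j ≤
      LinearMap.ker (extProj R W k) from H (j + 1).toNat j (by omega) h ha
  intro n
  induction n with
  | zero =>
    intro j hj _
    match j with
    | .negSucc n => exact bot_le
    | .ofNat n => simp at hj; omega
  | succ n ih =>
    intro j hj hjk
    refine (clFil_zero_le j).trans (sup_le (fun a ha => ?_) (ih (j - 1) (by omega) (by omega)))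
    exact extProj_of_mem_ne (by omega) ha

theorem sub_extProj_mem {k : ℤ} {a : ExteriorAlgebra R W}
    (ha : a ∈ clFil (0 : QuadraticForm R W) k) :
    a - extProj R W k a ∈ clFil (0 : QuadraticForm R W) (k - 1) := by
  obtain ⟨x, hx, y, hy, rfl⟩ := Submodule.mem_sup.1 (clFil_zero_le k ha)
  rw [map_add, extProj_of_mem hx, extProj_of_mem_clFil (by omega) hy]
  simpa using hy

theorem extGr_ι_mul_mem (w : W) {k : ℤ} {a : ExteriorAlgebra R W} (ha : a ∈ extGr R W k) :
    ExteriorAlgebra.ι R w * a ∈ extGr R W (k + 1) := by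
  match k, ha with
  | .negSucc n, ha =>
    rw [show a = 0 from ha, mul_zero]
    exact zero_mem _
  | .ofNat n, ha =>
    change _ ∈ (LinearMap.range (ExteriorAlgebra.ι R) : Submodule R (ExteriorAlgebra R W)) ^ (n + 1)
    rw [pow_succ']
    exact Submodule.mul_mem_mul ⟨w, rfl⟩ ha

theorem extGr_induction {P : ∀ k, ∀ a : ExteriorAlgebra R W, a ∈ extGr R W k → Prop}
    (zero : ∀ k, P k 0 (zero_mem _))
    (algebraMap : ∀ r, P 0 (algebraMap R _ r) (Submodule.mem_one.2 ⟨r, rfl⟩))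
    (add : ∀ k a b ha hb, P k a ha → P k b hb → P k (a + b) (add_mem ha hb))
    (ι_mul : ∀ k w a ha, P k a ha → P (k + 1) (ExteriorAlgebra.ι R w * a) (extGr_ι_mul_mem w ha))
    {k : ℤ} {a : ExteriorAlgebra R W} (ha : a ∈ extGr R W k) : P k a ha := by
  match k, ha with
  | .negSucc n, ha =>
    obtain rfl : a = 0 := ha
    exact zero _
  | .ofNat n, ha =>
    exact Submodule.pow_induction_on_left' (LinearMap.range (ExteriorAlgebra.ι R))
      (C := fun n a ha => P (Int.ofNat n) a ha) algebraMap
      (fun x y i hx hy h1 h2 => add _ _ _ hx hy h1 h2)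
      (fun m hm i x hx h => by
        obtain ⟨w, rfl⟩ := hm
        exact ι_mul _ w _ hx h) ha

end Quantization

section Canon

variable {R W : Type*} [CommRing R] [Algebra ℝ R] [AddCommGroup W] [Module R W]
  [Module ℝ W] [IsScalarTower ℝ R W]

theorem neg_toQuadraticMap (g : LinearMap.BilinForm R W) :
    (-g).toQuadraticMap = negQuad g - 0 := by
  rw [sub_zero, negQuad, LinearMap.BilinMap.toQuadraticMap_neg]

/-- The quantization map `⋀ W → Cl`. -/
def quant (g : LinearMap.BilinForm R W) : ExteriorAlgebra R W ≃ₗ[R] Cl g :=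
  CliffordAlgebra.changeFormEquiv (neg_toQuadraticMap g)

variable (C : Set (LinearMap.BilinForm R W)) (g : LinearMap.BilinForm R W)

theorem quant_mem {k : ℤ} {a : ExteriorAlgebra R W}
    (ha : a ∈ clFil (0 : QuadraticForm R W) k) : quant g a ∈ clFil (negQuad g) k :=
  changeForm_mem_clFil (neg_toQuadraticMap g) k ha

theorem quant_symm_mem {k : ℤ} {a : Cl g} (ha : a ∈ clFil (negQuad g) k) :
    (quant g).symm a ∈ clFil (0 : QuadraticForm R W) k :=
  changeForm_mem_clFil (CliffordAlgebra.changeForm.neg_proof (neg_toQuadraticMap g)) k ha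

theorem quant_ι_mul_sub_mem (w : W) {k : ℤ} {a : ExteriorAlgebra R W}
    (ha : a ∈ clFil (0 : QuadraticForm R W) k) :
    CliffordAlgebra.ι (negQuad g) w * quant g a - quant g (ExteriorAlgebra.ι R w * a) ∈
      clFil (negQuad g) k := by
  have h : quant g (ExteriorAlgebra.ι R w * a) = CliffordAlgebra.ι (negQuad g) w * quant g a -
      CliffordAlgebra.contractLeft ((-g) w) (quant g a) :=
    CliffordAlgebra.changeForm_ι_mul (neg_toQuadraticMap g) w a
  rw [h, sub_sub_cancel]
  exact clFil_mono _ (by omega) (contractLeft_mem_clFil _ _ (quant_mem g ha))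

theorem canon_one_tmul (δ : CDerEnd C) :
    canon C g (1 ⊗ₜ[R] δ) = (lbarFil C g).symb 0 ⟨1 ⊗ₜ[R] δ, one_tmul_mem C g δ⟩ :=
  (baseLift_tmul _ _ _).trans (one_smul _ _)

theorem quant_one : quant g 1 = 1 := CliffordAlgebra.changeForm_one (neg_toQuadraticMap g)

theorem quant_tmul_mem {k : ℤ} {a : ExteriorAlgebra R W} (ha : a ∈ extGr R W k)
    (δ : CDerEnd C) : quant g a ⊗ₜ[R] δ ∈ (lbarFil C g).F k :=
  tmul_mem_tensorRange (quant_mem g (extGr_le_clFil k ha)) δ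

theorem canon_tmul {k : ℤ} {a : ExteriorAlgebra R W} (ha : a ∈ extGr R W k) (δ : CDerEnd C) :
    canon C g (a ⊗ₜ[R] δ) =
      (lbarFil C g).symb k ⟨quant g a ⊗ₜ[R] δ, quant_tmul_mem C g ha δ⟩ := by
  induction ha using extGr_induction with
  | zero k =>
    rw [TensorProduct.zero_tmul, map_zero, eq_comm, ClFiltration.symb_eq_zero_iff]
    simp
  | algebraMap r =>
    have h : (algebraMap R (ExteriorAlgebra R W) r) ⊗ₜ[R] δ =
        algebraMap R (ExteriorAlgebra R W) r • ((1 : ExteriorAlgebra R W) ⊗ₜ[R] δ) := by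
      rw [TensorProduct.smul_tmul', smul_eq_mul, mul_one]
    rw [h, map_smul, canon_one_tmul, algebraMap_smul, ← map_smul]
    refine congrArg _ (Subtype.ext ?_)
    change r • (1 : Cl g) ⊗ₜ[R] δ = quant g (algebraMap R (ExteriorAlgebra R W) r) ⊗ₜ[R] δ
    rw [Algebra.algebraMap_eq_smul_one, map_smul, quant_one, TensorProduct.smul_tmul']
  | add k a b ha hb h1 h2 =>
    rw [TensorProduct.add_tmul, map_add, h1, h2, ← map_add]
    refine congrArg _ (Subtype.ext ?_)
    change quant g a ⊗ₜ[R] δ + quant g b ⊗ₜ[R] δ = quant g (a + b) ⊗ₜ[R] δ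
    rw [map_add, TensorProduct.add_tmul]
  | ι_mul k w a ha h =>
    rw [show (ExteriorAlgebra.ι R w * a) ⊗ₜ[R] δ = ExteriorAlgebra.ι R w • (a ⊗ₜ[R] δ) by
      rw [TensorProduct.smul_tmul', smul_eq_mul], map_smul, h, ClFiltration.ι_smul_symb]
    refine ClFiltration.symb_congr _ ?_
    have := quant_ι_mul_sub_mem g w (extGr_le_clFil k ha)
    change CliffordAlgebra.ι (negQuad g) w • (quant g a ⊗ₜ[R] δ) -
      quant g (ExteriorAlgebra.ι R w * a) ⊗ₜ[R] δ ∈ tensorRange _ _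
    rw [TensorProduct.smul_tmul', smul_eq_mul, ← TensorProduct.sub_tmul, add_sub_cancel_right]
    exact tmul_mem_tensorRange this δ

theorem tensorRange_induction {A D : Type*} [Ring A] [Algebra R A] [AddCommGroup D] [Module R D]
    {S : Submodule R A} {P : ∀ x : A ⊗[R] D, x ∈ tensorRange D S → Prop}
    (zero : P 0 (zero_mem _))
    (tmul : ∀ a (ha : a ∈ S) d, P (a ⊗ₜ d) (tmul_mem_tensorRange ha d))
    (add : ∀ x y hx hy, P x hx → P y hy → P (x + y) (add_mem hx hy))
    {x : A ⊗[R] D} (hx : x ∈ tensorRange D S) : P x hx := by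
  obtain ⟨x, rfl⟩ := hx
  induction x with
  | zero => simpa using zero
  | tmul a d => exact tmul a a.2 d
  | add x y h1 h2 =>
    have := add _ _ ⟨x, rfl⟩ ⟨y, rfl⟩ h1 h2
    simpa using this

/-- The isomorphism `i : Gr L̄ → L`. -/
def canonInv : (lbarFil C g).Gr →ₗ[R] Lmod C :=
  ClFiltration.grLift
    (fun k => (LinearMap.rTensor (CDerEnd C) (extProj R W k ∘ₗ (quant g).symm.toLinearMap)) ∘ₗ
      ((lbarFil C g).F k).subtype) (by
    rintro k ⟨x, hx'⟩ hx
    change LinearMap.rTensor _ _ x = 0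
    change x ∈ tensorRange _ _ at hx
    induction hx using tensorRange_induction with
    | zero => exact map_zero _
    | tmul a ha d =>
      rw [LinearMap.rTensor_tmul, LinearMap.comp_apply, LinearEquiv.coe_coe,
        extProj_of_mem_clFil (by omega) (quant_symm_mem g ha), TensorProduct.zero_tmul]
    | add x y hx hy h1 h2 =>
      rw [map_add, h1 ((lbarFil C g).mono (by omega) hx), h2 ((lbarFil C g).mono (by omega) hy),
        add_zero])

theorem canonInv_symb (k : ℤ) (x : (lbarFil C g).F k) : canonInv C g ((lbarFil C g).symb k x) =
    LinearMap.rTensor (CDerEnd C) (extProj R W k ∘ₗ (quant g).symm.toLinearMap) x :=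
  ClFiltration.grLift_symb _ _ k x

theorem lmod_induction {P : Lmod C → Prop} (zero : P 0)
    (tmul : ∀ k, ∀ a ∈ extGr R W k, ∀ δ, P (a ⊗ₜ[R] δ)) (add : ∀ x y, P x → P y → P (x + y))
    (x : Lmod C) : P x := by
  induction x using TensorProduct.induction_on with
  | zero => exact zero
  | tmul a δ =>
    have ha : a ∈ ⨆ k, extGr R W k := iSup_extGr (R := R) (W := W) ▸ Submodule.mem_top
    induction ha using Submodule.iSup_induction' with
    | mem k a ha => exact tmul k a ha δ
    | zero => rwa [TensorProduct.zero_tmul]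
    | add a b _ _ h1 h2 => rw [TensorProduct.add_tmul]; exact add _ _ h1 h2
  | add x y h1 h2 => exact add _ _ h1 h2

theorem canonInv_canon (x : Lmod C) : canonInv C g (canon C g x) = x := by
  induction x using lmod_induction with
  | zero => simp only [map_zero]
  | tmul k a ha δ =>
    rw [canon_tmul C g ha, canonInv_symb, LinearMap.rTensor_tmul, LinearMap.comp_apply,
      LinearEquiv.coe_coe, LinearEquiv.symm_apply_apply, extProj_of_mem ha]
  | add x y h1 h2 => rw [map_add, map_add, h1, h2]

theorem canon_canonInv_symb (k : ℤ) (x : (lbarFil C g).F k) :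
    canon C g (canonInv C g ((lbarFil C g).symb k x)) = (lbarFil C g).symb k x := by
  rw [canonInv_symb]
  obtain ⟨x, hx⟩ := x
  dsimp only
  change x ∈ tensorRange (CDerEnd C) (clFil (negQuad g) k) at hx
  induction hx using tensorRange_induction with
  | zero =>
    rw [map_zero, map_zero, eq_comm]
    exact ClFiltration.symb_eq_zero _ _ _ (zero_mem _)
  | tmul a ha d =>
    rw [LinearMap.rTensor_tmul, LinearMap.comp_apply, LinearEquiv.coe_coe,
      canon_tmul C g (extProj_mem _ _)]
    refine ClFiltration.symb_congr _ ?_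
    change quant g _ ⊗ₜ[R] d - a ⊗ₜ[R] d ∈ tensorRange _ _
    rw [← TensorProduct.sub_tmul]
    refine tmul_mem_tensorRange ?_ d
    rw [← neg_mem_iff, neg_sub]
    have := quant_mem g (sub_extProj_mem (quant_symm_mem g ha))
    rwa [map_sub, LinearEquiv.apply_symm_apply] at this
  | add x y hx hy h1 h2 =>
    rw [map_add, map_add, h1, h2, ← map_add]
    rfl

theorem canon_canonInv (x : (lbarFil C g).Gr) : canon C g (canonInv C g x) = x := by
  induction x using ClFiltration.gr_induction with
  | zero => simp only [map_zero]
  | symb k x => exact canon_canonInv_symb C g k x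
  | add x y h1 h2 => rw [map_add, map_add, h1, h2]

theorem canon_bijective : Function.Bijective (canon C g) :=
  ⟨Function.LeftInverse.injective (canonInv_canon C g),
    Function.RightInverse.surjective (canon_canonInv C g)⟩

theorem canon_mem_grPiece {k : ℤ} {x : Lmod C} (hx : x ∈ lGr C k) :
    canon C g x ∈ (lbarFil C g).grPiece k := by
  induction hx using tensorRange_induction with
  | zero => rw [map_zero]; exact zero_mem _
  | tmul a ha d => rw [canon_tmul C g ha]; exact ⟨_, rfl⟩
  | add x y hx hy h1 h2 => rw [map_add]; exact add_mem h1 h2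

theorem rTensor_extProj_mem (D : Type*) [AddCommGroup D] [Module R D] {A : Type*} [AddCommGroup A]
    [Module R A] (k : ℤ) (l : A →ₗ[R] ExteriorAlgebra R W) (x : A ⊗[R] D) :
    LinearMap.rTensor D (extProj R W k ∘ₗ l) x ∈ tensorRange D (extGr R W k) := by
  induction x with
  | zero => rw [map_zero]; exact zero_mem _
  | tmul a d => exact tmul_mem_tensorRange (extProj_mem k _) d
  | add x y h1 h2 => rw [map_add]; exact add_mem h1 h2

theorem map_canon_lGr (k : ℤ) : (lGr C k).map ((canon C g).restrictScalars R) =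
    (lbarFil C g).grPiece k := by
  apply le_antisymm
  · rintro _ ⟨x, hx, rfl⟩
    exact canon_mem_grPiece C g hx
  · rintro _ ⟨x, rfl⟩
    refine ⟨_, ?_, canon_canonInv_symb C g k x⟩
    rw [canonInv_symb]
    exact rTensor_extProj_mem _ _ _ _

theorem mem_lGr_iff (k : ℤ) (x : Lmod C) :
    x ∈ lGr C k ↔ canon C g x ∈ (lbarFil C g).grPiece k := by
  refine ⟨canon_mem_grPiece C g, fun h => ?_⟩
  rw [← map_canon_lGr] at h
  obtain ⟨y, hy, h⟩ := h
  rwa [← (canon_bijective C g).1 h]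

end Canon

/-! ### The graded Lie algebroid `L` -/

section ExteriorSigns

variable {R W : Type*} [CommRing R] [AddCommGroup W] [Module R W]

theorem extGr_mul_mem {i j : ℤ} {a b : ExteriorAlgebra R W} (ha : a ∈ extGr R W i)
    (hb : b ∈ extGr R W j) : a * b ∈ extGr R W (i + j) := by
  induction ha using extGr_induction with
  | zero k => rw [zero_mul]; exact zero_mem _
  | algebraMap r =>
    rw [← Algebra.smul_def, zero_add]
    exact Submodule.smul_mem _ _ hb
  | add k x y hx hy h1 h2 => rw [add_mul]; exact add_mem h1 h2
  | ι_mul k w a ha h =>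
    rw [mul_assoc, show k + 1 + j = (k + j) + 1 by ring]
    exact extGr_ι_mul_mem w h

theorem ι_mul_comm (w : W) {j : ℤ} {b : ExteriorAlgebra R W} (hb : b ∈ extGr R W j) :
    b * ExteriorAlgebra.ι R w = j.negOnePow • (ExteriorAlgebra.ι R w * b) := by
  induction hb using extGr_induction with
  | zero k => simp
  | algebraMap r => rw [Int.negOnePow_zero, one_smul, Algebra.commutes]
  | add k x y hx hy h1 h2 => rw [add_mul, mul_add, h1, h2, smul_add]
  | ι_mul k v a ha h =>
    rw [mul_assoc, h, Int.negOnePow_succ, mul_smul_comm, ← mul_assoc,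
      ← mul_assoc (ExteriorAlgebra.ι R w),
      eq_neg_of_add_eq_zero_left (ExteriorAlgebra.ι_add_mul_swap v w), neg_mul, smul_neg,
      Units.neg_smul]

/-- Graded commutativity of the exterior algebra. -/
theorem extGr_mul_comm {i j : ℤ} {a b : ExteriorAlgebra R W} (ha : a ∈ extGr R W i)
    (hb : b ∈ extGr R W j) : b * a = (i * j).negOnePow • (a * b) := by
  induction ha using extGr_induction with
  | zero k => simp
  | algebraMap r => rw [zero_mul, Int.negOnePow_zero, one_smul, Algebra.commutes]
  | add k x y hx hy h1 h2 => rw [add_mul, mul_add, h1, h2, smul_add]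
  | ι_mul k w a ha h =>
    rw [← mul_assoc, ι_mul_comm w hb, smul_mul_assoc, mul_assoc, h, mul_smul_comm, smul_smul,
      ← Int.negOnePow_add, mul_assoc, show j + k * j = (k + 1) * j by ring]

end ExteriorSigns

section Laoid

variable {R W : Type*} [CommRing R] [Algebra ℝ R] [AddCommGroup W] [Module R W]
  [Module ℝ W] [IsScalarTower ℝ R W] {C : Set (LinearMap.BilinForm R W)}

variable (C) in
/-- A shortcut for instance search. -/
abbrev lmodAddCommMonoid : AddCommMonoid (Lmod C) := inferInstance

variable (C) in
/-- A shortcut for instance search. -/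
abbrev lmodAddMonoid : AddMonoid (Lmod C) := inferInstance

variable (C) in
/-- A shortcut for instance search. -/
abbrev lmodSubNegMonoid : SubNegMonoid (Lmod C) := inferInstance

variable (C) in
/-- A shortcut for instance search. -/
abbrev lmodUnitsSMul : SMul ℤˣ (Lmod C) := inferInstance

attribute [local instance] lmodAddCommMonoid lmodAddMonoid lmodSubNegMonoid lmodUnitsSMul

theorem lam_mul (δ : CDerEnd C) (a b : ExteriorAlgebra R W) :
    lam C δ (a * b) = lam C δ a * b + a * lam C δ b := extDer_mul _ a b

theorem lam_ι (δ : CDerEnd C) (w : W) :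
    lam C δ (ExteriorAlgebra.ι R w) = ExteriorAlgebra.ι R (δ.1.2 w) := extDer_ι _ w

theorem lam_algebraMap (δ : CDerEnd C) (r : R) :
    lam C δ (algebraMap R _ r) = algebraMap R (ExteriorAlgebra R W) (δ.1.1 r) :=
  extDer_algebraMap _ r

theorem lam_one (δ : CDerEnd C) : lam C δ 1 = 0 := by
  rw [← map_one (algebraMap R (ExteriorAlgebra R W)), lam_algebraMap, Derivation.map_one_eq_zero,
    map_zero]

theorem lam_mem (δ : CDerEnd C) {k : ℤ} {a : ExteriorAlgebra R W} (ha : a ∈ extGr R W k) :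
    lam C δ a ∈ extGr R W k := by
  match k, ha with
  | .negSucc n, ha =>
    rw [show a = 0 from ha, map_zero]
    exact zero_mem _
  | .ofNat n, ha => exact extDer_mem _ n a ha

theorem lam_comm (δ ε : CDerEnd C) (a : ExteriorAlgebra R W) :
    lam C (CDerEnd.comm δ ε) a = lam C δ (lam C ε a) - lam C ε (lam C δ a) := by
  induction a using ExteriorAlgebra.induction with
  | algebraMap r =>
    simp only [lam_algebraMap, ← map_sub]
    rfl
  | ι w =>
    simp only [lam_ι, ← map_sub]
    rfl
  | mul a b ha hb =>
    simp only [lam_mul, map_add, ha, hb, sub_mul, mul_sub]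
    abel
  | add a b ha hb =>
    simp only [map_add, ha, hb]
    abel

theorem CDerEnd.comm_jacobi (x y z : CDerEnd C) : CDerEnd.comm x (CDerEnd.comm y z) =
    CDerEnd.comm (CDerEnd.comm x y) z + CDerEnd.comm y (CDerEnd.comm x z) := by
  apply Subtype.ext
  refine Prod.ext ?_ ?_
  · exact leibniz_lie x.1.1 y.1.1 z.1.1
  · ext w
    simp only [CDerEnd.comm, LinearMap.sub_apply, LinearMap.comp_apply, Prod.snd_add,
      Submodule.coe_add, LinearMap.add_apply, map_sub]
    abel

theorem anchor_tmul (a : ExteriorAlgebra R W) (δ : CDerEnd C) (b : ExteriorAlgebra R W) :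
    anchor C (a ⊗ₜ[R] δ) b = a * lam C δ b := rfl

theorem smul_mem_lGr {i j : ℤ} {a : ExteriorAlgebra R W} (ha : a ∈ extGr R W i) {x : Lmod C}
    (hx : x ∈ lGr C j) : a • x ∈ lGr C (i + j) :=
  smul_mem_tensorRange (fun _ hb => extGr_mul_mem ha hb) hx

theorem anchor_mem {i j : ℤ} {x : Lmod C} (hx : x ∈ lGr C i) {a : ExteriorAlgebra R W}
    (ha : a ∈ extGr R W j) : anchor C x a ∈ extGr R W (i + j) := by
  induction hx using tensorRange_induction with
  | zero => rw [map_zero]; exact zero_mem _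
  | tmul b hb δ => exact extGr_mul_mem hb (lam_mem δ ha)
  | add x y _ _ h1 h2 => rw [map_add]; exact add_mem h1 h2

theorem bracket_mem {i j : ℤ} {x y : Lmod C} (hx : x ∈ lGr C i) (hy : y ∈ lGr C j) :
    bracket C x y ∈ lGr C (i + j) := by
  induction hx using tensorRange_induction with
  | zero => rw [map_zero]; exact zero_mem _
  | tmul a ha δ =>
    induction hy using tensorRange_induction with
    | zero => rw [map_zero]; exact zero_mem _
    | tmul b hb ε =>
      rw [bracket_tmul]
      exact sub_mem (add_mem (tmul_mem_tensorRange (extGr_mul_mem ha hb) _)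
        (tmul_mem_tensorRange (extGr_mul_mem ha (lam_mem _ hb)) _))
        (tmul_mem_tensorRange (extGr_mul_mem (lam_mem _ ha) hb) _)
    | add x y _ _ h1 h2 => rw [map_add]; exact add_mem h1 h2
  | add x y _ _ h1 h2 => rw [map_add]; exact add_mem h1 h2

theorem bracket_skew {i j : ℤ} {x y : Lmod C} (hx : x ∈ lGr C i) (hy : y ∈ lGr C j) :
    bracket C x y = -((i * j).negOnePow • bracket C y x) := by
  induction hx using tensorRange_induction with
  | zero => simp
  | tmul a ha δ =>
    induction hy using tensorRange_induction with
    | zero => simp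
    | tmul b hb ε =>
      rw [bracket_tmul, bracket_tmul, extGr_mul_comm ha hb, extGr_mul_comm (lam_mem ε ha) hb,
        extGr_mul_comm ha (lam_mem δ hb), CDerEnd.comm_swap δ ε]
      rcases Int.units_eq_one_or (i * j).negOnePow with h | h <;> rw [h] <;>
        simp only [one_smul, Units.neg_smul, TensorProduct.neg_tmul, TensorProduct.tmul_neg] <;>
        abel
    | add x y _ _ h1 h2 =>
      rw [map_add, map_add, h1, h2, AddMonoidHom.add_apply, smul_add, neg_add]
  | add x y _ _ h1 h2 => rw [map_add, map_add, AddMonoidHom.add_apply, h1, h2, smul_add, neg_add]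

theorem anchor_mul {i j : ℤ} {x : Lmod C} (hx : x ∈ lGr C i) {a : ExteriorAlgebra R W}
    (ha : a ∈ extGr R W j) (b : ExteriorAlgebra R W) :
    anchor C x (a * b) = anchor C x a * b + (i * j).negOnePow • (a * anchor C x b) := by
  induction hx using tensorRange_induction with
  | zero => simp
  | tmul c hc δ =>
    rw [anchor_tmul, anchor_tmul, anchor_tmul, lam_mul, mul_add, ← mul_assoc a,
      extGr_mul_comm hc ha]
    rcases Int.units_eq_one_or (i * j).negOnePow with h | h <;> rw [h] <;>
      simp only [one_smul, Units.neg_smul, neg_mul, neg_neg, mul_assoc]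
  | add x y _ _ h1 h2 =>
    rw [map_add, LinearMap.add_apply, h1, h2, LinearMap.add_apply, LinearMap.add_apply, mul_add,
      smul_add, add_mul]
    abel

theorem bracket_leibniz {i j : ℤ} {x : Lmod C} (hx : x ∈ lGr C i) {a : ExteriorAlgebra R W}
    (ha : a ∈ extGr R W j) (y : Lmod C) :
    bracket C x (a • y) = anchor C x a • y + (i * j).negOnePow • (a • bracket C x y) := by
  induction hx using tensorRange_induction with
  | zero => simp
  | tmul c hc δ =>
    induction y using TensorProduct.induction_on with
    | zero => simp
    | tmul b ε =>
      rw [anchor_tmul, TensorProduct.smul_tmul', smul_eq_mul, bracket_tmul, bracket_tmul, smul_sub,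
        smul_add, TensorProduct.smul_tmul', TensorProduct.smul_tmul', TensorProduct.smul_tmul',
        TensorProduct.smul_tmul', smul_eq_mul, smul_eq_mul, smul_eq_mul, smul_eq_mul, lam_mul,
        ← mul_assoc a, ← mul_assoc a, ← mul_assoc a, extGr_mul_comm hc ha,
        extGr_mul_comm (lam_mem ε hc) ha]
      rcases Int.units_eq_one_or (i * j).negOnePow with h | h <;> rw [h] <;>
        simp only [one_smul, Units.neg_smul, neg_mul, TensorProduct.neg_tmul,
          TensorProduct.add_tmul, mul_add, mul_assoc] <;> abel
    | add x y h1 h2 =>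
      rw [smul_add, map_add, h1, h2, map_add, smul_add, smul_add, smul_add]
      abel
  | add x y _ _ h1 h2 =>
    rw [map_add, map_add, AddMonoidHom.add_apply, h1, h2, LinearMap.add_apply,
      AddMonoidHom.add_apply, smul_add, smul_add, add_smul]
    abel

theorem anchor_bracket {i j : ℤ} {x y : Lmod C} (hx : x ∈ lGr C i) (hy : y ∈ lGr C j)
    (c : ExteriorAlgebra R W) :
    anchor C (bracket C x y) c =
      anchor C x (anchor C y c) - (i * j).negOnePow • anchor C y (anchor C x c) := by
  induction hx using tensorRange_induction with
  | zero => simp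
  | tmul a ha δ =>
    induction hy using tensorRange_induction with
    | zero => simp
    | tmul b hb ε =>
      rw [bracket_tmul, map_sub, map_add, LinearMap.sub_apply, LinearMap.add_apply]
      simp only [anchor_tmul, lam_comm, lam_mul, mul_add, mul_sub, ← mul_assoc]
      rw [extGr_mul_comm ha hb, extGr_mul_comm (lam_mem ε ha) hb]
      rcases Int.units_eq_one_or (i * j).negOnePow with h | h <;> rw [h] <;>
        simp only [one_smul, Units.neg_smul, neg_mul] <;> abel
    | add x y _ _ h1 h2 =>
      simp only [map_add, LinearMap.add_apply, h1, h2, smul_add]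
      abel
  | add x y _ _ h1 h2 =>
    simp only [map_add, AddMonoidHom.add_apply, LinearMap.add_apply, h1, h2, smul_add]
    abel

theorem bracket_jacobi_one_tmul {i j : ℤ} {x y : Lmod C} (hx : x ∈ lGr C i) (hy : y ∈ lGr C j)
    (ζ : CDerEnd C) : bracket C x (bracket C y (1 ⊗ₜ[R] ζ)) =
      bracket C (bracket C x y) (1 ⊗ₜ[R] ζ) +
        (i * j).negOnePow • bracket C y (bracket C x (1 ⊗ₜ[R] ζ)) := by
  induction hx using tensorRange_induction with
  | zero => simp
  | tmul a ha δ =>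
    induction hy using tensorRange_induction with
    | zero => simp
    | tmul b hb ε =>
      simp only [bracket_tmul, map_add, map_sub, AddMonoidHom.add_apply, AddMonoidHom.sub_apply,
        lam_one, mul_zero, mul_one, TensorProduct.zero_tmul, add_zero, lam_mul, lam_comm,
        CDerEnd.comm_jacobi δ ε ζ]
      rw [CDerEnd.comm_swap ε δ]
      simp only [sub_mul, TensorProduct.add_tmul, TensorProduct.sub_tmul,
        TensorProduct.tmul_add, TensorProduct.tmul_neg]
      simp only [extGr_mul_comm ha hb, extGr_mul_comm (lam_mem _ ha) hb,
        extGr_mul_comm (lam_mem _ ha) (lam_mem _ hb),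
        extGr_mul_comm ha (lam_mem _ (lam_mem _ hb)), extGr_mul_comm (lam_mem _ (lam_mem _ ha)) hb]
      rcases Int.units_eq_one_or (i * j).negOnePow with h | h <;> rw [h] <;>
        simp only [one_smul, Units.neg_smul, TensorProduct.neg_tmul] <;> abel
    | add x y _ _ h1 h2 =>
      simp only [map_add, AddMonoidHom.add_apply, h1, h2, smul_add]
      abel
  | add x y _ _ h1 h2 =>
    simp only [map_add, AddMonoidHom.add_apply, h1, h2, smul_add]
    abel

theorem units_smul_comm_lmod (s : ℤˣ) (a : ExteriorAlgebra R W) (v : Lmod C) :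
    a • s • v = s • a • v := by
  rcases Int.units_eq_one_or s with h | h <;> rw [h]
  · rw [one_smul, one_smul]
  · rw [Units.neg_smul, one_smul, Units.neg_smul, one_smul, smul_neg]

theorem bracket_units_smul (s : ℤˣ) (u v : Lmod C) :
    bracket C u (s • v) = s • bracket C u v := by
  rcases Int.units_eq_one_or s with h | h <;> rw [h]
  · rw [one_smul, one_smul]
  · rw [Units.neg_smul, one_smul, Units.neg_smul, one_smul, map_neg]

theorem sub_units_smul_lmod (s : ℤˣ) (a b : ExteriorAlgebra R W) (v : Lmod C) :
    (a - s • b) • v = a • v - s • b • v := by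
  rcases Int.units_eq_one_or s with h | h <;> rw [h]
  · rw [one_smul, one_smul, eq_sub_iff_add_eq, ← add_smul, sub_add_cancel]
  · rw [Units.neg_smul, one_smul, Units.neg_smul, one_smul, sub_neg_eq_add, sub_neg_eq_add,
      add_smul]

theorem jacobi_signs {M : Type*} [AddCommGroup M] (s t u : ℤˣ) (a₁ a₂ a₃ a₄ a₅ a₆ : M) :
    a₁ + (s * t) • a₃ + (u • a₄ + u • t • (a₅ + s • a₆)) =
      a₁ - s • a₂ + (t * u) • a₅ + (s • (a₂ + (s * u) • a₄) + s • t • (a₃ + u • a₆)) := by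
  rcases Int.units_eq_one_or s with rfl | rfl <;>
  rcases Int.units_eq_one_or t with rfl | rfl <;>
  rcases Int.units_eq_one_or u with rfl | rfl <;>
    simp only [one_smul, Units.neg_smul, mul_neg, mul_one, neg_neg, sub_neg_eq_add] <;> abel

/-- The Jacobi identity. By the Leibniz rule, the Jacobiator is linear over `⋀ W` in its last
argument, which may therefore be taken in `CDerEnd(W)`. -/
theorem bracket_jacobi {i j k : ℤ} {x y z : Lmod C} (hx : x ∈ lGr C i) (hy : y ∈ lGr C j)
    (hz : z ∈ lGr C k) : bracket C x (bracket C y z) =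
      bracket C (bracket C x y) z + (i * j).negOnePow • bracket C y (bracket C x z) := by
  induction hz using tensorRange_induction with
  | zero => simp only [map_zero, smul_zero, add_zero]
  | tmul c hc ζ =>
    have h1 : c ⊗ₜ[R] ζ = c • ((1 : ExteriorAlgebra R W) ⊗ₜ[R] ζ : Lmod C) := by
      rw [TensorProduct.smul_tmul', smul_eq_mul, mul_one]
    rw [h1, bracket_leibniz hy hc, bracket_leibniz hx hc, bracket_leibniz (bracket_mem hx hy) hc,
      map_add, map_add, bracket_leibniz hx (anchor_mem hy hc), bracket_leibniz hy (anchor_mem hx hc)]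
    rw [bracket_units_smul, bracket_units_smul, bracket_leibniz hx hc, bracket_leibniz hy hc,
      bracket_jacobi_one_tmul hx hy, anchor_bracket hx hy, show i * (j + k) = i * j + i * k by ring,
      show j * (i + k) = i * j + j * k by ring, show (i + j) * k = i * k + j * k by ring,
      Int.negOnePow_add, Int.negOnePow_add, Int.negOnePow_add, sub_units_smul_lmod]
    have := jacobi_signs (i * j).negOnePow (i * k).negOnePow (j * k).negOnePow
      (anchor C x (anchor C y c) • (1 ⊗ₜ[R] ζ : Lmod C))
      (anchor C y (anchor C x c) • (1 ⊗ₜ[R] ζ : Lmod C))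
      (anchor C y c • bracket C x (1 ⊗ₜ[R] ζ)) (anchor C x c • bracket C y (1 ⊗ₜ[R] ζ))
      (c • bracket C (bracket C x y) (1 ⊗ₜ[R] ζ)) (c • bracket C y (bracket C x (1 ⊗ₜ[R] ζ)))
    rw [smul_add c, units_smul_comm_lmod _ c, smul_add (j * k).negOnePow,
      smul_add (i * j).negOnePow (_ + _)]
    exact this
  | add x y _ _ h1 h2 =>
    simp only [map_add, h1, h2, smul_add]
    abel

theorem jacobi_signs_cyclic {M : Type*} [AddCommGroup M] (s t u : ℤˣ) (a b : M) :
    a + s • b + (s * t) • -(t • b) + u • -(u • a) = 0 := by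
  rw [smul_neg, smul_neg, smul_smul, smul_smul, mul_assoc, Int.units_mul_self, Int.units_mul_self,
    mul_one, one_smul]
  abel

theorem bracket_jacobi_cyclic {i j k : ℤ} {x y z : Lmod C} (hx : x ∈ lGr C i)
    (hy : y ∈ lGr C j) (hz : z ∈ lGr C k) : bracket C x (bracket C y z)
      + (i * (j + k)).negOnePow • bracket C y (bracket C z x)
      + (k * (i + j)).negOnePow • bracket C z (bracket C x y) = 0 := by
  rw [bracket_jacobi hx hy hz, bracket_skew hz hx, bracket_skew hz (bracket_mem hx hy), map_neg,
    bracket_units_smul,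
    show i * (j + k) = i * j + k * i by ring]
  simp only [Int.negOnePow_add]
  exact jacobi_signs_cyclic _ _ _ _ _

theorem bracket_smul_real_right (x : Lmod C) (r : ℝ) (y : Lmod C) :
    bracket C x (r • y) = r • bracket C x y := by
  induction x using TensorProduct.induction_on with
  | zero => simp only [map_zero, AddMonoidHom.zero_apply, smul_zero]
  | tmul a δ =>
    induction y using TensorProduct.induction_on with
    | zero => simp only [smul_zero, map_zero]
    | tmul b ε =>
      simp only [TensorProduct.smul_tmul', bracket_tmul, LinearMap.map_smul, mul_smul_comm,
        smul_add, smul_sub]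
    | add x y h1 h2 => rw [smul_add, map_add, h1, h2, map_add, smul_add]
  | add x y h1 h2 => simp only [map_add, AddMonoidHom.add_apply, h1, h2, smul_add]

theorem bracket_smul_real_left (r : ℝ) (x y : Lmod C) :
    bracket C (r • x) y = r • bracket C x y := by
  induction x using TensorProduct.induction_on with
  | zero => simp only [map_zero, AddMonoidHom.zero_apply, smul_zero]
  | tmul a δ =>
    induction y using TensorProduct.induction_on with
    | zero => simp only [smul_zero, map_zero]
    | tmul b ε =>
      simp only [TensorProduct.smul_tmul', bracket_tmul, LinearMap.map_smul, smul_mul_assoc,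
        smul_add, smul_sub]
    | add x y h1 h2 => rw [map_add, h1, h2, map_add, smul_add]
  | add x y h1 h2 => simp only [smul_add, map_add, AddMonoidHom.add_apply, h1, h2]

end Laoid

/-! ### The Clifford algebra in an orthonormal basis -/

section CliffordBasis

variable {R W : Type*} [CommRing R] [Algebra ℝ R] [AddCommGroup W] [Module R W]
  [Module ℝ W] [IsScalarTower ℝ R W] {g : LinearMap.BilinForm R W}
  {θ : Module.Basis (Fin 4) R W}

/-- The generators of the Clifford algebra given by a basis of `W`. -/
def gen (g : LinearMap.BilinForm R W) (θ : Module.Basis (Fin 4) R W) (i : Fin 4) : Cl g :=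
  CliffordAlgebra.ι (negQuad g) (θ i)

/-- The basis `θ` is orthonormal for `g`. -/
def IsON (g : LinearMap.BilinForm R W) (θ : Module.Basis (Fin 4) R W) : Prop :=
  ∀ i j, g (θ i) (θ j) = algebraMap ℝ R (eta i j)

theorem negQuad_apply (g : LinearMap.BilinForm R W) (w : W) : negQuad g w = -g w w := rfl

theorem gen_mul_self (hθ : IsON g θ) (i : Fin 4) :
    gen g θ i * gen g θ i = algebraMap ℝ (Cl g) (-eta i i) := by
  rw [gen, CliffordAlgebra.ι_sq_scalar, negQuad_apply, hθ, ← map_neg,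
    ← IsScalarTower.algebraMap_apply]

theorem gen_mul_gen (hθ : IsON g θ) {i j : Fin 4} (h : i ≠ j) :
    gen g θ i * gen g θ j = -(gen g θ j * gen g θ i) := by
  rw [eq_neg_iff_add_eq_zero, gen, gen, CliffordAlgebra.ι_mul_ι_add_swap, QuadraticMap.polar,
    negQuad_apply, negQuad_apply, negQuad_apply]
  simp [hθ i, hθ j, eta, h, h.symm]

theorem gen_swap_assoc (hθ : IsON g θ) {i j : Fin 4} (h : i ≠ j) (x : Cl g) :
    gen g θ i * (gen g θ j * x) = -(gen g θ j * (gen g θ i * x)) := by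
  rw [← mul_assoc, gen_mul_gen hθ h, neg_mul, mul_assoc]

/-- The rules that bring products of generators to normal form. -/
theorem gen_rules (hθ : IsON g θ) :
    gen g θ 0 * gen g θ 0 = 1 ∧ (∀ x, gen g θ 0 * (gen g θ 0 * x) = x) ∧
    gen g θ 1 * gen g θ 1 = -1 ∧ (∀ x, gen g θ 1 * (gen g θ 1 * x) = -x) ∧
    gen g θ 2 * gen g θ 2 = -1 ∧ (∀ x, gen g θ 2 * (gen g θ 2 * x) = -x) ∧
    gen g θ 3 * gen g θ 3 = -1 ∧ (∀ x, gen g θ 3 * (gen g θ 3 * x) = -x) ∧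
    gen g θ 1 * gen g θ 0 = -(gen g θ 0 * gen g θ 1) ∧
    (∀ x, gen g θ 1 * (gen g θ 0 * x) = -(gen g θ 0 * (gen g θ 1 * x))) ∧
    gen g θ 2 * gen g θ 0 = -(gen g θ 0 * gen g θ 2) ∧
    (∀ x, gen g θ 2 * (gen g θ 0 * x) = -(gen g θ 0 * (gen g θ 2 * x))) ∧
    gen g θ 3 * gen g θ 0 = -(gen g θ 0 * gen g θ 3) ∧
    (∀ x, gen g θ 3 * (gen g θ 0 * x) = -(gen g θ 0 * (gen g θ 3 * x))) ∧
    gen g θ 2 * gen g θ 1 = -(gen g θ 1 * gen g θ 2) ∧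
    (∀ x, gen g θ 2 * (gen g θ 1 * x) = -(gen g θ 1 * (gen g θ 2 * x))) ∧
    gen g θ 3 * gen g θ 1 = -(gen g θ 1 * gen g θ 3) ∧
    (∀ x, gen g θ 3 * (gen g θ 1 * x) = -(gen g θ 1 * (gen g θ 3 * x))) ∧
    gen g θ 3 * gen g θ 2 = -(gen g θ 2 * gen g θ 3) ∧
    (∀ x, gen g θ 3 * (gen g θ 2 * x) = -(gen g θ 2 * (gen g θ 3 * x))) := by
  have h0 : gen g θ 0 * gen g θ 0 = 1 := by
    rw [gen_mul_self hθ, eta_zero_zero, neg_neg, map_one]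
  have h1 : gen g θ 1 * gen g θ 1 = -1 := by rw [gen_mul_self hθ]; simp [eta]
  have h2 : gen g θ 2 * gen g θ 2 = -1 := by rw [gen_mul_self hθ]; simp [eta]
  have h3 : gen g θ 3 * gen g θ 3 = -1 := by rw [gen_mul_self hθ]; simp [eta]
  refine ⟨h0, fun x => ?_, h1, fun x => ?_, h2, fun x => ?_, h3, fun x => ?_,
    gen_mul_gen hθ (by decide), gen_swap_assoc hθ (by decide),
    gen_mul_gen hθ (by decide), gen_swap_assoc hθ (by decide),
    gen_mul_gen hθ (by decide), gen_swap_assoc hθ (by decide),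
    gen_mul_gen hθ (by decide), gen_swap_assoc hθ (by decide),
    gen_mul_gen hθ (by decide), gen_swap_assoc hθ (by decide),
    gen_mul_gen hθ (by decide), gen_swap_assoc hθ (by decide)⟩ <;> rw [← mul_assoc]
  · rw [h0, one_mul]
  · rw [h1, neg_one_mul]
  · rw [h2, neg_one_mul]
  · rw [h3, neg_one_mul]

variable (g θ) in
/-- The products of distinct generators; the index is read as the set of its binary digits. -/
def mon : Fin 16 → Cl g :=
  ![1, gen g θ 0, gen g θ 1, gen g θ 0 * gen g θ 1, gen g θ 2, gen g θ 0 * gen g θ 2,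
    gen g θ 1 * gen g θ 2, gen g θ 0 * (gen g θ 1 * gen g θ 2), gen g θ 3, gen g θ 0 * gen g θ 3,
    gen g θ 1 * gen g θ 3, gen g θ 0 * (gen g θ 1 * gen g θ 3), gen g θ 2 * gen g θ 3,
    gen g θ 0 * (gen g θ 2 * gen g θ 3), gen g θ 1 * (gen g θ 2 * gen g θ 3),
    gen g θ 0 * (gen g θ 1 * (gen g θ 2 * gen g θ 3))]

/-- The number of factors of `mon`. -/
def monDeg : Fin 16 → ℕ := ![0, 1, 1, 2, 1, 2, 2, 3, 1, 2, 2, 3, 2, 3, 3, 4]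

/-- The symmetric difference of a set of generators with a single generator. -/
def monNext : Fin 4 → Fin 16 → Fin 16 :=
  ![![1, 0, 3, 2, 5, 4, 7, 6, 9, 8, 11, 10, 13, 12, 15, 14],
    ![2, 3, 0, 1, 6, 7, 4, 5, 10, 11, 8, 9, 14, 15, 12, 13],
    ![4, 5, 6, 7, 0, 1, 2, 3, 12, 13, 14, 15, 8, 9, 10, 11],
    ![8, 9, 10, 11, 12, 13, 14, 15, 0, 1, 2, 3, 4, 5, 6, 7]]

theorem gen_mul_mon (hθ : IsON g θ) (i : Fin 4) (j : Fin 16) :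
    gen g θ i * mon g θ j = mon g θ (monNext i j) ∨
      gen g θ i * mon g θ j = -mon g θ (monNext i j) := by
  fin_cases i <;> fin_cases j <;> simp [mon, monNext, gen_rules hθ]

theorem monDeg_monNext (i : Fin 4) (j : Fin 16) : monDeg (monNext i j) ≤ monDeg j + 1 := by
  revert i j
  decide

variable (g θ) in
/-- The span of the products of at most `k` distinct generators. -/
def monFil (k : ℕ) : Submodule R (Cl g) :=
  Submodule.span R (mon g θ '' {i | monDeg i ≤ k})

theorem mon_mem_monFil {i : Fin 16} {k : ℕ} (h : monDeg i ≤ k) : mon g θ i ∈ monFil g θ k :=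
  Submodule.subset_span ⟨i, h, rfl⟩

theorem monFil_mono {k l : ℕ} (h : k ≤ l) : monFil g θ k ≤ monFil g θ l :=
  Submodule.span_mono (Set.image_mono fun _ hi => le_trans hi h)

theorem clFil_le_monFil (hθ : IsON g θ) (k : ℕ) : clFil (negQuad g) k ≤ monFil g θ k := by
  induction k with
  | zero =>
    change (1 ⊔ LinearMap.range (CliffordAlgebra.ι (negQuad g))) ^ 0 ≤ _
    rw [pow_zero, Submodule.one_le]
    exact mon_mem_monFil (i := 0) le_rfl
  | succ k ih =>
    change (1 ⊔ LinearMap.range (CliffordAlgebra.ι (negQuad g))) ^ (k + 1) ≤ _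
    rw [pow_succ', Submodule.sup_mul, one_mul]
    refine sup_le (le_trans ih (monFil_mono (Nat.le_succ k)))
      (le_trans (mul_le_mul_right ih _) ?_)
    refine Submodule.mul_le.2 ?_
    rintro _ ⟨w, rfl⟩ x hx
    rw [← θ.sum_repr w, map_sum, Finset.sum_mul]
    refine Submodule.sum_mem _ fun i _ => ?_
    rw [map_smul, smul_mul_assoc]
    refine Submodule.smul_mem _ _ ?_
    induction hx using Submodule.span_induction with
    | mem x h =>
      obtain ⟨j, hj, rfl⟩ := h
      have h := mon_mem_monFil (g := g) (θ := θ) (i := monNext i j) (k := k + 1)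
        (le_trans (monDeg_monNext i j) (Nat.succ_le_succ hj))
      rcases gen_mul_mon hθ i j with e | e <;> rw [gen] at e <;> rw [e]
      · exact h
      · exact neg_mem h
    | zero => rw [mul_zero]; exact zero_mem _
    | add x y _ _ h1 h2 => rw [mul_add]; exact add_mem h1 h2
    | smul r x _ h => rw [mul_smul_comm]; exact Submodule.smul_mem _ _ h

theorem gen_mul_mem {i : Fin 4} {k : ℤ} {a : Cl g} (ha : a ∈ clFil (negQuad g) k) :
    gen g θ i * a ∈ clFil (negQuad g) (k + 1) := ι_mul_mem_clFil _ _ _ _ ha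

theorem one_mem_clFil : (1 : Cl g) ∈ clFil (negQuad g) 0 :=
  Submodule.one_le.1 (le_of_eq (pow_zero _).symm)

theorem mon_mem_clFil (i : Fin 16) : mon g θ i ∈ clFil (negQuad g) (monDeg i) := by
  have h : ∀ j : Fin 4, gen g θ j ∈ clFil (negQuad g) 1 := fun j => by
    rw [← mul_one (gen g θ j)]
    exact gen_mul_mem one_mem_clFil
  fin_cases i
  · exact one_mem_clFil
  · exact h 0
  · exact h 1
  · exact gen_mul_mem (h 1)
  · exact h 2
  · exact gen_mul_mem (h 2)
  · exact gen_mul_mem (h 2)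
  · exact gen_mul_mem (gen_mul_mem (h 2))
  · exact h 3
  · exact gen_mul_mem (h 3)
  · exact gen_mul_mem (h 3)
  · exact gen_mul_mem (gen_mul_mem (h 3))
  · exact gen_mul_mem (h 3)
  · exact gen_mul_mem (gen_mul_mem (h 3))
  · exact gen_mul_mem (gen_mul_mem (h 3))
  · exact gen_mul_mem (gen_mul_mem (gen_mul_mem (h 3)))

theorem clFil_eq_monFil (hθ : IsON g θ) (k : ℕ) : clFil (negQuad g) k = monFil g θ k := by
  apply le_antisymm (clFil_le_monFil hθ k)
  rw [monFil, Submodule.span_le]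
  rintro _ ⟨i, hi, rfl⟩
  exact clFil_mono _ (Int.ofNat_le.2 hi) (mon_mem_clFil i)

theorem iSup_clFil {Q : QuadraticForm R W} (a : CliffordAlgebra Q) : ∃ k : ℕ, a ∈ clFil Q k := by
  induction a using CliffordAlgebra.induction with
  | algebraMap r =>
    refine ⟨0, ?_⟩
    change _ ∈ (1 ⊔ LinearMap.range (CliffordAlgebra.ι Q)) ^ 0
    rw [pow_zero]
    exact Submodule.mem_one.2 ⟨r, rfl⟩
  | ι w =>
    refine ⟨1, ?_⟩
    change _ ∈ (1 ⊔ LinearMap.range (CliffordAlgebra.ι Q)) ^ 1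
    rw [pow_one]
    exact Submodule.mem_sup_right ⟨w, rfl⟩
  | mul a b ha hb =>
    obtain ⟨k, hk⟩ := ha
    obtain ⟨l, hl⟩ := hb
    refine ⟨k + l, ?_⟩
    change _ ∈ (1 ⊔ LinearMap.range (CliffordAlgebra.ι Q)) ^ (k + l)
    rw [pow_add]
    exact Submodule.mul_mem_mul hk hl
  | add a b ha hb =>
    obtain ⟨k, hk⟩ := ha
    obtain ⟨l, hl⟩ := hb
    exact ⟨max k l, add_mem (clFil_mono _ (Int.ofNat_le.2 (le_max_left _ _)) hk)
      (clFil_mono _ (Int.ofNat_le.2 (le_max_right _ _)) hl)⟩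

theorem span_mon (hθ : IsON g θ) : ⊤ ≤ Submodule.span R (Set.range (mon g θ)) := by
  intro a _
  obtain ⟨k, hk⟩ := iSup_clFil a
  exact Submodule.span_mono (Set.image_subset_range _ _) (clFil_le_monFil hθ k hk)

/-- The linear map underlying the representation of the Clifford algebra by two by two matrices of
quaternions. -/
def quatRepAux (θ : Module.Basis (Fin 4) R W) :
    W →ₗ[R] Matrix (Fin 2) (Fin 2) (QuaternionAlgebra R (-1) 0 (-1)) where
  toFun w := !![⟨θ.repr w 0, 0, 0, 0⟩, ⟨0, θ.repr w 1, θ.repr w 2, θ.repr w 3⟩;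
      ⟨0, θ.repr w 1, θ.repr w 2, θ.repr w 3⟩, ⟨-θ.repr w 0, 0, 0, 0⟩]
  map_add' v w := by
    ext i j <;> fin_cases i <;> fin_cases j <;> simp [add_comm]
  map_smul' r w := by
    ext i j <;> fin_cases i <;> fin_cases j <;> simp

theorem quatRepAux_apply (w : W) : quatRepAux θ w =
    !![⟨θ.repr w 0, 0, 0, 0⟩, ⟨0, θ.repr w 1, θ.repr w 2, θ.repr w 3⟩;
      ⟨0, θ.repr w 1, θ.repr w 2, θ.repr w 3⟩, ⟨-θ.repr w 0, 0, 0, 0⟩] := rfl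

theorem form_apply (hθ : IsON g θ) (w : W) : g w w = -(θ.repr w 0 * θ.repr w 0) +
    θ.repr w 1 * θ.repr w 1 + θ.repr w 2 * θ.repr w 2 + θ.repr w 3 * θ.repr w 3 := by
  have h : g w w = g (∑ i, θ.repr w i • θ i) (∑ i, θ.repr w i • θ i) := by rw [θ.sum_repr]
  rw [h]
  simp only [Fin.sum_univ_four, map_add, LinearMap.add_apply, map_smul, LinearMap.smul_apply,
    hθ _ _, smul_eq_mul]
  simp [eta]

/-- The representation of the Clifford algebra by two by two matrices of quaternions. -/
def quatRep (hθ : IsON g θ) :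
    Cl g →ₐ[R] Matrix (Fin 2) (Fin 2) (QuaternionAlgebra R (-1) 0 (-1)) :=
  CliffordAlgebra.lift (negQuad g) ⟨quatRepAux θ, fun w => by
    rw [negQuad_apply, form_apply hθ, quatRepAux_apply]
    ext i j <;> fin_cases i <;> fin_cases j <;>
      simp [Matrix.mul_apply, Fin.sum_univ_two, Matrix.algebraMap_matrix_apply,
        QuaternionAlgebra.algebraMap_eq] <;> ring⟩

theorem half_mul_two : algebraMap ℝ R (1 / 2) * 2 = 1 := by
  rw [← map_ofNat (algebraMap ℝ R) 2, ← map_mul]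
  norm_num

theorem eq_zero_of_add_of_sub {a b : R} (h₁ : a + b = 0) (h₂ : a + -b = 0) : a = 0 ∧ b = 0 := by
  constructor
  · linear_combination (-a) * half_mul_two (R := R) + algebraMap ℝ R (1 / 2) * (h₁ + h₂)
  · linear_combination (-b) * half_mul_two (R := R) + algebraMap ℝ R (1 / 2) * (h₁ - h₂)

/-- The sixteen products are independent because their images under the quaternionic representation
are, the scalar `2` being invertible. -/
theorem linearIndependent_mon (hθ : IsON g θ) : LinearIndependent R (mon g θ) := by
  rw [Fintype.linearIndependent_iff]
  intro c hc
  have h := congrArg (quatRep hθ) hc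
  have hg : ∀ i, quatRep hθ (gen g θ i) = quatRepAux θ (θ i) :=
    fun i => CliffordAlgebra.lift_ι_apply _ _ _
  simp only [Fin.sum_univ_succ, mon] at h
  simp [hg, quatRepAux_apply] at h
  have e : ∀ i j, _ := fun i j => congrFun (congrFun h i) j
  have e₀ := e 0 0
  have e₁ := e 0 1
  have e₂ := e 1 0
  have e₃ := e 1 1
  simp [QuaternionAlgebra.ext_iff] at e₀ e₁ e₂ e₃
  obtain ⟨a0, a1, a2, a3⟩ := e₀
  obtain ⟨b0, b1, b2, b3⟩ := e₁
  obtain ⟨c0, c1, c2, c3⟩ := e₂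
  obtain ⟨d0, d1, d2, d3⟩ := e₃
  have f0 := eq_zero_of_add_of_sub a0 d0
  have f1 := eq_zero_of_add_of_sub a1 d1
  have f2 := eq_zero_of_add_of_sub (a := c 10) (b := c 11) (by linear_combination -a2)
    (by linear_combination -d2)
  have f3 := eq_zero_of_add_of_sub a3 d3
  have f4 := eq_zero_of_add_of_sub (a := c 14) (b := c 15) (by linear_combination -b0)
    (by linear_combination -c0)
  have f5 := eq_zero_of_add_of_sub b1 c1
  have f6 := eq_zero_of_add_of_sub b2 c2
  have f7 := eq_zero_of_add_of_sub b3 c3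
  intro i
  fin_cases i
  exacts [f0.1, f0.2, f5.1, f5.2, f6.1, f6.2, f3.1, f3.2, f7.1, f7.2, f2.1, f2.2, f1.1, f1.2, f4.1,
    f4.2]

variable (g θ) in
/-- The basis of the Clifford algebra given by the products of distinct generators. -/
def monBasis (hθ : IsON g θ) : Module.Basis (Fin 16) R (Cl g) :=
  Module.Basis.mk (linearIndependent_mon hθ) (span_mon hθ)

theorem monBasis_apply (hθ : IsON g θ) (i : Fin 16) : monBasis g θ hθ i = mon g θ i :=
  Module.Basis.mk_apply _ _ i

/-- The filtration of the Clifford algebra in coordinates. -/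
theorem mem_clFil_iff (hθ : IsON g θ) (k : ℕ) (a : Cl g) :
    a ∈ clFil (negQuad g) k ↔ ∀ i, k < monDeg i → (monBasis g θ hθ).repr a i = 0 := by
  have h : mon g θ = monBasis g θ hθ := funext fun i => (monBasis_apply hθ i).symm
  rw [clFil_eq_monFil hθ, monFil, h, Module.Basis.mem_span_image]
  constructor
  · intro H i hi
    by_contra hne
    exact absurd (H (Finsupp.mem_support_iff.2 hne)) (not_le.2 hi)
  · intro H i hi
    by_contra hne
    exact Finsupp.mem_support_iff.1 hi (H i (not_le.1 hne))

theorem sum_mon_repr (hθ : IsON g θ) (a : Cl g) :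
    ∑ i, (monBasis g θ hθ).repr a i • mon g θ i = a := by
  simp only [← monBasis_apply hθ]
  exact (monBasis g θ hθ).sum_repr a

theorem repr_sum_mon (hθ : IsON g θ) (c : Fin 16 → R) (i : Fin 16) :
    (monBasis g θ hθ).repr (∑ j, c j • mon g θ j) i = c i := by
  simp only [← monBasis_apply hθ]
  rw [Module.Basis.repr_sum_self]

end CliffordBasis

/-! ### The kernel of `f` -/

section Kernel

variable {R W : Type*} [CommRing R] [Algebra ℝ R] [AddCommGroup W] [Module R W]
  [Module ℝ W] [IsScalarTower ℝ R W] {C : Set (LinearMap.BilinForm R W)}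
  {g : LinearMap.BilinForm R W} {θ : Module.Basis (Fin 4) R W}

variable (C θ) in
/-- The matrix entries of a module derivation in a basis of `W`. -/
def derCoord (i j : Fin 4) : CDerEnd C →ₗ[R] R where
  toFun δ := θ.repr (δ.1.2 (θ j)) i
  map_add' δ ε := by simp
  map_smul' r δ := by simp

theorem sum_derCoord (δ : CDerEnd C) (j : Fin 4) :
    ∑ i, derCoord C θ i j δ • θ i = δ.1.2 (θ j) := θ.sum_repr _

theorem form_derCoord (hθ : IsON g θ) (δ : CDerEnd C) (i j : Fin 4) :
    g (δ.1.2 (θ i)) (θ j) = algebraMap ℝ R (eta j j) * derCoord C θ j i δ := by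
  rw [← sum_derCoord]
  simp only [map_sum, map_smul, LinearMap.sum_apply, LinearMap.smul_apply, hθ _ _, smul_eq_mul]
  rw [Finset.sum_eq_single j]
  · ring
  · intro k _ hk
    simp [eta, hk]
  · simp

theorem form_derCoord' (hθ : IsON g θ) (δ : CDerEnd C) (i j : Fin 4) :
    g (θ i) (δ.1.2 (θ j)) = algebraMap ℝ R (eta i i) * derCoord C θ i j δ := by
  rw [← sum_derCoord]
  simp only [map_sum, map_smul, hθ _ _, smul_eq_mul]
  rw [Finset.sum_eq_single i]
  · ring
  · intro k _ hk
    simp [eta, hk.symm]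
  · simp

/-- In an orthonormal basis, the matrix of a conformal module derivation is the sum of a multiple
of the identity and an infinitesimal Lorentz transformation. -/
theorem derCoord_relations (hg : g ∈ C) (hθ : IsON g θ) (δ : CDerEnd C) :
    (∀ i, derCoord C θ i i δ = derCoord C θ 0 0 δ) ∧
    (∀ a : Fin 3, derCoord C θ 0 a.succ δ = derCoord C θ a.succ 0 δ) ∧
    (∀ a b : Fin 3, a ≠ b → derCoord C θ a.succ b.succ δ = -derCoord C θ b.succ a.succ δ) := by
  obtain ⟨f, hf⟩ := δ.2.2 g hg
  have key : ∀ i j, algebraMap ℝ R (eta j j) * derCoord C θ j i δ +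
      algebraMap ℝ R (eta i i) * derCoord C θ i j δ + f * algebraMap ℝ R (eta i j) = 0 := by
    intro i j
    have h := hf (θ i) (θ j)
    rw [hθ, Derivation.map_algebraMap, form_derCoord hθ, form_derCoord' hθ] at h
    exact h.symm
  have hs : ∀ a : Fin 3, eta a.succ a.succ = 1 := fun a => by rw [eta_succ_succ, if_pos rfl]
  have h0 := key 0 0
  rw [eta_zero_zero, map_neg, map_one] at h0
  refine ⟨fun i => ?_, fun a => ?_, fun a b hab => ?_⟩
  · refine Fin.cases rfl (fun a => ?_) i
    have h := key a.succ a.succ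
    rw [hs, map_one] at h
    linear_combination algebraMap ℝ R (1 / 2) * (h + h0) -
      (derCoord C θ a.succ a.succ δ - derCoord C θ 0 0 δ) * half_mul_two (R := R)
  · have h := key 0 a.succ
    rw [hs, eta_zero_zero, eta_zero_succ, map_one, map_neg, map_one, map_zero] at h
    linear_combination -h
  · have h := key a.succ b.succ
    rw [hs, hs, eta_succ_succ, if_neg hab, map_one, map_zero] at h
    linear_combination h

variable (C θ) in
/-- The coefficient of the boost `σ_a` in a conformal module derivation. -/
def boostCoord (a : Fin 3) : CDerEnd C →ₗ[R] R := derCoord C θ a.succ 0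

variable (C θ) in
/-- The coefficient of the rotation `rot θ a` in a conformal module derivation. -/
def rotCoord (a : Fin 3) : CDerEnd C →ₗ[R] R := derCoord C θ (a + 1).succ (a + 2).succ

/-- The values of the boosts and rotations on the spacelike basis vectors. -/
theorem boost_rot_table (θ : Module.Basis (Fin 4) R W) :
    boost θ 0 (θ 1) = θ 0 ∧ boost θ 0 (θ 2) = 0 ∧ boost θ 0 (θ 3) = 0 ∧
    boost θ 1 (θ 1) = 0 ∧ boost θ 1 (θ 2) = θ 0 ∧ boost θ 1 (θ 3) = 0 ∧
    boost θ 2 (θ 1) = 0 ∧ boost θ 2 (θ 2) = 0 ∧ boost θ 2 (θ 3) = θ 0 ∧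
    rot θ 0 (θ 1) = 0 ∧ rot θ 0 (θ 2) = -θ 3 ∧ rot θ 0 (θ 3) = θ 2 ∧
    rot θ 1 (θ 1) = θ 3 ∧ rot θ 1 (θ 2) = 0 ∧ rot θ 1 (θ 3) = -θ 1 ∧
    rot θ 2 (θ 1) = -θ 2 ∧ rot θ 2 (θ 2) = θ 1 ∧ rot θ 2 (θ 3) = 0 := by
  have b := fun a j => boost_succ θ a j
  have r := fun a j => rot_succ θ a j
  have h1 : (0 : Fin 3).succ = (1 : Fin 4) := rfl
  have h2 : (1 : Fin 3).succ = (2 : Fin 4) := rfl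
  have h3 : (2 : Fin 3).succ = (3 : Fin 4) := rfl
  rw [← h1, ← h2, ← h3]
  simp only [b, r]
  refine ⟨?_, ?_, ?_, ?_, ?_, ?_, ?_, ?_, ?_, ?_, ?_, ?_, ?_, ?_, ?_, ?_, ?_, ?_⟩ <;>
    simp

theorem apply_basis (hg : g ∈ C) (hθ : IsON g θ) (δ : CDerEnd C) (j : Fin 4) :
    δ.1.2 (θ j) = derCoord C θ 0 0 δ • θ j + ∑ a, (boostCoord C θ a δ • boost θ a (θ j) +
      rotCoord C θ a δ • rot θ a (θ j)) := by
  obtain ⟨h1, h2, h3⟩ := derCoord_relations hg hθ δ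
  rw [← sum_derCoord, Fin.sum_univ_four, Fin.sum_univ_three]
  have e1 := h1 1
  have e2 := h1 2
  have e3 := h1 3
  have e4 := h2 0
  have e5 := h2 1
  have e6 := h2 2
  have e7 := h3 1 0 (by decide)
  have e8 := h3 2 1 (by decide)
  have e9 := h3 0 2 (by decide)
  refine Fin.cases ?_ (fun k => ?_) j
  · simp [boost_zero, rot_zero, boostCoord]
    abel
  · obtain ⟨t1, t2, t3, t4, t5, t6, t7, t8, t9, t10, t11, t12, t13, t14, t15, t16, t17, t18⟩ :=
      boost_rot_table θ
    fin_cases k <;> simp [boostCoord, rotCoord] at * <;>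
      simp [e1, e2, e3, e4, e5, e6, e7, e8, e9, t1, t2, t3, t4, t5, t6, t7, t8, t9, t10, t11,
        t12, t13, t14, t15, t16, t17, t18] <;> module

/-- Two conformal module derivations coincide if they have the same restriction to functions and
the same values on a basis. -/
theorem CDerEnd.ext_basis {δ ε : CDerEnd C} (h : δ.1.1 = ε.1.1)
    (h' : ∀ j, δ.1.2 (θ j) = ε.1.2 (θ j)) : δ = ε := by
  refine Subtype.ext (Prod.ext h ?_)
  ext w
  rw [← θ.sum_repr w, map_sum, map_sum]
  refine Finset.sum_congr rfl fun i _ => ?_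
  rw [δ.2.1, ε.2.1, h, h']

variable (hC : ∀ g ∈ C, ∀ g' ∈ C, ∃ u : R, g' = u • g)

theorem sigmaBoost_apply (hθ' : IsConfOrthonormal C θ) (a : Fin 3) (w : W) :
    (sigmaBoost hC θ hθ' a).1.2 w = boost θ a w := rfl

theorem sigmaRot_apply (hθ' : IsConfOrthonormal C θ) (a : Fin 3) (w : W) :
    (sigmaRot hC θ hθ' a).1.2 w = rot θ a w := rfl

theorem sigmaBoost_fst (hθ' : IsConfOrthonormal C θ) (a : Fin 3) :
    (sigmaBoost hC θ hθ' a).1.1 = 0 := rfl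

theorem sigmaRot_fst (hθ' : IsConfOrthonormal C θ) (a : Fin 3) :
    (sigmaRot hC θ hθ' a).1.1 = 0 := rfl

theorem eq_sum_sigma (hg : g ∈ C) (hθ : IsON g θ) (hθ' : IsConfOrthonormal C θ) (δ : CDerEnd C)
    (h : δ.1.1 = 0) (h' : derCoord C θ 0 0 δ = 0) :
    δ = ∑ a, (boostCoord C θ a δ • sigmaBoost hC θ hθ' a +
      rotCoord C θ a δ • sigmaRot hC θ hθ' a) := by
  refine CDerEnd.ext_basis (θ := θ) ?_ fun j => ?_
  · rw [h, Fin.sum_univ_three]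
    simp [sigmaBoost_fst, sigmaRot_fst]
  · rw [apply_basis hg hθ, h', Fin.sum_univ_three, Fin.sum_univ_three]
    simp [sigmaBoost_apply, sigmaRot_apply]

/-- The relations between products of basis vectors in the exterior algebra. -/
theorem ext_rules (v : Fin 4 → W) :
    (∀ i, ExteriorAlgebra.ι R (v i) * ExteriorAlgebra.ι R (v i) = 0) ∧
    (∀ i x, ExteriorAlgebra.ι R (v i) * (ExteriorAlgebra.ι R (v i) * x) = 0) ∧
    (∀ i j, ExteriorAlgebra.ι R (v i) * ExteriorAlgebra.ι R (v j) =
      -(ExteriorAlgebra.ι R (v j) * ExteriorAlgebra.ι R (v i))) ∧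
    (∀ i j x, ExteriorAlgebra.ι R (v i) * (ExteriorAlgebra.ι R (v j) * x) =
      -(ExteriorAlgebra.ι R (v j) * (ExteriorAlgebra.ι R (v i) * x))) := by
  have h : ∀ i j, ExteriorAlgebra.ι R (v i) * ExteriorAlgebra.ι R (v j) =
      -(ExteriorAlgebra.ι R (v j) * ExteriorAlgebra.ι R (v i)) :=
    fun i j => eq_neg_of_add_eq_zero_left (ExteriorAlgebra.ι_add_mul_swap _ _)
  refine ⟨fun i => ExteriorAlgebra.ι_sq_zero _, fun i x => ?_, h, fun i j x => ?_⟩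
  · rw [← mul_assoc, ExteriorAlgebra.ι_sq_zero, zero_mul]
  · rw [← mul_assoc, h, neg_mul, mul_assoc]

variable (θ) in
/-- The volume element of a basis. -/
def vol : ExteriorAlgebra R W := ExteriorAlgebra.ι R (θ 0) * (ExteriorAlgebra.ι R (θ 1) *
  (ExteriorAlgebra.ι R (θ 2) * ExteriorAlgebra.ι R (θ 3)))

theorem ι_mem_extGr (w : W) : ExteriorAlgebra.ι R w ∈ extGr R W 1 := by
  have h1 : (1 : ExteriorAlgebra R W) ∈ extGr R W 0 :=
    Submodule.one_le.1 (le_of_eq (pow_zero _).symm)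
  rw [← mul_one (ExteriorAlgebra.ι R w)]
  exact extGr_ι_mul_mem w h1

theorem vol_mem : vol θ ∈ extGr R W 4 :=
  extGr_ι_mul_mem _ (extGr_ι_mul_mem _ (extGr_ι_mul_mem _ (ι_mem_extGr _)))

theorem lam_vol (hg : g ∈ C) (hθ : IsON g θ) (δ : CDerEnd C) :
    lam C δ (vol θ) = (4 * derCoord C θ 0 0 δ) • vol θ := by
  obtain ⟨h1, h2, h3⟩ := derCoord_relations hg hθ δ
  obtain ⟨r1, r2, r3, r4⟩ := ext_rules (R := R) θ
  have e : ∀ j, δ.1.2 (θ j) = _ := fun j => (sum_derCoord δ j).symm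
  simp only [vol, lam_mul, lam_ι, e, Fin.sum_univ_four, map_add, map_smul, h1]
  simp only [mul_add, add_mul, smul_mul_assoc, mul_smul_comm, r1, r2, smul_zero,
    add_zero, zero_add]
  simp only [r4 1 0, r4 3 1, r4 2 1, r3 2 1, r3 2 0, r4 3 2, r1, r2, mul_zero, mul_neg, neg_zero,
    smul_zero, add_zero, zero_add, neg_neg]
  module

theorem quant_ι (w : W) : quant g (ExteriorAlgebra.ι R w) = CliffordAlgebra.ι (negQuad g) w :=
  CliffordAlgebra.changeForm_ι (neg_toQuadraticMap g) w

theorem repr_quant_vol (hθ : IsON g θ) : (monBasis g θ hθ).repr (quant g (vol θ)) 15 = 1 := by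
  have h2 := quant_ι_mul_sub_mem g (θ 2) (extGr_le_clFil 1 (ι_mem_extGr (R := R) (θ 3)))
  have m2 := extGr_ι_mul_mem (θ 2) (ι_mem_extGr (R := R) (θ 3))
  have h1 := quant_ι_mul_sub_mem g (θ 1) (extGr_le_clFil _ m2)
  have m1 := extGr_ι_mul_mem (θ 1) m2
  have h0 := quant_ι_mul_sub_mem g (θ 0) (extGr_le_clFil _ m1)
  have k2 := ι_mul_mem_clFil _ (θ 0) _ _ (ι_mul_mem_clFil _ (θ 1) _ _ h2)
  have k1 := ι_mul_mem_clFil _ (θ 0) _ _ h1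
  have k := add_mem (add_mem k2 k1) h0
  have e : mon g θ 15 - quant g (vol θ) ∈ clFil (negQuad g) (3 : ℕ) := by
    have e3 : ((1 : ℤ) + 1 + 1) = ((3 : ℕ) : ℤ) := rfl
    rw [← e3]
    refine (congrArg (· ∈ clFil (negQuad g) (1 + 1 + 1)) ?_).mpr k
    simp only [vol, quant_ι, mul_sub]
    rw [sub_add_sub_cancel, sub_add_sub_cancel]
    rfl
  have := (mem_clFil_iff hθ 3 _).1 e 15 (by decide)
  rw [map_sub, ← monBasis_apply hθ, Module.Basis.repr_self, Finsupp.sub_apply,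
    Finsupp.single_eq_same, sub_eq_zero] at this
  exact this.symm

/-- The fourth exterior power of `W` is generated by the volume element. -/
theorem eq_smul_vol (hθ : IsON g θ) {η : ExteriorAlgebra R W} (hη : η ∈ extGr R W 4) :
    η = (monBasis g θ hθ).repr (quant g η) 15 • vol θ := by
  set r := (monBasis g θ hθ).repr (quant g η) 15 with hr
  have h4 : η - r • vol θ ∈ extGr R W 4 := sub_mem hη (Submodule.smul_mem _ _ vol_mem)
  have h3 : quant g (η - r • vol θ) ∈ clFil (negQuad g) (3 : ℕ) := by
    rw [mem_clFil_iff hθ]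
    have := (mem_clFil_iff hθ 4 _).1 (quant_mem g (extGr_le_clFil _ h4))
    intro i hi
    fin_cases i <;> first | exact absurd hi (by decide) | skip
    simp [repr_quant_vol hθ, ← hr]
  have h := extProj_of_mem_clFil (k := 4) (by norm_num) (quant_symm_mem g h3)
  rw [LinearEquiv.symm_apply_apply, extProj_of_mem h4] at h
  exact sub_eq_zero.1 h

end Kernel

section KernelStructure

variable {R W : Type*} [CommRing R] [Algebra ℝ R] [AddCommGroup W] [Module R W]
  [Module ℝ W] [IsScalarTower ℝ R W] {C : Set (LinearMap.BilinForm R W)}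
  {g : LinearMap.BilinForm R W} {θ : Module.Basis (Fin 4) R W}

variable (C g θ) in
/-- The `Cl`-linear extension of the boost coordinate to `L̄`. -/
def cBoost (b : Fin 3) : Lbar C g →ₗ[Cl g] Cl g :=
  baseLift ((Algebra.linearMap R (Cl g)) ∘ₗ boostCoord C θ b)

variable (C g θ) in
/-- The `Cl`-linear extension of the rotation coordinate to `L̄`. -/
def cRot (b : Fin 3) : Lbar C g →ₗ[Cl g] Cl g :=
  baseLift ((Algebra.linearMap R (Cl g)) ∘ₗ rotCoord C θ b)

theorem cBoost_tmul (b : Fin 3) (a : Cl g) (δ : CDerEnd C) :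
    cBoost C g θ b (a ⊗ₜ[R] δ) = boostCoord C θ b δ • a := by
  rw [cBoost, baseLift_tmul, LinearMap.comp_apply, Algebra.linearMap_apply, smul_eq_mul,
    ← Algebra.commutes, Algebra.smul_def]

theorem cRot_tmul (b : Fin 3) (a : Cl g) (δ : CDerEnd C) :
    cRot C g θ b (a ⊗ₜ[R] δ) = rotCoord C θ b δ • a := by
  rw [cRot, baseLift_tmul, LinearMap.comp_apply, Algebra.linearMap_apply, smul_eq_mul,
    ← Algebra.commutes, Algebra.smul_def]

theorem cBoost_mem (b : Fin 3) {k : ℤ} {x : Lbar C g} (hx : x ∈ (lbarFil C g).F k) :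
    cBoost C g θ b x ∈ clFil (negQuad g) k := by
  refine tensorRange_induction (P := fun x _ => cBoost C g θ b x ∈ clFil (negQuad g) k)
    ?_ (fun a ha d => ?_) (fun x y _ _ h1 h2 => ?_) hx
  · rw [map_zero]; exact zero_mem _
  · rw [cBoost_tmul]; exact Submodule.smul_mem _ _ ha
  · rw [map_add]; exact add_mem h1 h2

theorem cRot_mem (b : Fin 3) {k : ℤ} {x : Lbar C g} (hx : x ∈ (lbarFil C g).F k) :
    cRot C g θ b x ∈ clFil (negQuad g) k := by
  refine tensorRange_induction (P := fun x _ => cRot C g θ b x ∈ clFil (negQuad g) k)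
    ?_ (fun a ha d => ?_) (fun x y _ _ h1 h2 => ?_) hx
  · rw [map_zero]; exact zero_mem _
  · rw [cRot_tmul]; exact Submodule.smul_mem _ _ ha
  · rw [map_add]; exact add_mem h1 h2

theorem fMor_tmul_fst (a : Cl g) (δ : CDerEnd C) (r : R) :
    (fMor C g (a ⊗ₜ[R] δ)).1.1 r = δ.1.1 r • a := by
  rw [Algebra.smul_def, Algebra.commutes]
  rfl

theorem fMor_tmul_snd (a : Cl g) (δ : CDerEnd C) (w : W) :
    (fMor C g (a ⊗ₜ[R] δ)).1.2.1 w = a * CliffordAlgebra.ι (negQuad g) (δ.1.2 w) := rfl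

theorem fMor_tmul_om (a : Cl g) (δ : CDerEnd C) (η : Om R W) :
    (fMor C g (a ⊗ₜ[R] δ)).1.2.2 η = a ⊗ₜ[R] omDer C δ η := by
  change a • ((1 : Cl g) ⊗ₜ[R] omDer C δ η) = _
  rw [TensorProduct.smul_tmul', smul_eq_mul, mul_one]

/-- Every element of `L̄` has coefficients in `CDerEnd(W)` with respect to the basis of `Cl`. -/
theorem exists_mon_coeff (hθ : IsON g θ) (x : Lbar C g) :
    ∃ δ : Fin 16 → CDerEnd C, x = ∑ i, mon g θ i ⊗ₜ[R] δ i := by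
  induction x using TensorProduct.induction_on with
  | zero => exact ⟨0, by simp⟩
  | tmul a d =>
    refine ⟨fun i => (monBasis g θ hθ).repr a i • d, ?_⟩
    conv_lhs => rw [← sum_mon_repr hθ a]
    rw [TensorProduct.sum_tmul]
    simp only [TensorProduct.smul_tmul]
  | add x y hx hy =>
    obtain ⟨δ, rfl⟩ := hx
    obtain ⟨ε, rfl⟩ := hy
    exact ⟨δ + ε, by simp [TensorProduct.tmul_add, Finset.sum_add_distrib]⟩

/-- The coordinate of the volume element, extended to `Cl ⊗ Ω`. -/
def omCoord (hθ : IsON g θ) : Cl g ⊗[R] Om R W →ₗ[R] Cl g :=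
  (TensorProduct.rid R (Cl g)).toLinearMap ∘ₗ LinearMap.lTensor (Cl g)
    (((monBasis g θ hθ).coord 15) ∘ₗ (quant g).toLinearMap ∘ₗ (⋀[R]^4 W).subtype)

theorem omCoord_tmul (hθ : IsON g θ) (a : Cl g) (η : Om R W) :
    omCoord hθ (a ⊗ₜ[R] η) = (monBasis g θ hθ).repr (quant g η) 15 • a := rfl

variable (θ) in
/-- The volume element of a basis, as an element of `Ω`. -/
def volOm : Om R W := ⟨vol θ, vol_mem⟩

theorem omDer_vol (hg : g ∈ C) (hθ : IsON g θ) (δ : CDerEnd C) :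
    omDer C δ (volOm θ) = (4 * derCoord C θ 0 0 δ) • volOm θ :=
  Subtype.ext (lam_vol hg hθ δ)

/-- In the coefficients of an element of `ker f`, the component `δ_{C^∞}` vanishes because of the
first entry of the triple, and the scaling component because of the action on `Ω`. -/
theorem coeff_of_mem_Ibar (hg : g ∈ C) (hθ : IsON g θ) {δ : Fin 16 → CDerEnd C}
    (h : ∑ i, mon g θ i ⊗ₜ[R] δ i ∈ Ibar C g) (i : Fin 16) :
    (δ i).1.1 = 0 ∧ derCoord C θ 0 0 (δ i) = 0 := by
  have hf : fMor C g (∑ i, mon g θ i ⊗ₜ[R] δ i) = 0 := h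
  rw [map_sum] at hf
  constructor
  · ext r
    have h1 := LinearMap.congr_fun (congrArg (fun z : Pbar g => z.1.1) hf) r
    simp only [AddSubmonoidClass.coe_finsetSum, Prod.fst_sum, LinearMap.sum_apply,
      fMor_tmul_fst] at h1
    have h2 := repr_sum_mon hθ (fun i => (δ i).1.1 r) i
    rw [h1] at h2
    simpa using h2.symm
  · have h1 := LinearMap.congr_fun (congrArg (fun z : Pbar g => z.1.2.2) hf) (volOm θ)
    simp only [AddSubmonoidClass.coe_finsetSum, Prod.snd_sum, LinearMap.sum_apply,
      fMor_tmul_om, omDer_vol hg hθ] at h1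
    have h2 := congrArg (omCoord hθ) h1
    simp only [map_sum, omCoord_tmul, Submodule.coe_smul, map_smul, Finsupp.smul_apply,
      volOm, repr_quant_vol hθ, smul_eq_mul, mul_one] at h2
    have h3 := repr_sum_mon hθ (fun i => 4 * derCoord C θ 0 0 (δ i)) i
    rw [h2] at h3
    simp only [ZeroMemClass.coe_zero, Prod.snd_zero, LinearMap.zero_apply, map_zero,
      Finsupp.coe_zero, Pi.zero_apply] at h3
    have e := half_mul_two (R := R)
    linear_combination (-algebraMap ℝ R (1 / 2) * algebraMap ℝ R (1 / 2)) * h3 -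
      derCoord C θ 0 0 (δ i) * (1 + algebraMap ℝ R (1 / 2) * 2) * e

variable (hC : ∀ g ∈ C, ∀ g' ∈ C, ∃ u : R, g' = u • g) (hθ' : IsConfOrthonormal C θ)

theorem eq_sum_of_mem_Ibar (hg : g ∈ C) (hθ : IsON g θ) {x : Lbar C g} (hx : x ∈ Ibar C g) :
    x = ∑ b, (cBoost C g θ b x ⊗ₜ[R] sigmaBoost hC θ hθ' b +
      cRot C g θ b x ⊗ₜ[R] sigmaRot hC θ hθ' b) := by
  obtain ⟨δ, rfl⟩ := exists_mon_coeff hθ x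
  have h := coeff_of_mem_Ibar hg hθ hx
  have e : ∀ i, δ i = _ := fun i => eq_sum_sigma hC hg hθ hθ' (δ i) (h i).1 (h i).2
  conv_lhs =>
    enter [2, i]
    rw [e i, TensorProduct.tmul_sum]
  rw [Finset.sum_comm]
  refine Finset.sum_congr rfl fun b _ => ?_
  rw [map_sum, map_sum, TensorProduct.sum_tmul, TensorProduct.sum_tmul, ← Finset.sum_add_distrib]
  refine Finset.sum_congr rfl fun i _ => ?_
  rw [cBoost_tmul, cRot_tmul, TensorProduct.tmul_add, TensorProduct.smul_tmul,
    TensorProduct.smul_tmul]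

variable (g θ) in
/-- The products `θ₀θ_a` in the Clifford algebra. -/
def ee (a : Fin 3) : Cl g := gen g θ 0 * gen g θ a.succ

variable (g θ) in
/-- The product of all generators. -/
def om : Cl g := mon g θ 15

theorem om_eq : om g θ = gen g θ 0 * (gen g θ 1 * (gen g θ 2 * gen g θ 3)) := rfl

theorem om_mul_om (hθ : IsON g θ) : om g θ * om g θ = -1 := by
  simp [om_eq, mul_assoc, gen_rules hθ]

theorem om_mul_gen (hθ : IsON g θ) (i : Fin 4) : om g θ * gen g θ i = -(gen g θ i * om g θ) := by
  fin_cases i <;> simp [om_eq, mul_assoc, gen_rules hθ]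

variable (g) in
/-- The element `σ_b - ω ρ_b` of `L̄`, which acts on `W` as left multiplication by `-θ₀θ_b`. -/
def tau (b : Fin 3) : Lbar C g :=
  1 ⊗ₜ[R] sigmaBoost hC θ hθ' b + (-om g θ) ⊗ₜ[R] sigmaRot hC θ hθ' b

variable (g) in
/-- The combination `∑ a_b τ_b`. -/
def tauSum : (Fin 3 → Cl g) →ₗ[Cl g] Lbar C g :=
  ∑ b, (LinearMap.toSpanSingleton (Cl g) (Lbar C g) (tau g hC hθ' b)) ∘ₗ LinearMap.proj b

theorem tauSum_apply (a : Fin 3 → Cl g) : tauSum g hC hθ' a = ∑ b, a b • tau g hC hθ' b := by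
  simp [tauSum]

theorem smul_tau (a : Cl g) (b : Fin 3) : a • tau g hC hθ' b =
    a ⊗ₜ[R] sigmaBoost hC θ hθ' b + (-(a * om g θ)) ⊗ₜ[R] sigmaRot hC θ hθ' b := by
  rw [tau, smul_add, TensorProduct.smul_tmul', TensorProduct.smul_tmul', smul_eq_mul, smul_eq_mul,
    mul_one, mul_neg]

theorem fin3_succ : (0 : Fin 3).succ = (1 : Fin 4) ∧ (1 : Fin 3).succ = (2 : Fin 4) ∧
    (2 : Fin 3).succ = (3 : Fin 4) := ⟨rfl, rfl, rfl⟩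

theorem boostCoord_sigma (a b : Fin 3) :
    boostCoord C θ a (sigmaBoost hC θ hθ' b) = if a = b then 1 else 0 := by
  change θ.repr (boost θ b (θ 0)) a.succ = _
  rw [boost_zero, Module.Basis.repr_self, Finsupp.single_apply]
  simp [eq_comm]

theorem boostCoord_rot (a b : Fin 3) :
    boostCoord C θ a (sigmaRot hC θ hθ' b) = 0 := by
  change θ.repr (rot θ b (θ 0)) a.succ = _
  rw [rot_zero, map_zero, Finsupp.coe_zero, Pi.zero_apply]

theorem rotCoord_sigma (a b : Fin 3) :
    rotCoord C θ a (sigmaBoost hC θ hθ' b) = 0 := by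
  change θ.repr (boost θ b (θ (a + 2).succ)) (a + 1).succ = _
  rw [boost_succ]
  split_ifs <;> simp

theorem rotCoord_rot (a b : Fin 3) :
    rotCoord C θ a (sigmaRot hC θ hθ' b) = if a = b then 1 else 0 := by
  change θ.repr (rot θ b (θ (a + 2).succ)) (a + 1).succ = _
  obtain ⟨h1, h2, h3⟩ := fin3_succ
  have t := boost_rot_table θ
  fin_cases a <;> fin_cases b <;> simp [h1, h2, h3, t]

theorem cBoost_tauSum (a : Fin 3 → Cl g) (b : Fin 3) :
    cBoost C g θ b (tauSum g hC hθ' a) = a b := by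
  simp [tauSum_apply, smul_tau, cBoost_tmul, boostCoord_sigma, boostCoord_rot]

theorem cRot_tauSum (a : Fin 3 → Cl g) (b : Fin 3) :
    cRot C g θ b (tauSum g hC hθ' a) = -(a b * om g θ) := by
  simp [tauSum_apply, smul_tau, cRot_tmul, rotCoord_sigma, rotCoord_rot]

theorem fMor_tau (hθ : IsON g θ) (b : Fin 3) (j : Fin 4) :
    (fMor C g (tau g hC hθ' b)).1.2.1 (θ j) = -(ee g θ b * gen g θ j) := by
  have t := boost_rot_table θ
  obtain ⟨h1, h2, h3⟩ := fin3_succ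
  rw [tau, map_add]
  change (fMor C g _).1.2.1 (θ j) + (fMor C g _).1.2.1 (θ j) = _
  rw [fMor_tmul_snd, fMor_tmul_snd, sigmaBoost_apply, sigmaRot_apply, one_mul]
  fin_cases b <;> fin_cases j <;>
    simp [t, boost_zero, rot_zero, ee, om_eq, ← gen.eq_1, h1, h2, h3, gen_rules hθ, mul_assoc]

theorem tauSum_mem_Ibar (hg : g ∈ C) (hθ : IsON g θ) {a : Fin 3 → Cl g}
    (h : ∑ b, a b * ee g θ b = 0) : tauSum g hC hθ' a ∈ Ibar C g := by
  change fMor C g _ = 0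
  set p := fMor C g (tauSum g hC hθ' a) with hp
  have p1 : p.1.1 = 0 := by
    refine LinearMap.ext fun r => ?_
    rw [hp, tauSum_apply]
    simp only [smul_tau, map_sum, map_add, AddSubmonoidClass.coe_finsetSum, Prod.fst_sum,
      LinearMap.sum_apply, Submodule.coe_add, Prod.fst_add, LinearMap.add_apply,
      fMor_tmul_fst, sigmaBoost_fst, sigmaRot_fst]
    simp
  have p2 : p.1.2.1 = 0 := by
    have hj : ∀ j, p.1.2.1 (θ j) = 0 := by
      intro j
      rw [hp, tauSum_apply, map_sum]
      simp only [map_smul, AddSubmonoidClass.coe_finsetSum, Prod.snd_sum, Prod.fst_sum,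
        LinearMap.sum_apply]
      have : ∀ b, (a b • fMor C g (tau g hC hθ' b)).1.2.1 (θ j) =
          -((a b * ee g θ b) * gen g θ j) := by
        intro b
        change a b * (fMor C g (tau g hC hθ' b)).1.2.1 (θ j) = _
        rw [fMor_tau hC hθ' hθ, mul_neg, mul_assoc]
      simp only [this, Finset.sum_neg_distrib, ← Finset.sum_mul, h, zero_mul, neg_zero]
    refine LinearMap.ext fun w => ?_
    rw [← θ.sum_repr w, map_sum]
    refine Finset.sum_eq_zero fun j _ => ?_
    rw [p.2.2.1, p1, hj, LinearMap.zero_apply, zero_mul, smul_zero, add_zero]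
  have p3 : p.1.2.2 = 0 := by
    have hv : p.1.2.2 (volOm θ) = 0 := by
      rw [hp, tauSum_apply]
      simp only [smul_tau, map_sum, map_add, AddSubmonoidClass.coe_finsetSum, Prod.snd_sum,
        LinearMap.sum_apply, Submodule.coe_add, Prod.snd_add, LinearMap.add_apply,
        fMor_tmul_om, omDer_vol hg hθ]
      have z1 : ∀ b, derCoord C θ 0 0 (sigmaBoost hC θ hθ' b) = 0 := fun b => by
        change θ.repr (boost θ b (θ 0)) 0 = _
        rw [boost_zero]; simp
      have z2 : ∀ b, derCoord C θ 0 0 (sigmaRot hC θ hθ' b) = 0 := fun b => by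
        change θ.repr (rot θ b (θ 0)) 0 = _
        rw [rot_zero]; simp
      simp [z1, z2]
    refine LinearMap.ext fun η => ?_
    have e : η = (monBasis g θ hθ).repr (quant g η) 15 • volOm θ :=
      Subtype.ext (eq_smul_vol hθ η.2)
    rw [e, p.2.2.2, p1, hv, LinearMap.zero_apply, smul_zero, TensorProduct.zero_tmul, add_zero,
      LinearMap.zero_apply]
  exact Subtype.ext (Prod.ext p1 (Prod.ext p2 p3))

/-- Together with `tauSum_mem_Ibar`: the kernel of `f` consists of the combinations `∑ a_b τ_b`
with `∑ a_b θ₀θ_b = 0`, and the coefficients `a_b` are the boost coordinates. -/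
theorem eq_tauSum_of_mem_Ibar (hg : g ∈ C) (hθ : IsON g θ) {x : Lbar C g} (hx : x ∈ Ibar C g) :
    x = tauSum g hC hθ' (fun b => cBoost C g θ b x) ∧
      ∑ b, cBoost C g θ b x * ee g θ b = 0 := by
  have hs := eq_sum_of_mem_Ibar hC hθ' hg hθ hx
  set A := fun b => cBoost C g θ b x with hA
  set B := fun b => cRot C g θ b x with hB
  have hx' : fMor C g x = 0 := hx
  have hj : ∀ j, ∑ b, (A b * CliffordAlgebra.ι (negQuad g) (boost θ b (θ j)) +
      B b * CliffordAlgebra.ι (negQuad g) (rot θ b (θ j))) = 0 := by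
    intro j
    have h1 := LinearMap.congr_fun (congrArg (fun z : Pbar g => z.1.2.1) hx') (θ j)
    rw [hs] at h1
    simp only [map_sum, map_add, AddSubmonoidClass.coe_finsetSum, Prod.snd_sum, Prod.fst_sum,
      LinearMap.sum_apply, Submodule.coe_add, Prod.snd_add, Prod.fst_add, LinearMap.add_apply,
      fMor_tmul_snd, sigmaBoost_apply, sigmaRot_apply] at h1
    exact h1
  obtain ⟨s1, s2, s3⟩ := fin3_succ
  have t := boost_rot_table θ
  have h0 := hj 0
  have h1 := congrArg (· * gen g θ 1) (hj 1)
  have h2 := congrArg (· * gen g θ 2) (hj 2)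
  have h3 := congrArg (· * gen g θ 3) (hj 3)
  simp only [Fin.sum_univ_three, t, boost_zero, rot_zero, map_zero, map_neg, mul_zero, add_zero,
    zero_add, mul_neg, ← gen.eq_1, s1, s2, s3, zero_mul] at h0 h1 h2 h3
  have k0 : A 0 * ee g θ 0 + A 1 * ee g θ 1 + A 2 * ee g θ 2 = 0 := by
    have := congrArg (· * gen g θ 0) h0
    simp only [add_mul, mul_assoc, zero_mul, gen_rules hθ, mul_neg] at this
    simp only [ee, s1, s2, s3]
    rw [← neg_eq_zero, ← this]
    abel
  -- with `H_k = A_k θ₀θ_k` and `G_k = B_k θ_{k+1}θ_{k+2}` the remaining equations are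
  -- `H_k + G_{k+1} + G_{k+2} = 0`, and `∑ H_k = 0` then gives `∑ G_k = 0`
  have e1 : A 0 * ee g θ 0 + B 1 * (gen g θ 3 * gen g θ 1) + B 2 * (gen g θ 1 * gen g θ 2) = 0 := by
    rw [← h1]; simp [ee, s1, add_mul, mul_assoc, gen_rules hθ]
  have e2 : A 1 * ee g θ 1 + B 2 * (gen g θ 1 * gen g θ 2) + B 0 * (gen g θ 2 * gen g θ 3) = 0 := by
    rw [← h2]; simp [ee, s2, add_mul, mul_assoc, gen_rules hθ]; abel
  have e3 : A 2 * ee g θ 2 + B 0 * (gen g θ 2 * gen g θ 3) + B 1 * (gen g θ 3 * gen g θ 1) = 0 := by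
    rw [← h3]; simp [ee, s3, add_mul, mul_assoc, gen_rules hθ]; abel
  have hG : B 0 * (gen g θ 2 * gen g θ 3) + B 1 * (gen g θ 3 * gen g θ 1) +
      B 2 * (gen g θ 1 * gen g θ 2) = 0 := by
    set G := B 0 * (gen g θ 2 * gen g θ 3) + B 1 * (gen g θ 3 * gen g θ 1) +
      B 2 * (gen g θ 1 * gen g θ 2) with hGd
    have h2G : (2 : R) • G = 0 := by
      have : (2 : R) • G = (A 0 * ee g θ 0 + B 1 * (gen g θ 3 * gen g θ 1) +
          B 2 * (gen g θ 1 * gen g θ 2)) + (A 1 * ee g θ 1 + B 2 * (gen g θ 1 * gen g θ 2) +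
          B 0 * (gen g θ 2 * gen g θ 3)) + (A 2 * ee g θ 2 + B 0 * (gen g θ 2 * gen g θ 3) +
          B 1 * (gen g θ 3 * gen g θ 1)) -
          (A 0 * ee g θ 0 + A 1 * ee g θ 1 + A 2 * ee g θ 2) := by
        rw [hGd]; module
      rw [this, e1, e2, e3, k0]; simp
    rw [← one_smul R G, ← half_mul_two (R := R), mul_smul, h2G, smul_zero]
  have r0 : A 0 * ee g θ 0 = B 0 * (gen g θ 2 * gen g θ 3) := by
    linear_combination (norm := module) e1 - hG
  have r1 : A 1 * ee g θ 1 = B 1 * (gen g θ 3 * gen g θ 1) := by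
    linear_combination (norm := module) e2 - hG
  have r2 : A 2 * ee g θ 2 = B 2 * (gen g θ 1 * gen g θ 2) := by
    linear_combination (norm := module) e3 - hG
  have hAB : ∀ b, B b = -(A b * om g θ) := by
    intro b
    fin_cases b
    · have := congrArg (· * (gen g θ 2 * gen g θ 3)) r0
      simp [ee, s1, mul_assoc, gen_rules hθ] at this
      simp [om_eq, this]
    · have := congrArg (· * (gen g θ 3 * gen g θ 1)) r1
      simp [ee, s2, mul_assoc, gen_rules hθ] at this
      simp [om_eq, this]
    · have := congrArg (· * (gen g θ 1 * gen g θ 2)) r2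
      simp [ee, s3, mul_assoc, gen_rules hθ] at this
      simp [om_eq, this]
  refine ⟨?_, ?_⟩
  · rw [tauSum_apply]
    conv_lhs => rw [hs]
    refine Finset.sum_congr rfl fun b _ => ?_
    rw [smul_tau, ← hAB]
  · rw [Fin.sum_univ_three]
    exact k0

end KernelStructure

/-! ### The filtration of the kernel of `f` -/

section Filtration

variable {R W : Type*} [CommRing R] [Algebra ℝ R] [AddCommGroup W] [Module R W]
  [Module ℝ W] [IsScalarTower ℝ R W] {C : Set (LinearMap.BilinForm R W)}
  {g : LinearMap.BilinForm R W} {θ : Module.Basis (Fin 4) R W}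

variable (R) in
/-- The symmetric traceless matrices. -/
def stfMat : Submodule R (Matrix (Fin 3) (Fin 3) R) where
  carrier := {P | P.IsSymm ∧ P.trace = 0}
  zero_mem' := ⟨Matrix.isSymm_zero, Matrix.trace_zero _ _⟩
  add_mem' := by
    rintro P Q ⟨h1, h2⟩ ⟨k1, k2⟩
    exact ⟨h1.add k1, by rw [Matrix.trace_add, h2, k2, add_zero]⟩
  smul_mem' := by
    rintro r P ⟨h1, h2⟩
    exact ⟨h1.smul r, by rw [Matrix.trace_smul, h2, smul_zero]⟩

theorem mem_stfMat_iff {P : Matrix (Fin 3) (Fin 3) R} : P ∈ stfMat R ↔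
    P 1 0 = P 0 1 ∧ P 2 0 = P 0 2 ∧ P 2 1 = P 1 2 ∧ P 2 2 = -P 0 0 - P 1 1 := by
  constructor
  · rintro ⟨h, t⟩
    rw [Matrix.trace_fin_three] at t
    exact ⟨h.apply _ _, h.apply _ _, h.apply _ _, by linear_combination t⟩
  · rintro ⟨h1, h2, h3, h4⟩
    refine ⟨Matrix.IsSymm.ext fun i j => ?_, ?_⟩
    · fin_cases i <;> fin_cases j <;> simp [h1, h2, h3]
    · rw [Matrix.trace_fin_three, h4]; ring

variable (R) in
/-- The scalar `1/2`. -/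
def half : R := algebraMap ℝ R (1 / 2)

variable (R) in
/-- The scalar `1/3`. -/
def third : R := algebraMap ℝ R (1 / 3)

theorem half_add_half : half R + half R = 1 := by
  rw [half, ← map_add]; norm_num

theorem third_mul_three : third R * 3 = 1 := by
  rw [third, ← map_ofNat (algebraMap ℝ R) 3, ← map_mul]
  norm_num

theorem half_smul_add {N : Type*} [AddCommGroup N] [Module R N] (y : N) :
    half R • y + half R • y = y := by
  rw [← add_smul, half_add_half, one_smul]

/-- The projection to the symmetric traceless part of a matrix. -/
def stfPart : Matrix (Fin 3) (Fin 3) R →ₗ[R] Matrix (Fin 3) (Fin 3) R where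
  toFun P := half R • (P + P.transpose) -
    (third R * P.trace) • 1
  map_add' P Q := by
    rw [Matrix.transpose_add, Matrix.trace_add]; module
  map_smul' r P := by
    rw [Matrix.transpose_smul, Matrix.trace_smul, RingHom.id_apply, smul_eq_mul]; module

theorem stfPart_apply (P : Matrix (Fin 3) (Fin 3) R) (i j : Fin 3) : stfPart P i j =
    half R * (P i j + P j i) -
      third R * (P 0 0 + P 1 1 + P 2 2) * (if i = j then 1 else 0) := by
  change (half R • (P + P.transpose) -
    (third R * P.trace) • (1 : Matrix (Fin 3) (Fin 3) R)) i j = _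
  simp [Matrix.trace_fin_three, Matrix.one_apply, mul_add]

theorem stfPart_mem (P : Matrix (Fin 3) (Fin 3) R) : stfPart P ∈ stfMat R := by
  have e2 := half_add_half (R := R)
  have e3 := third_mul_three (R := R)
  rw [mem_stfMat_iff]
  simp only [stfPart_apply]
  refine ⟨by simp [add_comm], by simp [add_comm], by simp [add_comm], ?_⟩
  simp only [if_true, mul_one]
  linear_combination (P 0 0 + P 1 1 + P 2 2) * (e2 - e3)

/-- The products `θ₂θ₃`, `θ₃θ₁`, `θ₁θ₂` in the Clifford algebra. -/
def ff (g : LinearMap.BilinForm R W) (θ : Module.Basis (Fin 4) R W) (a : Fin 3) : Cl g :=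
  gen g θ (a + 1).succ * gen g θ (a + 2).succ

theorem ee_ff_eq (hθ : IsON g θ) :
    ee g θ 0 = mon g θ 3 ∧ ee g θ 1 = mon g θ 5 ∧ ee g θ 2 = mon g θ 9 ∧
    ff g θ 0 = mon g θ 12 ∧ ff g θ 1 = -mon g θ 10 ∧ ff g θ 2 = mon g θ 6 ∧
    om g θ = mon g θ 15 := by
  obtain ⟨s1, s2, s3⟩ := fin3_succ
  refine ⟨rfl, rfl, rfl, rfl, ?_, ?_, rfl⟩
  · change gen g θ 3 * gen g θ 1 = -(gen g θ 1 * gen g θ 3)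
    exact gen_mul_gen hθ (by decide)
  · rfl

variable (g θ) in
/-- The coefficients of `∑ (P_ab θ₀θ_a + Q_ab θ_{a+1}θ_{a+2}) τ_b`. -/
def mcoef : (Matrix (Fin 3) (Fin 3) R × Matrix (Fin 3) (Fin 3) R) →ₗ[R] (Fin 3 → Cl g) where
  toFun p b := ∑ a, (p.1 a b • ee g θ a + p.2 a b • ff g θ a)
  map_add' p q := by
    ext b
    simp only [Prod.fst_add, Prod.snd_add, Matrix.add_apply, Pi.add_apply,
      ← Finset.sum_add_distrib]
    exact Finset.sum_congr rfl fun a _ => by module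
  map_smul' r p := by
    ext b
    simp only [Prod.smul_fst, Prod.smul_snd, Matrix.smul_apply, Pi.smul_apply,
      Finset.smul_sum, RingHom.id_apply]
    exact Finset.sum_congr rfl fun a _ => by simp only [smul_eq_mul]; module

theorem mcoef_apply (p : Matrix (Fin 3) (Fin 3) R × Matrix (Fin 3) (Fin 3) R) (b : Fin 3) :
    mcoef g θ p b = ∑ a, (p.1 a b • ee g θ a + p.2 a b • ff g θ a) := rfl

variable (g θ) in
/-- The solutions of `∑ a_b θ₀θ_b = 0`. -/
def sol : Submodule (Cl g) (Fin 3 → Cl g) where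
  carrier := {a | ∑ b, a b * ee g θ b = 0}
  zero_mem' := by simp
  add_mem' := by
    intro a b (ha : _ = _) (hb : _ = _)
    simp only [Set.mem_ofPred_eq, Pi.add_apply, add_mul, Finset.sum_add_distrib, ha, hb, add_zero]
  smul_mem' := by
    intro c a (ha : _ = _)
    simp only [Set.mem_ofPred_eq, Pi.smul_apply, smul_eq_mul, mul_assoc, ← Finset.mul_sum, ha,
      mul_zero]

theorem mem_sol {a : Fin 3 → Cl g} : a ∈ sol g θ ↔ ∑ b, a b * ee g θ b = 0 := Iff.rfl

theorem mcoef_mem_sol (hθ : IsON g θ) {P Q : Matrix (Fin 3) (Fin 3) R} (hP : P ∈ stfMat R)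
    (hQ : Q ∈ stfMat R) : mcoef g θ (P, Q) ∈ sol g θ := by
  obtain ⟨p1, p2, p3, p4⟩ := mem_stfMat_iff.1 hP
  obtain ⟨q1, q2, q3, q4⟩ := mem_stfMat_iff.1 hQ
  obtain ⟨h1, h2, h3, h4, h5, h6, h7⟩ := ee_ff_eq hθ
  rw [mem_sol]
  simp only [mcoef_apply, Fin.sum_univ_three, h1, h2, h3, h4, h5, h6, p1, p2, p3, p4, q1, q2, q3,
    q4]
  simp [mon, add_mul, mul_assoc, gen_rules hθ]
  module

variable (g θ) in
/-- The coefficients of `τ_c + ½ θ_cθ_{c+1} τ_{c+1} - ½ θ_{c+2}θ_c τ_{c+2}`, with `θ` and `τ`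
indexed by the spatial directions modulo three: the solution of `∑ a_b θ₀θ_b = 0` whose coefficient
at `τ_c` is `1`. -/
def kcoef (c b : Fin 3) : Cl g :=
  if b = c then 1 else if b = c + 1 then half R • ff g θ (c + 2)
  else -(half R • ff g θ (c + 1))

theorem kcoef_mem_sol (hθ : IsON g θ) (c : Fin 3) : kcoef g θ c ∈ sol g θ := by
  obtain ⟨h1, h2, h3, h4, h5, h6, h7⟩ := ee_ff_eq hθ
  have key := fun y : Cl g => half_smul_add (R := R) y
  rw [mem_sol]
  fin_cases c
  · simp [kcoef, Fin.sum_univ_three, h1, h2, h3, h5, h6]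
    simp [mon, mul_assoc, gen_rules hθ]
    conv_lhs => enter [1, 1]; rw [← key (gen g θ 0 * gen g θ 1)]
    module
  · simp [kcoef, Fin.sum_univ_three, h1, h2, h3, h4, h6]
    simp [mon, mul_assoc, gen_rules hθ]
    conv_lhs => enter [1, 2]; rw [← key (gen g θ 0 * gen g θ 2)]
    module
  · simp [kcoef, Fin.sum_univ_three, h1, h2, h3, h4, h5]
    simp [mon, mul_assoc, gen_rules hθ]
    conv_lhs => enter [2]; rw [← key (gen g θ 0 * gen g θ 3)]
    module

/-- The linear equations for the coordinates of the solutions of `∑ a_b θ₀θ_b = 0`; only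
coordinates of even degree are used. -/
theorem sol_equations (hθ : IsON g θ) {c : Fin 3 → Fin 16 → R}
    (h : (fun b => ∑ i, c b i • mon g θ i) ∈ sol g θ) :
    c 0 3 + c 1 5 + c 2 9 = 0 ∧ c 0 12 - c 1 10 + c 2 6 = 0 ∧
    c 0 0 - c 2 10 - c 1 6 = 0 ∧ c 1 0 + c 0 6 - c 2 12 = 0 ∧ c 2 0 + c 1 12 + c 0 10 = 0 ∧
    c 0 15 - c 2 5 + c 1 9 = 0 ∧ c 1 15 - c 0 9 + c 2 3 = 0 ∧ c 2 15 - c 1 3 + c 0 5 = 0 := by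
  rw [mem_sol] at h
  -- the coordinates of the left hand side in the basis of products of distinct generators
  have key : ∑ b, (∑ i, c b i • mon g θ i) * ee g θ b = ∑ i, (![c 0 3 + c 1 5 + c 2 9,
      c 0 2 + c 1 4 + c 2 8,
      c 0 1 - c 1 7 - c 2 11,
      c 0 0 - c 1 6 - c 2 10,
      c 0 7 + c 1 1 - c 2 13,
      c 0 6 + c 1 0 - c 2 12,
      c 0 5 - c 1 3 + c 2 15,
      c 0 4 - c 1 2 + c 2 14,
      c 0 11 + c 1 13 + c 2 1,
      c 0 10 + c 1 12 + c 2 0,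
      c 0 9 - c 1 15 - c 2 3,
      c 0 8 - c 1 14 - c 2 2,
      c 0 15 + c 1 9 - c 2 5,
      c 0 14 + c 1 8 - c 2 4,
      c 0 13 - c 1 11 + c 2 7,
      c 0 12 - c 1 10 + c 2 6] : Fin 16 → R) i • mon g θ i := by
    obtain ⟨h1, h2, h3, h4, h5, h6, h7⟩ := ee_ff_eq hθ
    simp only [Fin.sum_univ_three, h1, h2, h3]
    simp only [Fin.sum_univ_succ]
    simp [mon, add_mul, mul_assoc, gen_rules hθ]
    module
  have hd := fun i => repr_sum_mon hθ (![c 0 3 + c 1 5 + c 2 9,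
      c 0 2 + c 1 4 + c 2 8,
      c 0 1 - c 1 7 - c 2 11,
      c 0 0 - c 1 6 - c 2 10,
      c 0 7 + c 1 1 - c 2 13,
      c 0 6 + c 1 0 - c 2 12,
      c 0 5 - c 1 3 + c 2 15,
      c 0 4 - c 1 2 + c 2 14,
      c 0 11 + c 1 13 + c 2 1,
      c 0 10 + c 1 12 + c 2 0,
      c 0 9 - c 1 15 - c 2 3,
      c 0 8 - c 1 14 - c 2 2,
      c 0 15 + c 1 9 - c 2 5,
      c 0 14 + c 1 8 - c 2 4,
      c 0 13 - c 1 11 + c 2 7,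
      c 0 12 - c 1 10 + c 2 6] : Fin 16 → R) i
  rw [← key, h] at hd
  have e0 := hd 0
  have e15 := hd 15
  have e3 := hd 3
  have e5 := hd 5
  have e9 := hd 9
  have e12 := hd 12
  have e10 := hd 10
  have e6 := hd 6
  simp at e0 e15 e3 e5 e9 e12 e10 e6
  refine ⟨?_, ?_, ?_, ?_, ?_, ?_, ?_, ?_⟩
  · linear_combination -e0
  · linear_combination -e15
  · linear_combination -e3
  · linear_combination -e5
  · linear_combination -e9
  · linear_combination -e12
  · linear_combination e10
  · linear_combination -e6

variable (g θ) in
/-- The coordinates of the products `θ₀θ_a` in a triple of elements of the Clifford algebra. -/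
def matE (hθ : IsON g θ) : (Fin 3 → Cl g) →ₗ[R] Matrix (Fin 3) (Fin 3) R where
  toFun a := Matrix.of fun i b => ![(monBasis g θ hθ).repr (a b) 3, (monBasis g θ hθ).repr (a b) 5,
    (monBasis g θ hθ).repr (a b) 9] i
  map_add' a b := by ext i j; fin_cases i <;> simp
  map_smul' r a := by ext i j; fin_cases i <;> simp

variable (g θ) in
/-- The coordinates of the products `θ₂θ₃`, `θ₃θ₁`, `θ₁θ₂` in a triple of elements of the Clifford
algebra. -/
def matF (hθ : IsON g θ) : (Fin 3 → Cl g) →ₗ[R] Matrix (Fin 3) (Fin 3) R where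
  toFun a := Matrix.of fun i b => ![(monBasis g θ hθ).repr (a b) 12,
    -(monBasis g θ hθ).repr (a b) 10, (monBasis g θ hθ).repr (a b) 6] i
  map_add' a b := by ext i j; fin_cases i <;> simp [add_comm]
  map_smul' r a := by ext i j; fin_cases i <;> simp

variable (g θ) in
/-- A linear map to the solutions of `∑ a_b θ₀θ_b = 0`, to be used on even triples. An even solution
is determined by its coordinates at `1` and `ω`, which are free and contribute multiples of `kcoef`
and `ω kcoef`, and by the symmetric traceless parts of its bivector coordinates. -/
def evenSol (hθ : IsON g θ) : (Fin 3 → Cl g) →ₗ[R] (Fin 3 → Cl g) where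
  toFun a := mcoef g θ (stfPart (matE g θ hθ a), stfPart (matF g θ hθ a)) +
    ∑ d, ((monBasis g θ hθ).repr (a d) 0 • kcoef g θ d +
      (monBasis g θ hθ).repr (a d) 15 • om g θ • kcoef g θ d)
  map_add' a b := by
    rw [map_add, map_add, map_add, map_add, ← Prod.mk_add_mk, map_add]
    simp only [Pi.add_apply, map_add, Finsupp.add_apply, Fin.sum_univ_three]
    generalize om g θ • kcoef g θ 0 = z₀, om g θ • kcoef g θ 1 = z₁, om g θ • kcoef g θ 2 = z₂
    module
  map_smul' r a := by
    rw [map_smul, map_smul, map_smul, map_smul, ← Prod.smul_mk, map_smul]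
    simp only [Pi.smul_apply, map_smul, Finsupp.smul_apply, Fin.sum_univ_three, smul_eq_mul,
      RingHom.id_apply]
    generalize om g θ • kcoef g θ 0 = z₀, om g θ • kcoef g θ 1 = z₁, om g θ • kcoef g θ 2 = z₂
    module

theorem evenSol_apply (hθ : IsON g θ) (a : Fin 3 → Cl g) : evenSol g θ hθ a =
    mcoef g θ (stfPart (matE g θ hθ a), stfPart (matF g θ hθ a)) +
    ∑ d, ((monBasis g θ hθ).repr (a d) 0 • kcoef g θ d +
      (monBasis g θ hθ).repr (a d) 15 • om g θ • kcoef g θ d) := rfl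

theorem evenSol_mem_sol (hθ : IsON g θ) (a : Fin 3 → Cl g) : evenSol g θ hθ a ∈ sol g θ := by
  have h : ∀ (r : R) (x : Fin 3 → Cl g), x ∈ sol g θ → r • x ∈ sol g θ := fun r x hx => by
    rw [← algebraMap_smul (Cl g) r x]
    exact Submodule.smul_mem _ _ hx
  rw [evenSol_apply]
  refine add_mem (mcoef_mem_sol hθ (stfPart_mem _) (stfPart_mem _)) (Submodule.sum_mem _ ?_)
  exact fun d _ => add_mem (h _ _ (kcoef_mem_sol hθ d))
    (h _ _ (Submodule.smul_mem _ _ (kcoef_mem_sol hθ d)))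

variable (g θ) in
/-- The even part of an element of the Clifford algebra, in coordinates. -/
def evenPart (hθ : IsON g θ) (a : Cl g) : Cl g :=
  ∑ i ∈ ({0, 3, 5, 6, 9, 10, 12, 15} : Finset (Fin 16)), (monBasis g θ hθ).repr a i • mon g θ i

/-- On solutions of `∑ a_b θ₀θ_b = 0`, the map `evenSol` is the projection to the even part. -/
theorem evenSol_of_mem_sol (hθ : IsON g θ) {a : Fin 3 → Cl g} (ha : a ∈ sol g θ) :
    evenSol g θ hθ a = fun b => evenPart g θ hθ (a b) := by
  have ha' : (fun b => ∑ i, (monBasis g θ hθ).repr (a b) i • mon g θ i) ∈ sol g θ := by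
    simpa only [sum_mon_repr] using ha
  obtain ⟨t1, t2, t3, t4, t5, t6, t7, t8⟩ := sol_equations hθ ha'
  obtain ⟨h1, h2, h3, h4, h5, h6, h7⟩ := ee_ff_eq hθ
  set c := fun b => (monBasis g θ hθ).repr (a b) with hc
  have e2 := half_add_half (R := R)
  have t1' : c 0 3 + c 1 5 + c 2 9 = 0 := t1
  have t2' : c 0 12 + -c 1 10 + c 2 6 = 0 := by linear_combination t2
  have t3' : c 0 0 = c 2 10 + c 1 6 := by linear_combination t3
  have t4' : c 1 0 = -c 0 6 + c 2 12 := by linear_combination t4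
  have t5' : c 2 0 = -c 1 12 - c 0 10 := by linear_combination t5
  have t6' : c 0 15 = c 2 5 - c 1 9 := by linear_combination t6
  have t7' : c 1 15 = c 0 9 - c 2 3 := by linear_combination t7
  have t8' : c 2 15 = c 1 3 - c 0 5 := by linear_combination t8
  have o1 : mon g θ 15 * mon g θ 6 = -mon g θ 9 := by simp [mon, mul_assoc, gen_rules hθ]
  have o2 : mon g θ 15 * mon g θ 10 = mon g θ 5 := by simp [mon, mul_assoc, gen_rules hθ]
  have o3 : mon g θ 15 * mon g θ 12 = -mon g θ 3 := by simp [mon, mul_assoc, gen_rules hθ]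
  have o4 : mon g θ 0 = 1 := rfl
  ext b
  rw [evenSol_apply]
  change (mcoef g θ _ b) + (∑ d, (c d 0 • kcoef g θ d + c d 15 • om g θ • kcoef g θ d)) b = _
  rw [mcoef_apply]
  simp only [stfPart_apply]
  have m1 : ∀ i b, matE g θ hθ a i b = ![c b 3, c b 5, c b 9] i := fun _ _ => rfl
  have m2 : ∀ i b, matF g θ hθ a i b = ![c b 12, -c b 10, c b 6] i := fun _ _ => rfl
  simp only [m1, m2]
  change _ = ∑ i ∈ ({0, 3, 5, 6, 9, 10, 12, 15} : Finset (Fin 16)), c b i • mon g θ i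
  fin_cases b
  · simp [kcoef, Fin.sum_univ_three, h1, h2, h3, h4, h5, h6, h7, t1', t2', t3', t4', t5', t6', t7',
      t8', o1, o2, o4]
    linear_combination (norm := module) e2 • (c 0 3 • mon g θ 3 + c 0 5 • mon g θ 5 +
      c 0 6 • mon g θ 6 + c 0 9 • mon g θ 9 + c 0 10 • mon g θ 10 + c 0 12 • mon g θ 12)
  · simp [kcoef, Fin.sum_univ_three, h1, h2, h3, h4, h5, h6, h7, t1', t2', t3', t4', t5', t6', t7',
      t8', o1, o3, o4]
    linear_combination (norm := module) e2 • (c 1 3 • mon g θ 3 + c 1 5 • mon g θ 5 +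
      c 1 6 • mon g θ 6 + c 1 9 • mon g θ 9 + c 1 10 • mon g θ 10 + c 1 12 • mon g θ 12)
  · simp [kcoef, Fin.sum_univ_three, h1, h2, h3, h4, h5, h6, h7, t1', t2', t3', t4', t5', t6', t7',
      t8', o2, o3, o4]
    linear_combination (norm := module) e2 • (c 2 3 • mon g θ 3 + c 2 5 • mon g θ 5 +
      c 2 6 • mon g θ 6 + c 2 9 • mon g θ 9 + c 2 10 • mon g θ 10 + c 2 12 • mon g θ 12)

end Filtration

section FilteredProjection

variable {R W : Type*} [CommRing R] [Algebra ℝ R] [AddCommGroup W] [Module R W]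
  [Module ℝ W] [IsScalarTower ℝ R W] {C : Set (LinearMap.BilinForm R W)}
  {g : LinearMap.BilinForm R W} {θ : Module.Basis (Fin 4) R W}

theorem gen_zero_mul_mon (hθ : IsON g θ) (i : Fin 16) :
    gen g θ 0 * mon g θ i = mon g θ (monNext 0 i) := by
  fin_cases i <;> simp [mon, monNext, gen_rules hθ]

theorem repr_gen_zero_mul (hθ : IsON g θ) (a : Cl g) (i : Fin 16) :
    (monBasis g θ hθ).repr (gen g θ 0 * a) i = (monBasis g θ hθ).repr a (monNext 0 i) := by
  have h : gen g θ 0 * a = ∑ j, (monBasis g θ hθ).repr a (monNext 0 j) • mon g θ j := by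
    conv_lhs => rw [← sum_mon_repr hθ a, Finset.mul_sum]
    simp only [mul_smul_comm, gen_zero_mul_mon hθ]
    have inv : Function.Involutive (monNext 0) := by unfold Function.Involutive; decide
    rw [← Equiv.sum_comp inv.toPerm]
    simp only [Function.Involutive.coe_toPerm, inv _]
  rw [h, repr_sum_mon]

/-- A solution `a` of `∑ a_b θ₀θ_b = 0` is the sum of its even part and of `θ₀` times the even part of
the solution `θ₀ a`, because `θ₀² = 1`. -/
theorem sol_decomposition (hθ : IsON g θ) {a : Fin 3 → Cl g} (ha : a ∈ sol g θ) :
    a = evenSol g θ hθ a + gen g θ 0 • evenSol g θ hθ (gen g θ 0 • a) := by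
  rw [evenSol_of_mem_sol hθ ha, evenSol_of_mem_sol hθ (Submodule.smul_mem _ _ ha)]
  ext b
  simp only [Pi.add_apply, Pi.smul_apply, smul_eq_mul, evenPart, repr_gen_zero_mul hθ,
    Finset.mul_sum, mul_smul_comm, gen_zero_mul_mon hθ]
  conv_lhs => rw [← sum_mon_repr hθ (a b)]
  simp [Fin.sum_univ_succ, monNext]
  abel

theorem om_smul_mcoef (hθ : IsON g θ) (P Q : Matrix (Fin 3) (Fin 3) R) :
    om g θ • mcoef g θ (P, Q) = mcoef g θ (-Q, P) := by
  obtain ⟨h1, h2, h3, h4, h5, h6, h7⟩ := ee_ff_eq hθ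
  ext b
  simp only [Pi.smul_apply, mcoef_apply, Fin.sum_univ_three, h1, h2, h3, h4, h5, h6, om, smul_eq_mul]
  simp [mon, mul_add, mul_assoc, gen_rules hθ]
  abel

variable (R) in
/-- The symmetric matrix with entries `1` in positions `(a, b)` and `(b, a)`, for `a ≠ b`. -/
def symUnit (a b : Fin 3) : Matrix (Fin 3) (Fin 3) R := Matrix.single a b 1 + Matrix.single b a 1

theorem symUnit_mem {a b : Fin 3} (h : a ≠ b) : symUnit R a b ∈ stfMat R := by
  refine ⟨?_, ?_⟩
  · rw [Matrix.IsSymm, symUnit, Matrix.transpose_add, Matrix.transpose_single,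
      Matrix.transpose_single, add_comm]
  · rw [symUnit, Matrix.trace_add, Matrix.trace_single_eq_of_ne _ _ _ h,
      Matrix.trace_single_eq_of_ne _ _ _ h.symm, add_zero]

/-- The odd solutions `θ₀ k_c` are combinations of vectors times solutions of degree two. -/
theorem gen_zero_smul_kcoef (hθ : IsON g θ) (c : Fin 3) : gen g θ 0 • kcoef g θ c =
    gen g θ (c + 2).succ • mcoef g θ (symUnit R (c + 2) c, 0) +
      gen g θ 0 • mcoef g θ (0, half R • symUnit R (c + 1) (c + 2)) := by
  obtain ⟨h1, h2, h3, h4, h5, h6, h7⟩ := ee_ff_eq hθ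
  obtain ⟨s1, s2, s3⟩ := fin3_succ
  have key := fun y : Cl g => half_smul_add (R := R) y
  have e2 := half_add_half (R := R)
  ext b
  simp only [Pi.smul_apply, Pi.add_apply, mcoef_apply, Fin.sum_univ_three, h1, h2, h3, h4, h5, h6,
    smul_eq_mul]
  fin_cases c <;> fin_cases b <;>
    simp [kcoef, symUnit, h4, h5, h6, s1, s2, s3, mon, gen_rules hθ]
  · linear_combination (norm := module) e2 • (gen g θ 0 * (gen g θ 1 * gen g θ 3))
  · linear_combination (norm := module) -(e2 • (gen g θ 0 * (gen g θ 1 * gen g θ 2)))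
  · linear_combination (norm := module) -(e2 • (gen g θ 0 * (gen g θ 2 * gen g θ 3)))

theorem gen_zero_smul_om_smul_kcoef (hθ : IsON g θ) (c : Fin 3) :
    gen g θ 0 • om g θ • kcoef g θ c =
    gen g θ (c + 2).succ • mcoef g θ (0, symUnit R (c + 2) c) +
      gen g θ 0 • mcoef g θ (-(half R • symUnit R (c + 1) (c + 2)), 0) := by
  have h : ∀ (i : Fin 4) (a : Fin 3 → Cl g), om g θ • gen g θ i • a = -(gen g θ i • om g θ • a) := by
    intro i a
    rw [← mul_smul, om_mul_gen hθ, neg_smul, mul_smul]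
  have e := congrArg (om g θ • ·) (gen_zero_smul_kcoef hθ c)
  simp only [smul_add, h, om_smul_mcoef hθ, neg_zero] at e
  rw [← neg_inj, e, neg_add]

variable (hC : ∀ g ∈ C, ∀ g' ∈ C, ∃ u : R, g' = u • g) (hθ' : IsConfOrthonormal C θ)

variable (g) in
/-- The elements `∑ (P_ab θ₀θ_a + Q_ab θ_{a+1}θ_{a+2}) τ_b` with `P`, `Q` symmetric and
traceless. -/
def weylBar : Submodule R (Lbar C g) :=
  (((stfMat R).prod (stfMat R)).map (mcoef g θ)).map ((tauSum g hC hθ').restrictScalars R)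

/-- The products of vectors and elements of `V`. -/
def vecMul (V : Submodule R (Lbar C g)) : Submodule R (Lbar C g) :=
  Submodule.span R {y | ∃ (w : W), ∃ v ∈ V, y = CliffordAlgebra.ι (negQuad g) w • v}

theorem gen_smul_mem_vecMul {V : Submodule R (Lbar C g)} {v : Lbar C g} (hv : v ∈ V) (i : Fin 4) :
    gen g θ i • v ∈ vecMul V := Submodule.subset_span ⟨θ i, v, hv, rfl⟩

theorem vecMul_le {V : Submodule R (Lbar C g)} {k : ℤ} (h : V ≤ (lbarFil C g).F k) :
    vecMul V ≤ (lbarFil C g).F (k + 1) := by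
  refine Submodule.span_le.2 ?_
  rintro _ ⟨w, v, hv, rfl⟩
  exact (lbarFil C g).ι_smul_mem w k v (h hv)

theorem tauSum_mcoef_mem {P Q : Matrix (Fin 3) (Fin 3) R} (hP : P ∈ stfMat R) (hQ : Q ∈ stfMat R) :
    tauSum g hC hθ' (mcoef g θ (P, Q)) ∈ weylBar g hC hθ' :=
  ⟨_, ⟨(P, Q), ⟨hP, hQ⟩, rfl⟩, rfl⟩

theorem tauSum_mem {a : Fin 3 → Cl g} {k : ℤ} (h : ∀ b, a b ∈ clFil (negQuad g) k)
    (h' : ∀ b, a b * om g θ ∈ clFil (negQuad g) k) : tauSum g hC hθ' a ∈ (lbarFil C g).F k := by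
  rw [tauSum_apply]
  refine Submodule.sum_mem _ fun b _ => ?_
  rw [smul_tau]
  exact add_mem (tmul_mem_tensorRange (h b) _) (tmul_mem_tensorRange (neg_mem (h' b)) _)

theorem ee_mem (a : Fin 3) : ee g θ a ∈ clFil (negQuad g) 2 := by
  fin_cases a
  · exact mon_mem_clFil (g := g) (θ := θ) 3
  · exact mon_mem_clFil (g := g) (θ := θ) 5
  · exact mon_mem_clFil (g := g) (θ := θ) 9

theorem ff_mem (hθ : IsON g θ) (a : Fin 3) : ff g θ a ∈ clFil (negQuad g) 2 := by
  obtain ⟨h1, h2, h3, h4, h5, h6, h7⟩ := ee_ff_eq hθ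
  fin_cases a
  · exact mon_mem_clFil (g := g) (θ := θ) 12
  · change ff g θ 1 ∈ _
    rw [h5]
    exact neg_mem (mon_mem_clFil (g := g) (θ := θ) 10)
  · exact mon_mem_clFil (g := g) (θ := θ) 6

theorem ee_mul_om (hθ : IsON g θ) (a : Fin 3) : ee g θ a * om g θ = ff g θ a := by
  obtain ⟨h1, h2, h3, h4, h5, h6, h7⟩ := ee_ff_eq hθ
  fin_cases a <;> simp [h1, h2, h3, h4, h5, h6, h7] <;> simp [mon, mul_assoc, gen_rules hθ]

theorem ff_mul_om (hθ : IsON g θ) (a : Fin 3) : ff g θ a * om g θ = -ee g θ a := by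
  rw [← ee_mul_om hθ, mul_assoc, om_mul_om hθ, mul_neg, mul_one]

theorem weylBar_le (hθ : IsON g θ) : weylBar g hC hθ' ≤ (lbarFil C g).F 2 := by
  rintro _ ⟨_, ⟨⟨P, Q⟩, -, rfl⟩, rfl⟩
  refine tauSum_mem hC hθ' (fun b => ?_) (fun b => ?_)
  · rw [mcoef_apply]
    exact Submodule.sum_mem _ fun a _ => add_mem (Submodule.smul_mem _ _ (ee_mem a))
      (Submodule.smul_mem _ _ (ff_mem hθ a))
  · rw [mcoef_apply, Finset.sum_mul]
    refine Submodule.sum_mem _ fun a _ => ?_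
    rw [add_mul, smul_mul_assoc, smul_mul_assoc, ee_mul_om hθ, ff_mul_om hθ]
    exact add_mem (Submodule.smul_mem _ _ (ff_mem hθ a))
      (Submodule.smul_mem _ _ (neg_mem (ee_mem a)))

theorem tauSum_smul_gen_mem {p : Matrix (Fin 3) (Fin 3) R × Matrix (Fin 3) (Fin 3) R}
    (h1 : p.1 ∈ stfMat R) (h2 : p.2 ∈ stfMat R) (i : Fin 4) :
    tauSum g hC hθ' (gen g θ i • mcoef g θ p) ∈ vecMul (weylBar g hC hθ') := by
  rw [map_smul]
  exact gen_smul_mem_vecMul (tauSum_mcoef_mem hC hθ' h1 h2) i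

theorem tauSum_gen_zero_smul_kcoef_mem (hθ : IsON g θ) (c : Fin 3) :
    tauSum g hC hθ' (gen g θ 0 • kcoef g θ c) ∈ vecMul (weylBar g hC hθ') ∧
    tauSum g hC hθ' (gen g θ 0 • om g θ • kcoef g θ c) ∈ vecMul (weylBar g hC hθ') := by
  have hc1 : c + 2 ≠ c := by revert c; decide
  have hc2 : c + 1 ≠ c + 2 := by revert c; decide
  rw [gen_zero_smul_kcoef hθ, gen_zero_smul_om_smul_kcoef hθ, map_add, map_add]
  exact ⟨add_mem (tauSum_smul_gen_mem hC hθ' (symUnit_mem hc1) (zero_mem _) _)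
      (tauSum_smul_gen_mem hC hθ' (zero_mem _) (Submodule.smul_mem _ _ (symUnit_mem hc2)) _),
    add_mem (tauSum_smul_gen_mem hC hθ' (zero_mem _) (symUnit_mem hc1) _)
      (tauSum_smul_gen_mem hC hθ' (neg_mem (Submodule.smul_mem _ _ (symUnit_mem hc2)))
        (zero_mem _) _)⟩

theorem tauSum_gen_zero_smul_evenSol_mem (hθ : IsON g θ) (a : Fin 3 → Cl g) :
    tauSum g hC hθ' (gen g θ 0 • evenSol g θ hθ a) ∈ vecMul (weylBar g hC hθ') := by
  have hr : ∀ (r : R) (x : Fin 3 → Cl g), tauSum g hC hθ' (gen g θ 0 • r • x) =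
      r • tauSum g hC hθ' (gen g θ 0 • x) := by
    intro r x
    rw [smul_comm, ← algebraMap_smul (Cl g) r (gen g θ 0 • x), map_smul, algebraMap_smul]
  rw [evenSol_apply, smul_add, map_add, Finset.smul_sum, map_sum]
  refine add_mem (tauSum_smul_gen_mem hC hθ' (stfPart_mem _) (stfPart_mem _) 0)
    (Submodule.sum_mem _ fun c _ => ?_)
  rw [smul_add, map_add, hr, hr]
  exact add_mem (Submodule.smul_mem _ _ (tauSum_gen_zero_smul_kcoef_mem hC hθ' hθ c).1)
    (Submodule.smul_mem _ _ (tauSum_gen_zero_smul_kcoef_mem hC hθ' hθ c).2)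

theorem tauSum_evenSol_mem (hθ : IsON g θ) (a : Fin 3 → Cl g) :
    tauSum g hC hθ' (evenSol g θ hθ a) ∈ vecMul (vecMul (weylBar g hC hθ')) := by
  have h : evenSol g θ hθ a = gen g θ 0 • gen g θ 0 • evenSol g θ hθ a := by
    rw [← mul_smul, (gen_rules hθ).1, one_smul]
  rw [h, map_smul]
  exact gen_smul_mem_vecMul (tauSum_gen_zero_smul_evenSol_mem hC hθ' hθ a) 0

theorem evenSol_of_coord (hθ : IsON g θ) {a : Fin 3 → Cl g}
    (h : ∀ b, (monBasis g θ hθ).repr (a b) 0 = 0) (h' : ∀ b, (monBasis g θ hθ).repr (a b) 15 = 0) :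
    evenSol g θ hθ a = mcoef g θ (stfPart (matE g θ hθ a), stfPart (matF g θ hθ a)) := by
  rw [evenSol_apply]
  simp [h, h']

theorem mul_om_mon (hθ : IsON g θ) (i : Fin 16) : mon g θ i * om g θ = mon g θ i.rev ∨
    mon g θ i * om g θ = -mon g θ i.rev := by
  fin_cases i <;> simp [mon, om, mul_assoc, gen_rules hθ, Fin.rev]

theorem repr_mul_om (hθ : IsON g θ) {a : Cl g} {i : Fin 16}
    (h : (monBasis g θ hθ).repr a i.rev = 0) : (monBasis g θ hθ).repr (a * om g θ) i = 0 := by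
  conv_lhs => rw [← sum_mon_repr hθ a, Finset.sum_mul]
  rw [map_sum, Finsupp.finsetSum_apply]
  refine Finset.sum_eq_zero fun j _ => ?_
  rw [smul_mul_assoc, map_smul, Finsupp.smul_apply, smul_eq_mul]
  by_cases hj : j = i.rev
  · rw [hj, h, zero_mul]
  · have hj' : j.rev ≠ i := fun e => hj (by rw [← e, Fin.rev_rev])
    rcases mul_om_mon hθ j with e | e <;> rw [e, ← monBasis_apply hθ] <;>
      simp [hj']

variable (C g θ) in
/-- A linear left inverse of `tauSum`. The boost coordinates of `∑ a_b τ_b` are `a_b` and its rotation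
coordinates are `-a_b ω`, and multiplication by `ω` exchanges degrees `i` and `4 - i`. The
components of `a_b` of degree at least two are read off from the boost coordinates, the others from
the rotation coordinates; this is what makes `projI` compatible with the filtrations. -/
def hat (hθ : IsON g θ) : Lbar C g →ₗ[R] (Fin 3 → Cl g) where
  toFun x b := ∑ i, (if 2 ≤ monDeg i then (monBasis g θ hθ).repr (cBoost C g θ b x) i else
    (monBasis g θ hθ).repr (cRot C g θ b x * om g θ) i) • mon g θ i
  map_add' x y := by
    ext b
    rw [Pi.add_apply, ← Finset.sum_add_distrib]
    refine Finset.sum_congr rfl fun i _ => ?_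
    rw [← add_smul]
    split_ifs
    · rw [map_add, map_add, Finsupp.add_apply]
    · rw [map_add, add_mul, map_add, Finsupp.add_apply]
  map_smul' r x := by
    ext b
    rw [Pi.smul_apply, Finset.smul_sum, RingHom.id_apply]
    refine Finset.sum_congr rfl fun i _ => ?_
    rw [smul_smul]
    have h1 : ∀ φ : Lbar C g →ₗ[Cl g] Cl g, φ (r • x) = r • φ x := fun φ => by
      rw [← algebraMap_smul (Cl g) r x, map_smul, algebraMap_smul]
    split_ifs
    · rw [h1, map_smul, Finsupp.smul_apply, smul_eq_mul]
    · rw [h1, smul_mul_assoc, map_smul, Finsupp.smul_apply, smul_eq_mul]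

theorem repr_hat (hθ : IsON g θ) (x : Lbar C g) (b : Fin 3) (i : Fin 16) :
    (monBasis g θ hθ).repr (hat C g θ hθ x b) i =
      if 2 ≤ monDeg i then (monBasis g θ hθ).repr (cBoost C g θ b x) i else
        (monBasis g θ hθ).repr (cRot C g θ b x * om g θ) i :=
  repr_sum_mon hθ _ i

theorem hat_tauSum (hθ : IsON g θ) (a : Fin 3 → Cl g) :
    hat C g θ hθ (tauSum g hC hθ' a) = a := by
  ext b
  refine (monBasis g θ hθ).ext_elem fun i => ?_
  rw [repr_hat, cBoost_tauSum, cRot_tauSum, neg_mul, mul_assoc, om_mul_om hθ, mul_neg, neg_neg,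
    mul_one, ite_self]

theorem repr_hat_eq_zero (hθ : IsON g θ) {k : ℕ} {x : Lbar C g} (hx : x ∈ (lbarFil C g).F k)
    (b : Fin 3) {i : Fin 16} (h : 2 ≤ monDeg i → k < monDeg i) (h' : monDeg i < 2 → k + monDeg i < 4) :
    (monBasis g θ hθ).repr (hat C g θ hθ x b) i = 0 := by
  rw [repr_hat]
  split_ifs with hi
  · exact (mem_clFil_iff hθ k _).1 (cBoost_mem b hx) i (h hi)
  · refine repr_mul_om hθ ((mem_clFil_iff hθ k _).1 (cRot_mem b hx) i.rev ?_)
    have h1 : ∀ i : Fin 16, monDeg i.rev + monDeg i = 4 := by decide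
    have := h1 i
    have := h' (not_le.1 hi)
    omega

variable (g) in
/-- A linear projection of `L̄` onto the kernel of `f` that respects the filtrations. -/
def projI (hθ : IsON g θ) : Lbar C g →ₗ[R] Lbar C g :=
  ((tauSum g hC hθ').restrictScalars R) ∘ₗ (evenSol g θ hθ + Algebra.lsmul R R _ (gen g θ 0) ∘ₗ
    evenSol g θ hθ ∘ₗ Algebra.lsmul R R _ (gen g θ 0)) ∘ₗ hat C g θ hθ

theorem projI_apply (hθ : IsON g θ) (x : Lbar C g) : projI g hC hθ' hθ x =
    tauSum g hC hθ' (evenSol g θ hθ (hat C g θ hθ x)) +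
      tauSum g hC hθ' (gen g θ 0 • evenSol g θ hθ (gen g θ 0 • hat C g θ hθ x)) :=
  map_add (tauSum g hC hθ') _ _

theorem projI_mem (hg : g ∈ C) (hθ : IsON g θ) (x : Lbar C g) : projI g hC hθ' hθ x ∈ Ibar C g := by
  rw [projI_apply]
  exact add_mem (tauSum_mem_Ibar hC hθ' hg hθ (evenSol_mem_sol hθ _))
    (tauSum_mem_Ibar hC hθ' hg hθ (Submodule.smul_mem _ _ (evenSol_mem_sol hθ _)))

theorem projI_of_mem (hg : g ∈ C) (hθ : IsON g θ) {x : Lbar C g} (hx : x ∈ Ibar C g) :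
    projI g hC hθ' hθ x = x := by
  obtain ⟨h1, h2⟩ := eq_tauSum_of_mem_Ibar hC hθ' hg hθ hx
  rw [h1, projI_apply, hat_tauSum, ← map_add, ← sol_decomposition hθ h2]

/-- In filtration degree two, only the components of degree two of the coefficients survive. -/
theorem projI_mem_weylBar (hθ : IsON g θ) {x : Lbar C g} (hx : x ∈ (lbarFil C g).F 2) :
    projI g hC hθ' hθ x ∈ weylBar g hC hθ' := by
  have h : ∀ b i, monDeg i ≠ 2 → (monBasis g θ hθ).repr (hat C g θ hθ x b) i = 0 := by
    intro b i hi
    exact repr_hat_eq_zero hθ (k := 2) hx b (by omega) (by omega)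
  have h2 : evenSol g θ hθ (gen g θ 0 • hat C g θ hθ x) = 0 := by
    have z : ∀ b i, (i = 3 ∨ i = 5 ∨ i = 6 ∨ i = 9 ∨ i = 10 ∨ i = 12 ∨ i = 0 ∨ i = 15) →
        (monBasis g θ hθ).repr ((gen g θ 0 • hat C g θ hθ x) b) i = 0 := by
      intro b i hi
      rw [Pi.smul_apply, smul_eq_mul, repr_gen_zero_mul]
      apply h
      rcases hi with rfl | rfl | rfl | rfl | rfl | rfl | rfl | rfl <;> decide
    have e1 : matE g θ hθ (gen g θ 0 • hat C g θ hθ x) = 0 := by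
      ext i j
      fin_cases i <;> exact z _ _ (by simp)
    have e2 : matF g θ hθ (gen g θ 0 • hat C g θ hθ x) = 0 := by
      ext i j
      fin_cases i
      · exact z _ _ (by simp)
      · exact neg_eq_zero.2 (z _ _ (by simp))
      · exact z _ _ (by simp)
    rw [evenSol_of_coord hθ (fun b => z b 0 (by simp)) (fun b => z b 15 (by simp)), e1, e2,
      map_zero, ← Prod.zero_eq_mk, map_zero]
  rw [projI_apply, h2, smul_zero, map_zero, add_zero,
    evenSol_of_coord hθ (fun b => h b 0 (by decide)) (fun b => h b 15 (by decide))]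
  exact tauSum_mcoef_mem hC hθ' (stfPart_mem _) (stfPart_mem _)

theorem projI_mem_of_three (hθ : IsON g θ) {x : Lbar C g} (hx : x ∈ (lbarFil C g).F 3) :
    projI g hC hθ' hθ x ∈ weylBar g hC hθ' ⊔ vecMul (weylBar g hC hθ') := by
  rw [projI_apply, evenSol_of_coord hθ
    (fun b => repr_hat_eq_zero hθ (k := 3) hx b (by decide) (by decide))
    (fun b => repr_hat_eq_zero hθ (k := 3) hx b (by decide) (by decide))]
  exact Submodule.add_mem_sup (tauSum_mcoef_mem hC hθ' (stfPart_mem _) (stfPart_mem _))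
    (tauSum_gen_zero_smul_evenSol_mem hC hθ' hθ _)

theorem projI_mem_sup (hθ : IsON g θ) (x : Lbar C g) : projI g hC hθ' hθ x ∈
    vecMul (weylBar g hC hθ') ⊔ vecMul (vecMul (weylBar g hC hθ')) := by
  rw [projI_apply, add_comm]
  exact Submodule.add_mem_sup (tauSum_gen_zero_smul_evenSol_mem hC hθ' hθ _)
    (tauSum_evenSol_mem hC hθ' hθ _)

theorem projI_eq_zero (hθ : IsON g θ) {x : Lbar C g} (hx : x ∈ (lbarFil C g).F 1) :
    projI g hC hθ' hθ x = 0 := by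
  have h : hat C g θ hθ x = 0 := by
    ext b
    refine (monBasis g θ hθ).ext_elem fun i => ?_
    rw [repr_hat_eq_zero hθ (k := 1) hx b (by omega) (by omega)]
    simp
  rw [projI_apply, h, smul_zero, map_zero, smul_zero, map_zero, add_zero]

/-- The projection onto the kernel of `f` respects the filtrations. -/
theorem projI_mem_F (hθ : IsON g θ) {k : ℤ} {x : Lbar C g} (hx : x ∈ (lbarFil C g).F k) :
    projI g hC hθ' hθ x ∈ (lbarFil C g).F k := by
  have mono := (lbarFil C g).mono
  have l2 := weylBar_le (g := g) hC hθ' hθ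
  have l3 : vecMul (weylBar g hC hθ') ≤ (lbarFil C g).F 3 :=
    (vecMul_le l2).trans (mono (by norm_num))
  have l4 : vecMul (vecMul (weylBar g hC hθ')) ≤ (lbarFil C g).F 4 :=
    (vecMul_le l3).trans (mono (by norm_num))
  rcases le_or_gt k 1 with h | h
  · rw [projI_eq_zero hC hθ' hθ (mono h hx)]
    exact zero_mem _
  rcases eq_or_ne k 2 with rfl | h2
  · exact l2 (projI_mem_weylBar hC hθ' hθ hx)
  rcases eq_or_ne k 3 with rfl | h3
  · exact sup_le (l2.trans (mono (by norm_num : (2 : ℤ) ≤ 3))) l3 (projI_mem_of_three hC hθ' hθ hx)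
  · exact mono (by omega : (4 : ℤ) ≤ k) (sup_le (l3.trans (mono (by norm_num : (3 : ℤ) ≤ 4))) l4
      (projI_mem_sup hC hθ' hθ x))

end FilteredProjection

/-! ### The ideal `I` -/

section Ideal

variable {R W : Type*} [CommRing R] [Algebra ℝ R] [AddCommGroup W] [Module R W]
  [Module ℝ W] [IsScalarTower ℝ R W] {C : Set (LinearMap.BilinForm R W)}
  {g : LinearMap.BilinForm R W} {θ : Module.Basis (Fin 4) R W}

attribute [local instance] lmodAddCommMonoid lmodAddMonoid lmodSubNegMonoid lmodUnitsSMul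

/-- The left inverse is induced by the filtered projection `projI`. -/
theorem exists_graded_leftInverse (hC : ∀ g ∈ C, ∀ g' ∈ C, ∃ u : R, g' = u • g)
    (hg : g ∈ C) (hθ : IsON g θ) :
    ∃ r : (lbarFil C g).Gr →ₗ[R] ((lbarFil C g).sub (Ibar C g)).Gr,
      (∀ x, r (grIbar C g x) = x) ∧
      (∀ k : ℤ, ∀ x ∈ (lbarFil C g).grPiece k,
        r x ∈ ((lbarFil C g).sub (Ibar C g)).grPiece k) := by
  have hθ' : IsConfOrthonormal C θ := ⟨g, hg, hθ⟩
  let p : Lbar C g →ₗ[R] Ibar C g :=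
    { toFun := fun x => ⟨projI g hC hθ' hθ x, projI_mem hC hθ' hg hθ x⟩
      map_add' := fun x y => Subtype.ext (map_add _ x y)
      map_smul' := fun r x => Subtype.ext (map_smul _ r x) }
  have hp : ∀ k, ∀ x ∈ (lbarFil C g).F k, p x ∈ ((lbarFil C g).sub (Ibar C g)).F k :=
    fun k x hx => projI_mem_F hC hθ' hθ hx
  let r := ClFiltration.grLift (Φ := lbarFil C g)
    (fun k => ((lbarFil C g).sub (Ibar C g)).symb k ∘ₗ p.restrict (hp k))
    (fun k x hx => ((lbarFil C g).sub (Ibar C g)).symb_eq_zero k _ (hp _ _ hx))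
  have hr : ∀ k x, r ((lbarFil C g).symb k x) =
      ((lbarFil C g).sub (Ibar C g)).symb k ⟨p x, hp k x x.2⟩ :=
    fun k x => ClFiltration.grLift_symb _ _ k x
  refine ⟨r, fun x => ?_, ?_⟩
  · induction x using ClFiltration.gr_induction with
    | zero => rw [map_zero, map_zero]
    | symb k x =>
      rw [grIbar, ClFiltration.grIncl_symb, hr]
      congr 1
      exact Subtype.ext (Subtype.ext (projI_of_mem hC hθ' hg hθ x.1.2))
    | add x y h1 h2 => rw [map_add, map_add, h1, h2]
  · rintro k _ ⟨x, rfl⟩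
    rw [hr]
    exact ⟨_, rfl⟩

/-- Homogeneous elements of `I` are symbols of elements of the kernel of `f`. -/
theorem exists_of_mem_iGr {k : ℤ} {x : Lmod C} (hx : x ∈ iGr C g k) :
    ∃ (y : Lbar C g) (hy : y ∈ (lbarFil C g).F k), y ∈ Ibar C g ∧
      canon C g x = (lbarFil C g).symb k ⟨y, hy⟩ := by
  obtain ⟨y, hy, hyI, e⟩ := (lbarFil C g).exists_of_mem_range_grIncl (Ibar C g) (k := k) hx.1
  refine ⟨y, hy, hyI, ?_⟩
  rw [← e, (lbarFil C g).grComp_of_mem (canon_mem_grPiece C g hx.2)]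

theorem iGr_eq_bot (hC : ∀ g ∈ C, ∀ g' ∈ C, ∃ u : R, g' = u • g) (hg : g ∈ C)
    (hθ : IsON g θ) {k : ℤ} (hk : k ≤ 1) : iGr C g k = ⊥ := by
  have hθ' : IsConfOrthonormal C θ := ⟨g, hg, hθ⟩
  rw [eq_bot_iff]
  intro x hx
  obtain ⟨y, hy, hyI, e⟩ := exists_of_mem_iGr hx
  have h0 : y = 0 := by
    rw [← projI_of_mem hC hθ' hg hθ hyI, projI_eq_zero hC hθ' hθ ((lbarFil C g).mono hk hy)]
  rw [(lbarFil C g).symb_eq_zero _ _ (by change y ∈ _; rw [h0]; exact zero_mem _)] at e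
  exact (canon_bijective C g).1 (e.trans (map_zero _).symm)

variable (hC : ∀ g ∈ C, ∀ g' ∈ C, ∃ u : R, g' = u • g) (hθ' : IsConfOrthonormal C θ)

/-- The real part of `(θ₀θ_a + i θ_{a+1}θ_{a+2}) ⊗ (σ_b + i ρ_b)`. -/
def weylRe (a b : Fin 3) : Lmod C :=
  thetaRe θ a ⊗ₜ[R] sigmaBoost hC θ hθ' b + (-thetaIm θ a) ⊗ₜ[R] sigmaRot hC θ hθ' b

/-- The imaginary part of `(θ₀θ_a + i θ_{a+1}θ_{a+2}) ⊗ (σ_b + i ρ_b)`. -/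
def weylIm (a b : Fin 3) : Lmod C :=
  thetaIm θ a ⊗ₜ[R] sigmaBoost hC θ hθ' b + thetaRe θ a ⊗ₜ[R] sigmaRot hC θ hθ' b

/-- The element `∑ (P_ab Re + Q_ab Im) (θ₀θ_a + i θ_{a+1}θ_{a+2}) ⊗ (σ_b + i ρ_b)` of `L`. -/
def weylMap : (Matrix (Fin 3) (Fin 3) R × Matrix (Fin 3) (Fin 3) R) →ₗ[R] Lmod C where
  toFun p := ∑ a, ∑ b, (p.1 a b • weylRe hC hθ' a b + p.2 a b • weylIm hC hθ' a b)
  map_add' p q := by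
    simp only [Prod.fst_add, Prod.snd_add, Matrix.add_apply, ← Finset.sum_add_distrib]
    refine Finset.sum_congr rfl fun a _ => Finset.sum_congr rfl fun b _ => ?_
    module
  map_smul' r p := by
    simp only [Prod.smul_fst, Prod.smul_snd, Matrix.smul_apply, Finset.smul_sum, RingHom.id_apply,
      smul_eq_mul]
    refine Finset.sum_congr rfl fun a _ => Finset.sum_congr rfl fun b _ => ?_
    module

theorem weylMap_apply (p : Matrix (Fin 3) (Fin 3) R × Matrix (Fin 3) (Fin 3) R) :
    weylMap hC hθ' p = ∑ a, ∑ b, (p.1 a b • weylRe hC hθ' a b + p.2 a b • weylIm hC hθ' a b) := rfl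

theorem thetaRe_mem (a : Fin 3) : thetaRe θ a ∈ extGr R W 2 :=
  extGr_ι_mul_mem _ (ι_mem_extGr _)

theorem thetaIm_mem (a : Fin 3) : thetaIm θ a ∈ extGr R W 2 :=
  extGr_ι_mul_mem _ (ι_mem_extGr _)

theorem weylRe_mem (a b : Fin 3) : weylRe hC hθ' a b ∈ lGr C 2 :=
  add_mem (tmul_mem_tensorRange (thetaRe_mem a) _)
    (tmul_mem_tensorRange (neg_mem (thetaIm_mem a)) _)

theorem weylIm_mem (a b : Fin 3) : weylIm hC hθ' a b ∈ lGr C 2 :=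
  add_mem (tmul_mem_tensorRange (thetaIm_mem a) _) (tmul_mem_tensorRange (thetaRe_mem a) _)

theorem weylMap_mem (p : Matrix (Fin 3) (Fin 3) R × Matrix (Fin 3) (Fin 3) R) :
    weylMap hC hθ' p ∈ lGr C 2 := by
  rw [weylMap_apply]
  exact Submodule.sum_mem _ fun a _ => Submodule.sum_mem _ fun b _ =>
    add_mem (Submodule.smul_mem _ _ (weylRe_mem hC hθ' a b))
      (Submodule.smul_mem _ _ (weylIm_mem hC hθ' a b))

variable (g) in
theorem quant_thetaRe_sub_mem (a : Fin 3) :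
    ee g θ a - quant g (thetaRe θ a) ∈ clFil (negQuad g) 1 := by
  have h := quant_ι_mul_sub_mem g (θ 0) (extGr_le_clFil 1 (ι_mem_extGr (R := R) (θ a.succ)))
  rwa [quant_ι] at h

variable (g) in
theorem quant_thetaIm_sub_mem (a : Fin 3) :
    ff g θ a - quant g (thetaIm θ a) ∈ clFil (negQuad g) 1 := by
  have h := quant_ι_mul_sub_mem g (θ (a + 1).succ)
    (extGr_le_clFil 1 (ι_mem_extGr (R := R) (θ (a + 2).succ)))
  rwa [quant_ι] at h

theorem canon_tmul_of_sub_mem {k : ℤ} {a : ExteriorAlgebra R W} (ha : a ∈ extGr R W k)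
    {a' : Cl g} (ha' : a' ∈ clFil (negQuad g) k)
    (h : a' - quant g a ∈ clFil (negQuad g) (k - 1)) (δ : CDerEnd C) :
    canon C g (a ⊗ₜ[R] δ) = (lbarFil C g).symb k ⟨a' ⊗ₜ[R] δ, tmul_mem_tensorRange ha' δ⟩ := by
  rw [canon_tmul C g ha]
  refine ((lbarFil C g).symb_congr ?_).symm
  rw [← TensorProduct.sub_tmul]
  exact tmul_mem_tensorRange h δ

theorem smul_tau_mem {a : Cl g} {k : ℤ} (h : a ∈ clFil (negQuad g) k)
    (h' : a * om g θ ∈ clFil (negQuad g) k) (b : Fin 3) :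
    a • tau g hC hθ' b ∈ (lbarFil C g).F k := by
  rw [smul_tau]
  exact add_mem (tmul_mem_tensorRange h _) (tmul_mem_tensorRange (neg_mem h') _)

theorem canon_weylRe (hθ : IsON g θ) (a b : Fin 3) : canon C g (weylRe hC hθ' a b) =
    (lbarFil C g).symb 2 ⟨ee g θ a • tau g hC hθ' b, smul_tau_mem hC hθ' (ee_mem a)
      (by rw [ee_mul_om hθ]; exact ff_mem hθ a) b⟩ := by
  have h : -ff g θ a - quant g (-thetaIm θ a) ∈ clFil (negQuad g) 1 := by
    rw [map_neg, neg_sub_neg, ← neg_sub]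
    exact neg_mem (quant_thetaIm_sub_mem g a)
  rw [weylRe, map_add, canon_tmul_of_sub_mem (thetaRe_mem a) (ee_mem a) (quant_thetaRe_sub_mem g a),
    canon_tmul_of_sub_mem (neg_mem (thetaIm_mem a)) (neg_mem (ff_mem hθ a)) h, ← map_add]
  congr 1
  refine Subtype.ext ?_
  change _ + _ = ee g θ a • tau g hC hθ' b
  rw [smul_tau, ee_mul_om hθ]

theorem canon_weylIm (hθ : IsON g θ) (a b : Fin 3) : canon C g (weylIm hC hθ' a b) =
    (lbarFil C g).symb 2 ⟨ff g θ a • tau g hC hθ' b, smul_tau_mem hC hθ' (ff_mem hθ a)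
      (by rw [ff_mul_om hθ]; exact neg_mem (ee_mem a)) b⟩ := by
  rw [weylIm, map_add, canon_tmul_of_sub_mem (thetaRe_mem a) (ee_mem a) (quant_thetaRe_sub_mem g a),
    canon_tmul_of_sub_mem (thetaIm_mem a) (ff_mem hθ a) (quant_thetaIm_sub_mem g a), ← map_add]
  congr 1
  refine Subtype.ext ?_
  change _ + _ = ff g θ a • tau g hC hθ' b
  rw [smul_tau, ff_mul_om hθ, neg_neg]

theorem tauSum_mcoef_eq (p : Matrix (Fin 3) (Fin 3) R × Matrix (Fin 3) (Fin 3) R) :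
    tauSum g hC hθ' (mcoef g θ p) = ∑ a, ∑ b, (p.1 a b • ee g θ a • tau g hC hθ' b +
      p.2 a b • ff g θ a • tau g hC hθ' b) := by
  rw [tauSum_apply, Finset.sum_comm]
  refine Finset.sum_congr rfl fun b _ => ?_
  rw [mcoef_apply, Finset.sum_smul]
  refine Finset.sum_congr rfl fun a _ => ?_
  rw [add_smul, smul_assoc, smul_assoc]

theorem tauSum_mcoef_mem_F (hθ : IsON g θ)
    (p : Matrix (Fin 3) (Fin 3) R × Matrix (Fin 3) (Fin 3) R) :
    tauSum g hC hθ' (mcoef g θ p) ∈ (lbarFil C g).F 2 := by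
  rw [tauSum_mcoef_eq]
  refine Submodule.sum_mem _ fun a _ => Submodule.sum_mem _ fun b _ =>
    add_mem (Submodule.smul_mem _ _ (smul_tau_mem hC hθ' (ee_mem a) ?_ b))
      (Submodule.smul_mem _ _ (smul_tau_mem hC hθ' (ff_mem hθ a) ?_ b))
  · rw [ee_mul_om hθ]; exact ff_mem hθ a
  · rw [ff_mul_om hθ]; exact neg_mem (ee_mem a)

theorem canon_smul_R (r : R) (x : Lmod C) : canon C g (r • x) = r • canon C g x :=
  map_smul ((canon C g).restrictScalars R) r x

/-- Under `L ≃ Gr L̄`, the elements `m(S)` are the symbols of the elements of the kernel of `f` of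
filtration degree two. -/
theorem canon_weylMap (hθ : IsON g θ) (p : Matrix (Fin 3) (Fin 3) R × Matrix (Fin 3) (Fin 3) R) :
    canon C g (weylMap hC hθ' p) =
      (lbarFil C g).symb 2 ⟨tauSum g hC hθ' (mcoef g θ p), tauSum_mcoef_mem_F hC hθ' hθ p⟩ := by
  rw [weylMap_apply]
  simp only [map_sum, map_add, canon_smul_R, canon_weylRe hC hθ' hθ, canon_weylIm hC hθ' hθ,
    ← map_smul]
  simp only [← map_add, ← map_sum]
  congr 1
  refine Subtype.ext ?_
  refine Eq.trans ?_ (tauSum_mcoef_eq hC hθ' p).symm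
  simp only [AddSubmonoidClass.coe_finsetSum]
  rfl

/-- The real parts of `∑ (θ₀θ_a + i θ_{a+1}θ_{a+2}) S_ab ⊗ (σ_b + i ρ_b)` for symmetric
traceless `S` with coefficients in `R ⊗ ℂ`. -/
def weylSub : Submodule R (Lmod C) := ((stfMat R).prod (stfMat R)).map (weylMap hC hθ')

theorem weylSub_le_iGr (hg : g ∈ C) (hθ : IsON g θ) : weylSub hC hθ' ≤ iGr C g 2 := by
  rintro _ ⟨⟨P, Q⟩, ⟨hP, hQ⟩, rfl⟩
  refine ⟨?_, weylMap_mem hC hθ' _⟩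
  change canon C g _ ∈ LinearMap.range (grIbar C g)
  rw [canon_weylMap hC hθ' hθ]
  exact (lbarFil C g).symb_mem_range_grIncl _ _
    (tauSum_mem_Ibar hC hθ' hg hθ (mcoef_mem_sol hθ hP hQ))

theorem exists_weylSub (hθ : IsON g θ) {y : Lbar C g} (hy : y ∈ weylBar g hC hθ') :
    ∃ m ∈ weylSub hC hθ', canon C g m = (lbarFil C g).symb 2 ⟨y, weylBar_le hC hθ' hθ hy⟩ := by
  obtain ⟨_, ⟨p, hp, rfl⟩, rfl⟩ := hy
  exact ⟨weylMap hC hθ' p, ⟨p, hp, rfl⟩, canon_weylMap hC hθ' hθ p⟩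

theorem iGr_two (hg : g ∈ C) (hθ : IsON g θ) : iGr C g 2 = weylSub hC hθ' := by
  refine le_antisymm (fun x hx => ?_) (weylSub_le_iGr hC hθ' hg hθ)
  obtain ⟨y, hy, hyI, e⟩ := exists_of_mem_iGr hx
  have h := projI_mem_weylBar hC hθ' hθ hy
  rw [projI_of_mem hC hθ' hg hθ hyI] at h
  obtain ⟨m, hm, em⟩ := exists_weylSub hC hθ' hθ h
  rwa [(canon_bijective C g).1 (e.trans em.symm)]

theorem symb_vecMul_mem {S : Submodule (ExteriorAlgebra R W) (lbarFil C g).Gr}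
    {V : Submodule R (Lbar C g)} {k : ℤ} (hV : V ≤ (lbarFil C g).F k)
    (h : ∀ v (hv : v ∈ V), (lbarFil C g).symb k ⟨v, hV hv⟩ ∈ S) (v : Lbar C g)
    (hv : v ∈ vecMul V) : (lbarFil C g).symb (k + 1) ⟨v, vecMul_le hV hv⟩ ∈ S := by
  induction hv using Submodule.span_induction with
  | mem x hx =>
    obtain ⟨w, v, hv, rfl⟩ := hx
    have := S.smul_mem (ExteriorAlgebra.ι R w) (h v hv)
    rwa [ClFiltration.ι_smul_symb] at this
  | zero =>
    rw [ClFiltration.symb_eq_zero _ _ _ (zero_mem _)]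
    exact zero_mem _
  | add x y hx hy h1 h2 =>
    have := add_mem h1 h2
    rwa [← map_add] at this
  | smul r x hx h1 =>
    have := (S.restrictScalars R).smul_mem r h1
    rwa [← map_smul] at this

/-- The ideal is generated in degree two: the kernel of `f` is contained in
`V + Cl¹ V + Cl¹ Cl¹ V` for `V = weylBar`, compatibly with the filtrations. -/
theorem idealI_eq_span (hg : g ∈ C) (hθ : IsON g θ) : idealI C g =
    Submodule.span (ExteriorAlgebra R W) (weylSub hC hθ' : Set (Lmod C)) := by
  apply le_antisymm
  swap
  · refine Submodule.span_le.2 fun x hx => ?_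
    exact (weylSub_le_iGr hC hθ' hg hθ hx).1
  set S := (Submodule.span (ExteriorAlgebra R W) (weylSub hC hθ' : Set (Lmod C))).map (canon C g)
    with hS
  have l2 := weylBar_le (g := g) hC hθ' hθ
  have l3 := vecMul_le l2
  have s2 : ∀ v (hv : v ∈ weylBar g hC hθ'), (lbarFil C g).symb 2 ⟨v, l2 hv⟩ ∈ S := by
    intro v hv
    obtain ⟨m, hm, em⟩ := exists_weylSub hC hθ' hθ hv
    exact ⟨m, Submodule.subset_span hm, em⟩
  have s3 := symb_vecMul_mem l2 s2
  have s4 := symb_vecMul_mem l3 s3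
  have key : ∀ k y (hy : y ∈ (lbarFil C g).F k), y ∈ Ibar C g →
      (lbarFil C g).symb k ⟨y, hy⟩ ∈ S := by
    intro k y hy hyI
    have e := projI_of_mem hC hθ' hg hθ hyI
    rcases le_or_gt k 1 with h | h
    · rw [ClFiltration.symb_eq_zero]
      · exact zero_mem _
      · change y ∈ _
        rw [← e, projI_eq_zero hC hθ' hθ ((lbarFil C g).mono h hy)]
        exact zero_mem _
    rcases eq_or_ne k 2 with rfl | h2
    · exact s2 y (e ▸ projI_mem_weylBar hC hθ' hθ hy)
    rcases eq_or_ne k (2 + 1) with rfl | h3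
    · obtain ⟨y2, hy2, y3, hy3, e'⟩ := Submodule.mem_sup.1 (projI_mem_of_three hC hθ' hθ hy)
      rw [e] at e'
      rw [ClFiltration.symb_congr (y := ⟨y3, vecMul_le l2 hy3⟩)]
      · exact s3 y3 hy3
      · change y - y3 ∈ _
        rw [show y - y3 = y2 by rw [← e', add_sub_cancel_right]]
        exact l2 hy2
    obtain ⟨y3, hy3, y4, hy4, e'⟩ := Submodule.mem_sup.1 (projI_mem_sup hC hθ' hθ y)
    rw [e] at e'
    rcases eq_or_ne k (2 + 1 + 1) with rfl | h4
    · rw [ClFiltration.symb_congr (y := ⟨y4, vecMul_le l3 hy4⟩)]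
      · exact s4 y4 hy4
      · change y - y4 ∈ _
        rw [show y - y4 = y3 by rw [← e', add_sub_cancel_right]]
        exact l3 hy3
    · rw [ClFiltration.symb_eq_zero]
      · exact zero_mem _
      · change y ∈ _
        rw [← e']
        exact add_mem ((lbarFil C g).mono (by omega) (l3 hy3))
          ((lbarFil C g).mono (by omega) (vecMul_le l3 hy4))
  intro x hx
  have h : canon C g x ∈ S := by
    refine (lbarFil C g).mem_of_grComp_mem (S := S.restrictScalars R) fun k => ?_
    obtain ⟨y, hy, hyI, e⟩ := (lbarFil C g).exists_of_mem_range_grIncl (Ibar C g) (k := k) hx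
    rw [e]
    exact key k y hy hyI
  obtain ⟨x', hx', e⟩ := h
  rwa [← (canon_bijective C g).1 e]

end Ideal

section IdealBracket

variable {R W : Type*} [CommRing R] [Algebra ℝ R] [AddCommGroup W] [Module R W]
  [Module ℝ W] [IsScalarTower ℝ R W] {C : Set (LinearMap.BilinForm R W)}
  {g : LinearMap.BilinForm R W} {θ : Module.Basis (Fin 4) R W}

attribute [local instance] lmodAddCommMonoid lmodAddMonoid lmodSubNegMonoid lmodUnitsSMul

variable (hC : ∀ g ∈ C, ∀ g' ∈ C, ∃ u : R, g' = u • g) (hθ' : IsConfOrthonormal C θ)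

variable (C) in
/-- The evaluation of the anchor at an element of `⋀ W`. -/
def anchorAt (b : ExteriorAlgebra R W) : Lmod C →ₗ[ExteriorAlgebra R W] ExteriorAlgebra R W where
  toFun x := anchor C x b
  map_add' x y := by rw [map_add]; rfl
  map_smul' a x := by rw [map_smul]; rfl

theorem anchorAt_tmul (a : ExteriorAlgebra R W) (δ : CDerEnd C) (b : ExteriorAlgebra R W) :
    anchorAt C b (a ⊗ₜ[R] δ) = a * lam C δ b := rfl

theorem anchorAt_smul (b : ExteriorAlgebra R W) (r : R) (x : Lmod C) :
    anchorAt C b (r • x) = r • anchorAt C b x :=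
  map_smul ((anchorAt C b).restrictScalars R) r x

theorem anchorAt_weylMap_basis {P Q : Matrix (Fin 3) (Fin 3) R} (hP : P ∈ stfMat R)
    (hQ : Q ∈ stfMat R) (j : Fin 4) :
    anchorAt C (ExteriorAlgebra.ι R (θ j)) (weylMap hC hθ' (P, Q)) = 0 := by
  obtain ⟨p1, p2, p3, p4⟩ := mem_stfMat_iff.1 hP
  obtain ⟨q1, q2, q3, q4⟩ := mem_stfMat_iff.1 hQ
  obtain ⟨s1, s2, s3⟩ := fin3_succ
  obtain ⟨r1, r2, r3, r4⟩ := ext_rules (R := R) θ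
  have t := boost_rot_table θ
  have a1 : (0 : Fin 3) + 1 = 1 := rfl
  have a2 : (0 : Fin 3) + 2 = 2 := rfl
  have a3 : (1 : Fin 3) + 1 = 2 := rfl
  have a4 : (1 : Fin 3) + 2 = 0 := rfl
  have a5 : (2 : Fin 3) + 1 = 0 := rfl
  have a6 : (2 : Fin 3) + 2 = 1 := rfl
  simp only [weylMap_apply, Fin.sum_univ_three, weylRe, weylIm, map_add, anchorAt_smul,
    anchorAt_tmul, lam_ι, sigmaBoost_apply, sigmaRot_apply, thetaRe, thetaIm, p1, p2, p3, p4,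
    q1, q2, q3, q4, s1, s2, s3, a1, a2, a3, a4, a5, a6]
  fin_cases j <;>
  · simp only [Fin.zero_eta, Fin.mk_one, Fin.reduceFinMk, Fin.isValue, t, boost_zero, rot_zero,
      map_zero, map_neg, mul_zero, mul_neg, neg_mul, neg_neg, add_zero, zero_add, neg_zero, smul_zero,
      mul_assoc, r3 1 0, r3 2 0, r3 3 0, r3 2 1, r3 3 1, r3 3 2, r1, r2, r4 1 0, r4 2 0,
      r4 2 1, s1, s2, s3]
    module

variable (C) in
/-- An element of even degree of `L` acts on `⋀ W` through the anchor as a derivation. -/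
theorem anchorAt_mul {x : Lmod C} (hx : x ∈ lGr C 2) {j : ℤ} {a : ExteriorAlgebra R W}
    (ha : a ∈ extGr R W j) (b : ExteriorAlgebra R W) :
    anchorAt C (a * b) x = anchorAt C a x * b + a * anchorAt C b x := by
  have h := anchor_mul hx ha b
  rwa [Int.negOnePow_even _ (even_two_mul j), one_smul] at h

/-- If an element of degree two of `L` acts as zero on functions and on a basis of `W`, then it
lies in the kernel of the anchor. -/
theorem anchorAt_eq_zero {x : Lmod C} (hx : x ∈ lGr C 2)
    (h0 : ∀ r, anchorAt C (algebraMap R _ r) x = 0)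
    (hj : ∀ j, anchorAt C (ExteriorAlgebra.ι R (θ j)) x = 0) (b : ExteriorAlgebra R W) :
    anchorAt C b x = 0 := by
  let φ : ExteriorAlgebra R W →+ ExteriorAlgebra R W :=
    { toFun := fun b => anchorAt C b x
      map_zero' := map_zero (anchor C x)
      map_add' := map_add (anchor C x) }
  have hm : ∀ {j : ℤ} {a : ExteriorAlgebra R W}, a ∈ extGr R W j → ∀ b,
      φ (a * b) = φ a * b + a * φ b := fun ha b => anchorAt_mul C hx ha b
  have h0' : ∀ r, φ (algebraMap R _ r) = 0 := h0
  have hj' : ∀ j, φ (ExteriorAlgebra.ι R (θ j)) = 0 := hj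
  have h1 : ∀ w, φ (ExteriorAlgebra.ι R w) = 0 := by
    intro w
    rw [← θ.sum_repr w, map_sum, map_sum]
    refine Finset.sum_eq_zero fun j _ => ?_
    have hr : algebraMap R (ExteriorAlgebra R W) (θ.repr w j) ∈ extGr R W 0 :=
      Submodule.mem_one.2 ⟨_, rfl⟩
    rw [map_smul, Algebra.smul_def, hm hr, h0', hj', zero_mul, mul_zero, add_zero]
  change φ b = 0
  induction b using CliffordAlgebra.left_induction with
  | algebraMap r => exact h0' r
  | add x y hx hy => rw [map_add, hx, hy, add_zero]
  | ι_mul x w hx =>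
    change φ (ExteriorAlgebra.ι R w * x) = 0
    rw [hm (ι_mem_extGr w), h1, hx, zero_mul, mul_zero, add_zero]

theorem anchorAt_weylMap {P Q : Matrix (Fin 3) (Fin 3) R} (hP : P ∈ stfMat R)
    (hQ : Q ∈ stfMat R) (b : ExteriorAlgebra R W) : anchorAt C b (weylMap hC hθ' (P, Q)) = 0 := by
  refine anchorAt_eq_zero (weylMap_mem hC hθ' _) (fun r => ?_)
    (fun j => anchorAt_weylMap_basis hC hθ' hP hQ j) b
  simp only [weylMap_apply, map_sum, map_add, anchorAt_smul, weylRe, weylIm, anchorAt_tmul,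
    lam_algebraMap, sigmaBoost_fst, sigmaRot_fst, Derivation.coe_zero, Pi.zero_apply, map_zero,
    mul_zero, smul_zero, add_zero, Finset.sum_const_zero]

/-- The anchor is linear over `⋀ W`, so it suffices that it kills the generators of the ideal. -/
theorem anchor_idealI (hC : ∀ g ∈ C, ∀ g' ∈ C, ∃ u : R, g' = u • g) (hg : g ∈ C)
    (hθ : IsON g θ) : idealI C g ≤ LinearMap.ker (anchor C) := by
  have hθ' : IsConfOrthonormal C θ := ⟨g, hg, hθ⟩
  rw [idealI_eq_span hC hθ' hg hθ, Submodule.span_le]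
  rintro _ ⟨⟨P, Q⟩, ⟨hP, hQ⟩, rfl⟩
  have h := anchorAt_weylMap hC hθ' (P := P) (Q := Q) hP hQ
  generalize weylMap hC hθ' (P, Q) = x at h ⊢
  exact LinearMap.mem_ker.2 (LinearMap.ext h)

/-- The antisymmetric matrix of a vector. -/
def rotMat (v : Fin 3 → R) : Matrix (Fin 3) (Fin 3) R :=
  !![0, v 2, -v 1; -v 2, 0, v 0; v 1, -v 0, 0]

theorem comm_apply (δ ε : CDerEnd C) (w : W) :
    (CDerEnd.comm δ ε).1.2 w = δ.1.2 (ε.1.2 w) - ε.1.2 (δ.1.2 w) := rfl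

/-- The commutator with `δ` acts on boosts and rotations through the adjoint representation of the
Lorentz part of `δ`. In terms of `σ_b + i ρ_b` it is the antisymmetric complex matrix `A` with
real part `rotMat` of the rotation coordinates and imaginary part `rotMat` of the boost
coordinates. -/
theorem comm_sigma (hg : g ∈ C) (hθ : IsON g θ) (δ : CDerEnd C) (b : Fin 3) :
    CDerEnd.comm δ (sigmaBoost hC θ hθ' b) =
      ∑ a, (rotMat (fun c => rotCoord C θ c δ) a b • sigmaBoost hC θ hθ' a +
        (-rotMat (fun c => boostCoord C θ c δ) a b) • sigmaRot hC θ hθ' a) ∧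
    CDerEnd.comm δ (sigmaRot hC θ hθ' b) =
      ∑ a, (rotMat (fun c => boostCoord C θ c δ) a b • sigmaBoost hC θ hθ' a +
        rotMat (fun c => rotCoord C θ c δ) a b • sigmaRot hC θ hθ' a) := by
  have e := apply_basis hg hθ δ
  have t := boost_rot_table θ
  obtain ⟨s1, s2, s3⟩ := fin3_succ
  have z : ∀ ε : CDerEnd C, ε.1.1 = 0 → (CDerEnd.comm δ ε).1.1 = 0 := by
    intro ε h
    change ⁅δ.1.1, ε.1.1⁆ = 0
    rw [h]
    simp
  refine ⟨CDerEnd.ext_basis (θ := θ) ?_ fun j => ?_, CDerEnd.ext_basis (θ := θ) ?_ fun j => ?_⟩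
  · rw [z _ (sigmaBoost_fst hC hθ' b)]
    simp [Fin.sum_univ_three, sigmaBoost_fst, sigmaRot_fst]
  · rw [comm_apply, sigmaBoost_apply, e]
    simp only [Fin.sum_univ_three, Submodule.coe_add, Submodule.coe_smul, Prod.snd_add,
      Prod.smul_snd, LinearMap.add_apply, LinearMap.smul_apply, sigmaBoost_apply, sigmaRot_apply]
    fin_cases b <;> fin_cases j <;>
      simp [t, e, boost_zero, rot_zero, Fin.sum_univ_three, s1, s2, s3, rotMat] <;> module
  · rw [z _ (sigmaRot_fst hC hθ' b)]
    simp [Fin.sum_univ_three, sigmaBoost_fst, sigmaRot_fst]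
  · rw [comm_apply, sigmaRot_apply, e]
    simp only [Fin.sum_univ_three, Submodule.coe_add, Submodule.coe_smul, Prod.snd_add,
      Prod.smul_snd, LinearMap.add_apply, LinearMap.smul_apply, sigmaBoost_apply, sigmaRot_apply]
    fin_cases b <;> fin_cases j <;>
      simp [t, e, boost_zero, rot_zero, Fin.sum_univ_three, s1, s2, s3, rotMat] <;> module

/-- The action of `δ` on the bivectors `θ₀θ_b + i θ_{b+1}θ_{b+2}`: they are transformed by the matrix
`A` of `comm_sigma` and scaled by twice the scaling component of `δ`. -/
theorem lam_theta (hg : g ∈ C) (hθ : IsON g θ) (δ : CDerEnd C) (b : Fin 3) :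
    lam C δ (thetaRe θ b) = (2 * derCoord C θ 0 0 δ) • thetaRe θ b +
      ∑ a, (rotMat (fun c => rotCoord C θ c δ) a b • thetaRe θ a +
        (-rotMat (fun c => boostCoord C θ c δ) a b) • thetaIm θ a) ∧
    lam C δ (thetaIm θ b) = (2 * derCoord C θ 0 0 δ) • thetaIm θ b +
      ∑ a, (rotMat (fun c => boostCoord C θ c δ) a b • thetaRe θ a +
        rotMat (fun c => rotCoord C θ c δ) a b • thetaIm θ a) := by
  have e := apply_basis hg hθ δ
  have t := boost_rot_table θ
  obtain ⟨s1, s2, s3⟩ := fin3_succ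
  obtain ⟨r1, r2, r3, r4⟩ := ext_rules (R := R) θ
  constructor <;> fin_cases b <;>
    simp [thetaRe, thetaIm, lam_mul, lam_ι, e, t, boost_zero, rot_zero, Fin.sum_univ_three, s1, s2,
      s3, rotMat, mul_add, add_mul, r1, r3 1 0, r3 2 0, r3 2 1, r3 3 1, r3 3 2] <;> module

theorem bracket_one_tmul (δ : CDerEnd C) (a : ExteriorAlgebra R W) (ε : CDerEnd C) :
    bracket C (1 ⊗ₜ[R] δ) (a ⊗ₜ[R] ε) = a ⊗ₜ[R] CDerEnd.comm δ ε + lam C δ a ⊗ₜ[R] ε := by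
  rw [bracket_tmul, one_mul, one_mul, lam_one, zero_mul, TensorProduct.zero_tmul, sub_zero]

theorem bracket_one_tmul_smul (δ : CDerEnd C) (r : R) (x : Lmod C) :
    bracket C (1 ⊗ₜ[R] δ) (r • x) = δ.1.1 r • x + r • bracket C (1 ⊗ₜ[R] δ) x := by
  have h1 : (1 : ExteriorAlgebra R W) ⊗ₜ[R] δ ∈ lGr C 0 :=
    tmul_mem_tensorRange (Submodule.one_le.1 (le_of_eq (pow_zero _).symm)) δ
  have h := bracket_leibniz h1 (j := 0) (Submodule.mem_one.2 ⟨r, rfl⟩) x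
  rwa [algebraMap_smul, anchor_tmul, one_mul, lam_algebraMap, algebraMap_smul, mul_zero,
    Int.negOnePow_zero, one_smul, algebraMap_smul] at h

theorem bracket_one_tmul_weylRe (hg : g ∈ C) (hθ : IsON g θ) (δ : CDerEnd C) (a b : Fin 3) :
    bracket C (1 ⊗ₜ[R] δ) (weylRe hC hθ' a b) =
      (2 * derCoord C θ 0 0 δ) • weylRe hC hθ' a b +
      ∑ d, (rotMat (fun c => rotCoord C θ c δ) d a • weylRe hC hθ' d b -
        rotMat (fun c => boostCoord C θ c δ) d a • weylIm hC hθ' d b +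
        rotMat (fun c => rotCoord C θ c δ) d b • weylRe hC hθ' a d -
        rotMat (fun c => boostCoord C θ c δ) d b • weylIm hC hθ' a d) := by
  have l := fun b => (lam_theta hg hθ δ b).1
  have l' := fun b => (lam_theta hg hθ δ b).2
  have k := fun b => (comm_sigma hC hθ' hg hθ δ b).1
  have k' := fun b => (comm_sigma hC hθ' hg hθ δ b).2
  simp only [weylRe, weylIm, map_add, bracket_one_tmul, TensorProduct.neg_tmul, map_neg, l, l', k,
    k', Fin.sum_univ_three, TensorProduct.add_tmul, TensorProduct.tmul_add,
    TensorProduct.tmul_smul, ← TensorProduct.smul_tmul']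
  module

theorem bracket_one_tmul_weylIm (hg : g ∈ C) (hθ : IsON g θ) (δ : CDerEnd C) (a b : Fin 3) :
    bracket C (1 ⊗ₜ[R] δ) (weylIm hC hθ' a b) =
      (2 * derCoord C θ 0 0 δ) • weylIm hC hθ' a b +
      ∑ d, (rotMat (fun c => boostCoord C θ c δ) d a • weylRe hC hθ' d b +
        rotMat (fun c => rotCoord C θ c δ) d a • weylIm hC hθ' d b +
        rotMat (fun c => boostCoord C θ c δ) d b • weylRe hC hθ' a d +
        rotMat (fun c => rotCoord C θ c δ) d b • weylIm hC hθ' a d) := by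
  have l := fun b => (lam_theta hg hθ δ b).1
  have l' := fun b => (lam_theta hg hθ δ b).2
  have k := fun b => (comm_sigma hC hθ' hg hθ δ b).1
  have k' := fun b => (comm_sigma hC hθ' hg hθ δ b).2
  simp only [weylRe, weylIm, map_add, bracket_one_tmul, TensorProduct.neg_tmul, l, l', k, k',
    Fin.sum_univ_three, TensorProduct.add_tmul, TensorProduct.tmul_add,
    TensorProduct.tmul_smul, ← TensorProduct.smul_tmul']
  module

theorem rotMat_transpose (v : Fin 3 → R) : (rotMat v).transpose = -rotMat v := by
  ext i j
  fin_cases i <;> fin_cases j <;> simp [rotMat]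

theorem rotMat_action_mem (v : Fin 3 → R) {P : Matrix (Fin 3) (Fin 3) R} (hP : P ∈ stfMat R) :
    rotMat v * P + P * (rotMat v).transpose ∈ stfMat R := by
  refine ⟨?_, ?_⟩
  · rw [Matrix.IsSymm, Matrix.transpose_add, Matrix.transpose_mul, Matrix.transpose_mul,
      Matrix.transpose_transpose, hP.1, add_comm]
  · rw [Matrix.trace_add, Matrix.trace_mul_comm P, rotMat_transpose, neg_mul, Matrix.trace_neg,
      add_neg_cancel]

theorem map_derivation_mem (d : Derivation ℝ R R) {P : Matrix (Fin 3) (Fin 3) R}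
    (hP : P ∈ stfMat R) : P.map d ∈ stfMat R := by
  obtain ⟨p1, p2, p3, p4⟩ := mem_stfMat_iff.1 hP
  rw [mem_stfMat_iff]
  simp [p1, p2, p3, p4]

/-- For `S = P - i Q`, the bracket with `δ` replaces `S` by `δ(S) + 2 λ S + A S + S Aᵀ`, where `λ` is
the scaling component of `δ` and `A` the antisymmetric complex matrix of its Lorentz part. -/
theorem bracket_one_tmul_weylMap (hg : g ∈ C) (hθ : IsON g θ) (δ : CDerEnd C)
    (P Q : Matrix (Fin 3) (Fin 3) R) :
    bracket C (1 ⊗ₜ[R] δ) (weylMap hC hθ' (P, Q)) = weylMap hC hθ'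
      (P.map δ.1.1 + (2 * derCoord C θ 0 0 δ) • P +
        (rotMat (fun c => rotCoord C θ c δ) * P +
          P * (rotMat (fun c => rotCoord C θ c δ)).transpose) +
        (rotMat (fun c => boostCoord C θ c δ) * Q +
          Q * (rotMat (fun c => boostCoord C θ c δ)).transpose),
       Q.map δ.1.1 + (2 * derCoord C θ 0 0 δ) • Q +
        (rotMat (fun c => rotCoord C θ c δ) * Q +
          Q * (rotMat (fun c => rotCoord C θ c δ)).transpose) -
        (rotMat (fun c => boostCoord C θ c δ) * P +
          P * (rotMat (fun c => boostCoord C θ c δ)).transpose)) := by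
  have e1 := bracket_one_tmul_weylRe hC hθ' hg hθ δ
  have e2 := bracket_one_tmul_weylIm hC hθ' hg hθ δ
  generalize rotMat (fun c => rotCoord C θ c δ) = M at *
  generalize rotMat (fun c => boostCoord C θ c δ) = K at *
  simp only [weylMap_apply, map_sum, map_add, bracket_one_tmul_smul, e1, e2]
  generalize weylRe hC hθ' = X
  generalize weylIm hC hθ' = Y
  simp only [Fin.sum_univ_three, Matrix.add_apply, Matrix.sub_apply, Matrix.mul_apply,
    Matrix.transpose_apply, Matrix.map_apply, Matrix.smul_apply, smul_eq_mul]
  module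

theorem bracket_one_tmul_mem (hC : ∀ g ∈ C, ∀ g' ∈ C, ∃ u : R, g' = u • g) (hg : g ∈ C)
    (hθ : IsON g θ) (δ : CDerEnd C) {m : Lmod C} (hm : m ∈ weylSub hC ⟨g, hg, hθ⟩) :
    bracket C (1 ⊗ₜ[R] δ) m ∈ idealI C g := by
  have hθ' : IsConfOrthonormal C θ := ⟨g, hg, hθ⟩
  obtain ⟨⟨P, Q⟩, ⟨hP, hQ⟩, rfl⟩ := hm
  rw [bracket_one_tmul_weylMap hC hθ' hg hθ]
  refine (weylSub_le_iGr hC hθ' hg hθ ⟨_, ⟨?_, ?_⟩, rfl⟩).1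
  · exact add_mem (add_mem (add_mem (map_derivation_mem _ hP) (Submodule.smul_mem _ _ hP))
      (rotMat_action_mem _ hP)) (rotMat_action_mem _ hQ)
  · exact sub_mem (add_mem (add_mem (map_derivation_mem _ hQ) (Submodule.smul_mem _ _ hQ))
      (rotMat_action_mem _ hQ)) (rotMat_action_mem _ hP)

theorem units_smul_mem {A M : Type*} [Ring A] [AddCommGroup M] [Module A M] (N : Submodule A M)
    (s : ℤˣ) {x : M} (hx : x ∈ N) : s • x ∈ N := by
  rcases Int.units_eq_one_or s with h | h <;> rw [h]
  · rwa [one_smul]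
  · rw [Units.neg_smul, one_smul]
    exact neg_mem hx

/-- The bracket with a homogeneous element of `I²`: since `I²` lies in the kernel of the anchor,
the bracket is linear in the other argument up to sign. -/
theorem bracket_weylSub_mem (hC : ∀ g ∈ C, ∀ g' ∈ C, ∃ u : R, g' = u • g) (hg : g ∈ C)
    (hθ : IsON g θ) (x : Lmod C) {m : Lmod C} (hm : m ∈ weylSub hC ⟨g, hg, hθ⟩) :
    bracket C x m ∈ idealI C g := by
  have hm2 := weylSub_le_iGr hC ⟨g, hg, hθ⟩ hg hθ hm
  induction x using lmod_induction with
  | zero => rw [map_zero]; exact zero_mem _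
  | add x y h1 h2 => rw [map_add]; exact add_mem h1 h2
  | tmul k b hb δ =>
    have h1 : (1 : ExteriorAlgebra R W) ⊗ₜ[R] δ ∈ lGr C 0 :=
      tmul_mem_tensorRange (Submodule.one_le.1 (le_of_eq (pow_zero _).symm)) δ
    have hs : b ⊗ₜ[R] δ = b • ((1 : ExteriorAlgebra R W) ⊗ₜ[R] δ) := by
      rw [TensorProduct.smul_tmul', smul_eq_mul, mul_one]
    have hz : anchor C m b = 0 := by
      rw [LinearMap.mem_ker.1 (anchor_idealI hC hg hθ hm2.1)]
      rfl
    rw [bracket_skew (tmul_mem_tensorRange hb δ) hm2.2, hs, bracket_leibniz hm2.2 hb, hz,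
      zero_smul, zero_add, bracket_skew hm2.2 h1]
    refine neg_mem (units_smul_mem _ _ (units_smul_mem _ _ (Submodule.smul_mem _ _ (neg_mem
      (units_smul_mem _ _ ?_)))))
    exact bracket_one_tmul_mem hC hg hθ δ hm

/-- The ideal is generated by `I²` and killed by the anchor, so the Leibniz rule reduces the claim to
brackets with elements of `I²`. -/
theorem bracket_idealI (hC : ∀ g ∈ C, ∀ g' ∈ C, ∃ u : R, g' = u • g) (hg : g ∈ C)
    (hθ : IsON g θ) (x y : Lmod C) (hy : y ∈ idealI C g) : bracket C x y ∈ idealI C g := by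
  have hI := idealI_eq_span hC ⟨g, hg, hθ⟩ hg hθ
  rw [hI] at hy
  induction hy using Submodule.span_induction generalizing x with
  | mem m hm => exact bracket_weylSub_mem hC hg hθ x hm
  | zero => rw [map_zero]; exact zero_mem _
  | add y z hy hz h1 h2 =>
    rw [map_add]
    exact add_mem (h1 x) (h2 x)
  | smul a y hy h =>
    rw [← hI] at hy
    -- by additivity, `x` and `a` may be taken homogeneous
    have ha : a ∈ ⨆ k, extGr R W k := by rw [iSup_extGr]; trivial
    induction x using lmod_induction with
    | zero => rw [map_zero]; exact zero_mem _
    | add x z h1 h2 => rw [map_add]; exact add_mem h1 h2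
    | tmul k b hb δ =>
      induction ha using Submodule.iSup_induction' with
      | mem j a ha =>
        rw [bracket_leibniz (tmul_mem_tensorRange hb δ) ha]
        exact add_mem (Submodule.smul_mem _ _ hy)
          (units_smul_mem _ _ (Submodule.smul_mem _ _ (h _)))
      | zero => rw [zero_smul, map_zero]; exact zero_mem _
      | add a a' _ _ h1 h2 =>
        rw [add_smul, map_add]
        exact add_mem h1 h2

end IdealBracket

/-! ### Parity -/

section Parity

variable {R W : Type*} [CommRing R] [Algebra ℝ R] [AddCommGroup W] [Module R W]
  [Module ℝ W] [IsScalarTower ℝ R W] {C : Set (LinearMap.BilinForm R W)}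
  {g : LinearMap.BilinForm R W}

theorem involute_mem_clFil {k : ℤ} {a : Cl g} (ha : a ∈ clFil (negQuad g) k) :
    CliffordAlgebra.involute a ∈ clFil (negQuad g) k := by
  match k, ha with
  | .negSucc n, ha =>
    have h0 : a = 0 := ha
    rw [h0, map_zero]
    exact zero_mem _
  | .ofNat n, ha =>
    have h1 : (1 ⊔ LinearMap.range (CliffordAlgebra.ι (negQuad g))).map
        (CliffordAlgebra.involute (Q := negQuad g)).toLinearMap ≤
        1 ⊔ LinearMap.range (CliffordAlgebra.ι (negQuad g)) := by
      rw [Submodule.map_sup, Submodule.map_one]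
      refine sup_le_sup_left ?_ _
      rintro _ ⟨_, ⟨w, rfl⟩, rfl⟩
      exact ⟨-w, by simp⟩
    have h2 := pow_le_pow_left' h1 n
    rw [← Submodule.map_pow] at h2
    exact h2 ⟨a, ha, rfl⟩

theorem half_smul_two {X : Type*} [AddCommGroup X] [Module R X] (x : X) :
    algebraMap ℝ R (1 / 2) • (x + x) = x := by
  rw [← two_smul R x, smul_smul, ← map_ofNat (algebraMap ℝ R) 2, ← map_mul]
  norm_num

/-- The filtration of the Clifford algebra is compatible with the parity grading. -/
theorem exists_parity_of_mem_clFil {k : ℤ} {a : Cl g} (ha : a ∈ clFil (negQuad g) k) (j : ZMod 2) :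
    ∃ b ∈ clFil (negQuad g) k ⊓ CliffordAlgebra.evenOdd (negQuad g) j,
      ∃ c ∈ CliffordAlgebra.evenOdd (negQuad g) (j + 1), a = b + c := by
  obtain ⟨b, hb, c, hc, rfl⟩ := Submodule.mem_sup.1
    ((CliffordAlgebra.evenOdd_isCompl (Q := negQuad g)).sup_eq_top.ge (Submodule.mem_top (x := a)))
  have h1 := involute_mem_clFil ha
  rw [map_add, CliffordAlgebra.involute_eq_of_mem_even hb,
    CliffordAlgebra.involute_eq_of_mem_odd hc] at h1
  have hb' : b ∈ clFil (negQuad g) k := by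
    rw [← half_smul_two (R := R) b]
    refine Submodule.smul_mem _ _ ?_
    convert add_mem ha h1 using 1
    abel
  have hc' : c ∈ clFil (negQuad g) k := by
    simpa using sub_mem ha hb'
  have hj : j = 0 ∨ j = 1 := by revert j; decide
  rcases hj with rfl | rfl
  · exact ⟨b, ⟨hb', hb⟩, c, hc, rfl⟩
  · exact ⟨c, ⟨hc', hc⟩, b, hb, add_comm _ _⟩

theorem eq_zero_of_mem_evenOdd {D : Type*} [AddCommGroup D] [Module R D] {z : Cl g ⊗[R] D}
    (j : ZMod 2) (h : z ∈ tensorRange D (CliffordAlgebra.evenOdd (negQuad g) j))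
    (h' : z ∈ tensorRange D (CliffordAlgebra.evenOdd (negQuad g) (j + 1))) : z = 0 := by
  let inv : Cl g ⊗[R] D →ₗ[R] Cl g ⊗[R] D :=
    LinearMap.rTensor D (CliffordAlgebra.involute (Q := negQuad g)).toLinearMap
  have h0 : ∀ z ∈ tensorRange D (CliffordAlgebra.evenOdd (negQuad g) 0), inv z = z := by
    intro z hz
    refine tensorRange_induction (P := fun x _ => inv x = x) (map_zero _) (fun a ha d => ?_)
      (fun x y _ _ h1 h2 => by rw [map_add, h1, h2]) hz
    change CliffordAlgebra.involute a ⊗ₜ[R] d = _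
    rw [CliffordAlgebra.involute_eq_of_mem_even ha]
  have h1 : ∀ z ∈ tensorRange D (CliffordAlgebra.evenOdd (negQuad g) 1), inv z = -z := by
    intro z hz
    refine tensorRange_induction (P := fun x _ => inv x = -x) (by simp) (fun a ha d => ?_)
      (fun x y _ _ h1 h2 => by rw [map_add, h1, h2, neg_add]) hz
    change CliffordAlgebra.involute a ⊗ₜ[R] d = _
    rw [CliffordAlgebra.involute_eq_of_mem_odd ha, TensorProduct.neg_tmul]
  have h2 : z = -z := by
    have hj : ∀ j : ZMod 2, j = 0 ∨ j = 1 := by decide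
    rcases hj j with rfl | rfl
    · exact (h0 z h).symm.trans (h1 z h')
    · exact (h0 z h').symm.trans (h1 z h)
  rw [← half_smul_two (R := R) z]
  nth_rewrite 2 [h2]
  rw [add_neg_cancel, smul_zero]

theorem lbarTri_le (k : ℤ) : lbarTri C g k ≤ tensorRange (CDerEnd C) (clTri g k) := by
  rintro x ⟨hx, hx'⟩
  have h : ∃ y ∈ tensorRange (CDerEnd C) (clTri g k), ∃ z ∈ tensorRange (CDerEnd C)
      (CliffordAlgebra.evenOdd (negQuad g) ((k : ZMod 2) + 1)), x = y + z := by
    refine tensorRange_induction (P := fun x _ => ∃ y ∈ tensorRange (CDerEnd C) (clTri g k),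
      ∃ z ∈ tensorRange (CDerEnd C) (CliffordAlgebra.evenOdd (negQuad g) ((k : ZMod 2) + 1)),
        x = y + z) ⟨0, zero_mem _, 0, zero_mem _, (add_zero _).symm⟩ (fun a ha d => ?_) ?_ hx
    · obtain ⟨b, hb, c, hc, rfl⟩ := exists_parity_of_mem_clFil ha (k : ZMod 2)
      exact ⟨_, tmul_mem_tensorRange hb d, _, tmul_mem_tensorRange hc d,
        TensorProduct.add_tmul _ _ _⟩
    · rintro _ _ _ _ ⟨y, hy, z, hz, rfl⟩ ⟨y', hy', z', hz', rfl⟩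
      exact ⟨_, add_mem hy hy', _, add_mem hz hz', by abel⟩
  obtain ⟨y, hy, z, hz, rfl⟩ := h
  have hz' : z ∈ tensorRange (CDerEnd C) (CliffordAlgebra.evenOdd (negQuad g) (k : ZMod 2)) := by
    have := sub_mem hx' (tensorRange_mono (D := CDerEnd C) inf_le_right hy)
    rwa [add_sub_cancel_left] at this
  rw [eq_zero_of_mem_evenOdd _ hz' hz, add_zero]
  exact hy

theorem mul_ι_mem_clTri {k : ℤ} {a : Cl g} (ha : a ∈ clTri g k) (w : W) :
    a * CliffordAlgebra.ι (negQuad g) w ∈ clTri g (k + 1) := by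
  refine ⟨?_, ?_⟩
  · match k, ha.1 with
    | .negSucc n, h =>
      have h0 : a = 0 := h
      rw [h0, zero_mul]
      exact zero_mem _
    | .ofNat n, h =>
      change _ ∈ (1 ⊔ LinearMap.range (CliffordAlgebra.ι (negQuad g))) ^ (n + 1)
      rw [pow_succ]
      exact Submodule.mul_mem_mul h (Submodule.mem_sup_right ⟨w, rfl⟩)
  · have := CliffordAlgebra.evenOdd_mul_le (negQuad g) (k : ZMod 2) 1
      (Submodule.mul_mem_mul ha.2 (CliffordAlgebra.ι_mem_evenOdd_one _ w))
    simpa using this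

theorem fMor_mem_pbarTri (k : ℤ) (x : Lbar C g) (hx : x ∈ lbarTri C g k) :
    fMor C g x ∈ pbarTri g k := by
  refine tensorRange_induction (P := fun x _ => fMor C g x ∈ pbarTri g k) ?_ (fun a ha δ => ?_)
    (fun x y _ _ h1 h2 => ?_) (lbarTri_le k hx)
  · rw [map_zero]
    exact ⟨fun r => zero_mem _, fun w => zero_mem _, fun η => zero_mem _⟩
  · refine ⟨fun r => ?_, fun w => ?_, fun η => ?_⟩
    · rw [fMor_tmul_fst]
      exact Submodule.smul_mem _ _ ha
    · rw [fMor_tmul_snd]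
      exact mul_ι_mem_clTri ha _
    · rw [fMor_tmul_om]
      exact tmul_mem_tensorRange ha _
  · rw [map_add]
    exact ⟨fun r => add_mem (h1.1 r) (h2.1 r), fun w => add_mem (h1.2.1 w) (h2.2.1 w),
      fun η => add_mem (h1.2.2 η) (h2.2.2 η)⟩

end Parity

/-! ### The quotient `E = L / I` -/

section Quotient

variable {R W : Type*} [CommRing R] [Algebra ℝ R] [AddCommGroup W] [Module R W]
  [Module ℝ W] [IsScalarTower ℝ R W] {C : Set (LinearMap.BilinForm R W)}
  {g : LinearMap.BilinForm R W}

attribute [local instance] lmodAddCommMonoid lmodAddMonoid lmodSubNegMonoid lmodUnitsSMul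

variable (C g) in
theorem exists_equiv_gr_quotient : ∃ e : Emod C g ≃ₗ[ExteriorAlgebra R W]
    ((lbarFil C g).Gr ⧸ LinearMap.range (grIbar C g)),
      ∀ x, e (Submodule.Quotient.mk x) = Submodule.Quotient.mk (canon C g x) :=
  ⟨Submodule.Quotient.equiv _ _ (LinearEquiv.ofBijective (canon C g) (canon_bijective C g))
    (Submodule.map_comap_eq_of_surjective (canon_bijective C g).2 _), fun _ => rfl⟩

theorem grProj_mem_grPiece {k : ℤ} {x : (lbarFil C g).Gr} (hx : x ∈ (lbarFil C g).grPiece k) :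
    grEbar C g x ∈ ((lbarFil C g).quot (Ibar C g)).grPiece k := by
  obtain ⟨y, rfl⟩ := hx
  exact ⟨_, ((lbarFil C g).grProj_symb (Ibar C g) k y).symm⟩

variable (C g) in
/-- The canonical isomorphism `E ≃ Gr Ē`. -/
def emodEquiv : Emod C g ≃ₗ[ExteriorAlgebra R W] ((lbarFil C g).quot (Ibar C g)).Gr :=
  (Submodule.quotEquivOfEq _ _ (by
    rw [LinearMap.ker_comp, ClFiltration.ker_grProj]
    rfl)).trans
    ((grEbar C g ∘ₗ canon C g).quotKerEquivOfSurjective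
      (((lbarFil C g).grProj_surjective _).comp (canon_bijective C g).2))

theorem emodEquiv_mk (x : Lmod C) :
    emodEquiv C g (Submodule.Quotient.mk x) = grEbar C g (canon C g x) := rfl

theorem mk_mem_eGr {k : ℤ} {x : Lmod C} (hx : x ∈ lGr C k) :
    (Submodule.Quotient.mk x : Emod C g) ∈ eGr C g k := ⟨x, hx, rfl⟩

theorem mem_eGr_iff (k : ℤ) (x : Emod C g) : x ∈ eGr C g k ↔
    emodEquiv C g x ∈ ((lbarFil C g).quot (Ibar C g)).grPiece k := by
  constructor
  · rintro ⟨y, hy, rfl⟩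
    exact grProj_mem_grPiece (canon_mem_grPiece C g hy)
  · intro h
    obtain ⟨z, hz, h2⟩ := ClFiltration.map_grProj_grPiece _ _ k h
    obtain ⟨y, rfl⟩ := (canon_bijective C g).2 z
    rw [← emodEquiv_mk, (emodEquiv C g).injective.eq_iff] at h2
    rw [← h2]
    exact mk_mem_eGr ((mem_lGr_iff C g k y).2 hz)

theorem emod_induction {P : Emod C g → Prop} (zero : P 0)
    (mk : ∀ k, ∀ x ∈ lGr C k, P (Submodule.Quotient.mk x)) (add : ∀ x y, P x → P y → P (x + y))
    (x : Emod C g) : P x := by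
  obtain ⟨x, rfl⟩ := Submodule.Quotient.mk_surjective _ x
  induction x using lmod_induction with
  | zero => exact zero
  | tmul k a ha δ => exact mk k _ (tmul_mem_tensorRange ha δ)
  | add x y h1 h2 => exact add _ _ h1 h2

theorem eGr_isInternal : DirectSum.IsInternal (eGr C g) := by
  rw [DirectSum.isInternal_submodule_iff_iSupIndep_and_iSup_eq_top]
  constructor
  · intro k
    rw [Submodule.disjoint_def]
    intro x hx hx'
    have h1 : ((lbarFil C g).quot (Ibar C g)).grComp k (emodEquiv C g x) = 0 := by
      rw [iSup_subtype'] at hx'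
      refine Submodule.iSup_induction _ (motive := fun x =>
        ((lbarFil C g).quot (Ibar C g)).grComp k (emodEquiv C g x) = 0) hx' ?_ ?_ ?_
      · rintro ⟨j, hj⟩ y hy
        exact ClFiltration.grComp_of_mem_ne _ hj ((mem_eGr_iff j y).1 hy)
      · rw [map_zero, map_zero]
      · intro y z hy hz
        rw [map_add, map_add, hy, hz, add_zero]
    rw [ClFiltration.grComp_of_mem _ ((mem_eGr_iff k x).1 hx)] at h1
    exact (emodEquiv C g).map_eq_zero_iff.1 h1
  · rw [eq_top_iff]
    rintro x -
    induction x using emod_induction with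
    | zero => exact zero_mem _
    | mk k x hx => exact Submodule.mem_iSup_of_mem k (mk_mem_eGr hx)
    | add x y h1 h2 => exact add_mem h1 h2

/-- The ideal is spanned by its homogeneous elements. -/
theorem mem_iSup_iGr {x : Lmod C} (hx : x ∈ idealI C g) : x ∈ ⨆ k, iGr C g k := by
  have h : canon C g x ∈ (⨆ k, iGr C g k).map ((canon C g).restrictScalars R) := by
    refine ClFiltration.mem_of_grComp_mem _ fun k => ?_
    obtain ⟨y, hy⟩ := (canon_bijective C g).2 ((lbarFil C g).grComp k (canon C g x))
    refine ⟨y, Submodule.mem_iSup_of_mem k ⟨?_, ?_⟩, hy⟩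
    · change canon C g y ∈ LinearMap.range (grIbar C g)
      rw [hy]
      exact ClFiltration.grComp_mem_range_grIncl _ _ k hx
    · refine (mem_lGr_iff C g k y).2 ?_
      rw [hy]
      exact ClFiltration.grComp_mem _ _ _
  obtain ⟨y, hy, h⟩ := h
  rwa [(canon_bijective C g).1 h] at hy

theorem bracket_idealI_left (h : ∀ x, ∀ y ∈ idealI C g, bracket C x y ∈ idealI C g)
    (x y : Lmod C) (hx : x ∈ idealI C g) : bracket C x y ∈ idealI C g := by
  induction y using lmod_induction with
  | zero => rw [map_zero]; exact zero_mem _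
  | add y z h1 h2 => rw [map_add]; exact add_mem h1 h2
  | tmul k b hb δ =>
    refine Submodule.iSup_induction _ (motive := fun x => bracket C x (b ⊗ₜ[R] δ) ∈ idealI C g)
      (mem_iSup_iGr hx) ?_ ?_ ?_
    · rintro j x ⟨hx, hx'⟩
      rw [bracket_skew hx' (tmul_mem_tensorRange hb δ)]
      exact neg_mem (units_smul_mem _ _ (h _ _ hx))
    · rw [map_zero]; exact zero_mem _
    · intro x z h1 h2
      rw [map_add]
      exact add_mem h1 h2

/-- A representative in `L` of an element of `E`. -/
def emodOut (x : Emod C g) : Lmod C := (Submodule.Quotient.mk_surjective _ x).choose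

theorem mk_emodOut (x : Emod C g) : (Submodule.Quotient.mk (emodOut x) : Emod C g) = x :=
  (Submodule.Quotient.mk_surjective _ x).choose_spec

theorem mk_bracket_congr (h : ∀ x, ∀ y ∈ idealI C g, bracket C x y ∈ idealI C g)
    {x x' y y' : Lmod C}
    (hx : (Submodule.Quotient.mk x : Emod C g) = Submodule.Quotient.mk x')
    (hy : (Submodule.Quotient.mk y : Emod C g) = Submodule.Quotient.mk y') :
    (Submodule.Quotient.mk (bracket C x y) : Emod C g) =
      Submodule.Quotient.mk (bracket C x' y') := by
  rw [Submodule.Quotient.eq] at hx hy ⊢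
  have h1 := bracket_idealI_left h _ y hx
  have h2 := h x' _ hy
  rw [map_sub, AddMonoidHom.sub_apply] at h1
  rw [map_sub] at h2
  have := add_mem h1 h2
  rwa [sub_add_sub_cancel] at this

variable (h : ∀ x, ∀ y ∈ idealI C g, bracket C x y ∈ idealI C g)

/-- The bracket of `E`. -/
def emodBr : Emod C g →ₗ[ℝ] Emod C g →ₗ[ℝ] Emod C g :=
  LinearMap.mk₂ ℝ (fun x y => Submodule.Quotient.mk (bracket C (emodOut x) (emodOut y)))
    (fun x x' y => by
      rw [← Submodule.Quotient.mk_add, ← AddMonoidHom.add_apply, ← map_add]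
      refine mk_bracket_congr h ?_ rfl
      rw [Submodule.Quotient.mk_add, mk_emodOut, mk_emodOut, mk_emodOut])
    (fun r x y => by
      rw [← Submodule.Quotient.mk_smul, ← bracket_smul_real_left]
      refine mk_bracket_congr h ?_ rfl
      rw [Submodule.Quotient.mk_smul, mk_emodOut, mk_emodOut])
    (fun x y y' => by
      rw [← Submodule.Quotient.mk_add, ← map_add]
      refine mk_bracket_congr h rfl ?_
      rw [Submodule.Quotient.mk_add, mk_emodOut, mk_emodOut, mk_emodOut])
    (fun r x y => by
      rw [← Submodule.Quotient.mk_smul, ← bracket_smul_real_right]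
      refine mk_bracket_congr h rfl ?_
      rw [Submodule.Quotient.mk_smul, mk_emodOut, mk_emodOut])

theorem emodBr_mk (x y : Lmod C) : emodBr h (Submodule.Quotient.mk x) (Submodule.Quotient.mk y) =
    Submodule.Quotient.mk (bracket C x y) :=
  mk_bracket_congr h (mk_emodOut _) (mk_emodOut _)

theorem mk_units_smul (s : ℤˣ) (x : Lmod C) : (Submodule.Quotient.mk (s • x) : Emod C g) =
    s • (Submodule.Quotient.mk x : Emod C g) := by
  rcases Int.units_eq_one_or s with rfl | rfl
  · rw [one_smul, one_smul]
  · rw [Units.neg_smul, one_smul, Units.neg_smul, one_smul]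
    rfl

/-- The Lie algebroid structure descends to the quotient by an ideal that the anchor kills. -/
theorem emod_isGLaoid (ha : idealI C g ≤ LinearMap.ker (anchor C)) :
    IsGLaoid (fun k => (extGr R W k).restrictScalars ℝ) (eGr C g) (emodBr h)
      ((idealI C g).liftQ (anchor C) ha) where
  internal := eGr_isInternal
  smul_mem := by
    rintro i j a ha _ ⟨x, hx, rfl⟩
    exact mk_mem_eGr (smul_mem_lGr ha hx)
  br_mem := by
    rintro i j _ ⟨x, hx, rfl⟩ _ ⟨y, hy, rfl⟩
    exact (emodBr_mk h x y).symm ▸ mk_mem_eGr (bracket_mem hx hy)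
  br_skew := by
    rintro i j _ ⟨x, hx, rfl⟩ _ ⟨y, hy, rfl⟩
    change emodBr h (Submodule.Quotient.mk x) (Submodule.Quotient.mk y) =
      -((i * j).negOnePow • emodBr h (Submodule.Quotient.mk y) (Submodule.Quotient.mk x))
    rw [emodBr_mk, emodBr_mk, ← mk_units_smul, ← Submodule.Quotient.mk_neg, bracket_skew hx hy]
  jacobi := by
    rintro i j k _ ⟨x, hx, rfl⟩ _ ⟨y, hy, rfl⟩ _ ⟨z, hz, rfl⟩
    change emodBr h (Submodule.Quotient.mk x) (emodBr h (Submodule.Quotient.mk y)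
        (Submodule.Quotient.mk z)) + (i * (j + k)).negOnePow • emodBr h (Submodule.Quotient.mk y)
        (emodBr h (Submodule.Quotient.mk z) (Submodule.Quotient.mk x)) +
        (k * (i + j)).negOnePow • emodBr h (Submodule.Quotient.mk z)
        (emodBr h (Submodule.Quotient.mk x) (Submodule.Quotient.mk y)) = 0
    simp only [emodBr_mk]
    rw [← mk_units_smul, ← mk_units_smul, ← Submodule.Quotient.mk_add,
      ← Submodule.Quotient.mk_add, bracket_jacobi_cyclic hx hy hz, Submodule.Quotient.mk_zero]
  anchor_mem := by
    rintro i j _ ⟨x, hx, rfl⟩ a ha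
    exact anchor_mem hx ha
  anchor_mul := by
    rintro i j _ ⟨x, hx, rfl⟩ a ha b
    exact anchor_mul hx ha b
  anchor_br := by
    rintro i j _ ⟨x, hx, rfl⟩ _ ⟨y, hy, rfl⟩
    change (idealI C g).liftQ (anchor C) ha
      (emodBr h (Submodule.Quotient.mk x) (Submodule.Quotient.mk y)) = _
    rw [emodBr_mk]
    refine LinearMap.ext fun c => ?_
    exact anchor_bracket hx hy c
  leibniz := by
    rintro i j _ ⟨x, hx, rfl⟩ a ha' y
    obtain ⟨y, rfl⟩ := Submodule.Quotient.mk_surjective _ y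
    change emodBr h (Submodule.Quotient.mk x) (Submodule.Quotient.mk (a • y)) =
      anchor C x a • Submodule.Quotient.mk y + (i * j).negOnePow • (a •
        emodBr h (Submodule.Quotient.mk x) (Submodule.Quotient.mk y))
    rw [emodBr_mk, emodBr_mk, ← Submodule.Quotient.mk_smul, ← Submodule.Quotient.mk_smul,
      ← mk_units_smul, ← Submodule.Quotient.mk_add, bracket_leibniz hx ha']

end Quotient

/-! ### The basis of `I²` -/

section WeylBasis

variable {R W : Type*} [CommRing R] [Algebra ℝ R] [AddCommGroup W] [Module R W]
  [Module ℝ W] [IsScalarTower ℝ R W] {C : Set (LinearMap.BilinForm R W)}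
  {g : LinearMap.BilinForm R W} {θ : Module.Basis (Fin 4) R W}

attribute [local instance] lmodAddCommMonoid lmodAddMonoid lmodSubNegMonoid lmodUnitsSMul

variable (hC : ∀ g ∈ C, ∀ g' ∈ C, ∃ u : R, g' = u • g) (hθ' : IsConfOrthonormal C θ)

theorem eq_zero_of_sum_mem (hθ : IsON g θ) {p q : Fin 3 → R}
    (h : ∑ a, (p a • ee g θ a + q a • ff g θ a) ∈ clFil (negQuad g) 1) (a : Fin 3) :
    p a = 0 ∧ q a = 0 := by
  obtain ⟨h1, h2, h3, h4, h5, h6, -⟩ := ee_ff_eq hθ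
  rw [← monBasis_apply hθ] at h1 h2 h3 h4 h5 h6
  have h0 := (mem_clFil_iff hθ 1 _).1 h
  simp only [Fin.sum_univ_three, h1, h2, h3, h4, h5, h6, map_add, map_smul, map_neg, smul_neg,
    Module.Basis.repr_self, Finsupp.add_apply, Finsupp.neg_apply, Finsupp.smul_apply,
    Finsupp.single_apply, smul_eq_mul] at h0
  have e1 : p 0 = 0 := by simpa using h0 3 (by decide)
  have e2 : p 1 = 0 := by simpa using h0 5 (by decide)
  have e3 : q 2 = 0 := by simpa using h0 6 (by decide)
  have e4 : p 2 = 0 := by simpa using h0 9 (by decide)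
  have e5 : q 1 = 0 := by simpa using h0 10 (by decide)
  have e6 : q 0 = 0 := by simpa using h0 12 (by decide)
  fin_cases a
  · exact ⟨e1, e6⟩
  · exact ⟨e2, e5⟩
  · exact ⟨e4, e3⟩

theorem weylMap_injective (hθ : IsON g θ) : Function.Injective (weylMap hC hθ') := by
  rw [injective_iff_map_eq_zero]
  intro p hp
  have h := canon_weylMap hC hθ' hθ p
  rw [hp, map_zero] at h
  have h1 := ((lbarFil C g).symb_eq_zero_iff 2 _).1 h.symm
  have h2 : ∀ a b, p.1 a b = 0 ∧ p.2 a b = 0 := fun a b => by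
    have h3 := cBoost_mem (θ := θ) b h1
    rw [cBoost_tauSum, mcoef_apply] at h3
    exact eq_zero_of_sum_mem hθ h3 a
  refine Prod.ext ?_ ?_
  · ext a b
    exact (h2 a b).1
  · ext a b
    exact (h2 a b).2

theorem boost_unitsSMul (s : Rˣ) (a : Fin 3) : boost (θ.unitsSMul fun _ => s) a = boost θ a := by
  refine (θ.unitsSMul fun _ => s).ext fun j => ?_
  refine Fin.cases ?_ (fun j => ?_) j
  · rw [boost_zero, Module.Basis.unitsSMul_apply, Module.Basis.unitsSMul_apply, Units.smul_def,
      Units.smul_def, map_smul, boost_zero]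
  · rw [boost_succ, Module.Basis.unitsSMul_apply, Module.Basis.unitsSMul_apply, Units.smul_def,
      Units.smul_def, map_smul, boost_succ]
    split_ifs <;> simp

theorem rot_unitsSMul (s : Rˣ) (a : Fin 3) : rot (θ.unitsSMul fun _ => s) a = rot θ a := by
  refine (θ.unitsSMul fun _ => s).ext fun j => ?_
  refine Fin.cases ?_ (fun j => ?_) j
  · rw [rot_zero, Module.Basis.unitsSMul_apply, Units.smul_def, map_smul, rot_zero, smul_zero]
  · rw [rot_succ, Module.Basis.unitsSMul_apply, Module.Basis.unitsSMul_apply,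
      Module.Basis.unitsSMul_apply, Units.smul_def, Units.smul_def, Units.smul_def, map_smul,
      rot_succ, smul_sub]
    congr 1 <;> split_ifs <;> simp

/-- The elements `m(S)` of two frames that differ by a scale factor are proportional: the maps
`σ_i`, `σ_{ij}` agree. -/
theorem weylMap_unitsSMul (s : Rˣ) (hs : IsConfOrthonormal C (θ.unitsSMul fun _ => s))
    (p : Matrix (Fin 3) (Fin 3) R × Matrix (Fin 3) (Fin 3) R) :
    weylMap hC hs p = weylMap hC hθ' (((s : R) * s) • p) := by
  have h1 : ∀ b, sigmaBoost hC _ hs b = sigmaBoost hC θ hθ' b := fun b => by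
    refine CDerEnd.ext_basis (θ := θ) ?_ fun j => ?_
    · rw [sigmaBoost_fst, sigmaBoost_fst]
    · rw [sigmaBoost_apply, sigmaBoost_apply, boost_unitsSMul]
  have h2 : ∀ b, sigmaRot hC _ hs b = sigmaRot hC θ hθ' b := fun b => by
    refine CDerEnd.ext_basis (θ := θ) ?_ fun j => ?_
    · rw [sigmaRot_fst, sigmaRot_fst]
    · rw [sigmaRot_apply, sigmaRot_apply, rot_unitsSMul]
  have h3 : ∀ a, thetaRe (θ.unitsSMul fun _ => s) a = ((s : R) * s) • thetaRe θ a := fun a => by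
    simp only [thetaRe, Module.Basis.unitsSMul_apply, Units.smul_def, map_smul, smul_mul_assoc,
      mul_smul_comm, smul_smul]
  have h4 : ∀ a, thetaIm (θ.unitsSMul fun _ => s) a = ((s : R) * s) • thetaIm θ a := fun a => by
    simp only [thetaIm, Module.Basis.unitsSMul_apply, Units.smul_def, map_smul, smul_mul_assoc,
      mul_smul_comm, smul_smul]
  rw [map_smul, weylMap_apply, weylMap_apply, Finset.smul_sum]
  refine Finset.sum_congr rfl fun a _ => ?_
  rw [Finset.smul_sum]
  refine Finset.sum_congr rfl fun b _ => ?_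
  simp only [weylRe, weylIm, h1, h2, h3, h4, ← smul_neg, ← TensorProduct.smul_tmul']
  module

theorem weylSub_unitsSMul (s : Rˣ) (hs : IsConfOrthonormal C (θ.unitsSMul fun _ => s)) :
    weylSub hC hs = weylSub hC hθ' := by
  apply le_antisymm
  · rintro _ ⟨p, hp, rfl⟩
    exact ⟨_, Submodule.smul_mem _ _ hp, (weylMap_unitsSMul hC hθ' s hs p).symm⟩
  · rintro _ ⟨p, hp, rfl⟩
    refine ⟨((s⁻¹ : Rˣ) * (s⁻¹ : Rˣ) : R) • p, Submodule.smul_mem _ _ hp, ?_⟩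
    rw [weylMap_unitsSMul hC hθ' s hs, smul_smul]
    have : (s : R) * s * ((s⁻¹ : Rˣ) * (s⁻¹ : Rˣ)) = 1 := by
      rw [mul_mul_mul_comm, Units.mul_inv, one_mul]
    rw [this, one_smul]

variable (R) in
/-- The pair `(Re S, -Im S)`, with entries in `R`. -/
def reIm : Matrix (Fin 3) (Fin 3) ℂ →ₗ[ℝ]
    Matrix (Fin 3) (Fin 3) R × Matrix (Fin 3) (Fin 3) R where
  toFun S := (Matrix.of fun a b => algebraMap ℝ R (S a b).re,
    Matrix.of fun a b => algebraMap ℝ R (-(S a b).im))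
  map_add' S T := by
    refine Prod.ext ?_ ?_
    · ext a b; simp
    · ext a b; simp; ring
  map_smul' r S := by
    refine Prod.ext ?_ ?_
    · ext a b
      rw [RingHom.id_apply, Prod.smul_fst, Matrix.smul_apply]
      simp [Algebra.smul_def r (algebraMap ℝ R _)]
    · ext a b
      rw [RingHom.id_apply, Prod.smul_snd, Matrix.smul_apply]
      simp [Algebra.smul_def r (algebraMap ℝ R _)]

theorem weylElt_eq (S : Matrix (Fin 3) (Fin 3) ℂ) :
    weylElt hC θ hθ' S = weylMap hC hθ' (reIm R S) := by
  rw [weylElt, weylMap_apply]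
  refine Finset.sum_congr rfl fun a _ => Finset.sum_congr rfl fun b _ => ?_
  have h1 : (reIm R S).1 a b = algebraMap ℝ R (S a b).re := rfl
  have h2 : (reIm R S).2 a b = algebraMap ℝ R (-(S a b).im) := rfl
  rw [h1, h2, algebraMap_smul, algebraMap_smul, neg_smul, ← sub_eq_add_neg, weylRe, weylIm,
    TensorProduct.neg_tmul, ← sub_eq_add_neg, add_comm (thetaRe θ a ⊗ₜ[R] sigmaRot hC θ hθ' b)]

theorem reIm_mem {S : Matrix (Fin 3) (Fin 3) ℂ} (hS : S ∈ symTraceless) :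
    reIm R S ∈ (stfMat R).prod (stfMat R) := by
  obtain ⟨h1, h2⟩ := hS
  have h3 : ∀ i j, S j i = S i j := fun i j => h1.apply i j
  rw [Matrix.trace_fin_three] at h2
  have h4 := congrArg Complex.re h2
  have h5 := congrArg Complex.im h2
  simp only [Complex.add_re, Complex.add_im, Complex.zero_re, Complex.zero_im] at h4 h5
  constructor
  · refine mem_stfMat_iff.2 ⟨?_, ?_, ?_, ?_⟩
    · exact congrArg (fun z : ℂ => algebraMap ℝ R z.re) (h3 0 1)
    · exact congrArg (fun z : ℂ => algebraMap ℝ R z.re) (h3 0 2)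
    · exact congrArg (fun z : ℂ => algebraMap ℝ R z.re) (h3 1 2)
    · change algebraMap ℝ R _ = - algebraMap ℝ R _ - algebraMap ℝ R _
      rw [← map_neg, ← map_sub]
      congr 1
      linarith
  · refine mem_stfMat_iff.2 ⟨?_, ?_, ?_, ?_⟩
    · exact congrArg (fun z : ℂ => algebraMap ℝ R (-z.im)) (h3 0 1)
    · exact congrArg (fun z : ℂ => algebraMap ℝ R (-z.im)) (h3 0 2)
    · exact congrArg (fun z : ℂ => algebraMap ℝ R (-z.im)) (h3 1 2)
    · change algebraMap ℝ R _ = - algebraMap ℝ R _ - algebraMap ℝ R _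
      rw [← map_neg, ← map_sub]
      congr 1
      linarith

/-- The symmetric traceless matrices over `R` are spanned by real ones. -/
theorem stfMat_le_span : stfMat R ≤ Submodule.span R
    ((fun T : Matrix (Fin 3) (Fin 3) ℝ => T.map (algebraMap ℝ R)) '' (stfMat ℝ)) := by
  intro P hP
  obtain ⟨h1, h2, h3, h4⟩ := mem_stfMat_iff.1 hP
  have hs : P = P 0 0 • (!![1, 0, 0; 0, 0, 0; 0, 0, -1] : Matrix (Fin 3) (Fin 3) ℝ).map
        (algebraMap ℝ R) +
      P 1 1 • (!![0, 0, 0; 0, 1, 0; 0, 0, -1] : Matrix (Fin 3) (Fin 3) ℝ).map (algebraMap ℝ R) +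
      P 0 1 • (!![0, 1, 0; 1, 0, 0; 0, 0, 0] : Matrix (Fin 3) (Fin 3) ℝ).map (algebraMap ℝ R) +
      P 0 2 • (!![0, 0, 1; 0, 0, 0; 1, 0, 0] : Matrix (Fin 3) (Fin 3) ℝ).map (algebraMap ℝ R) +
      P 1 2 • (!![0, 0, 0; 0, 0, 1; 0, 1, 0] : Matrix (Fin 3) (Fin 3) ℝ).map (algebraMap ℝ R) := by
    ext i j
    fin_cases i <;> fin_cases j <;> simp [h1, h2, h3, h4]
    ring
  rw [hs]
  refine add_mem (add_mem (add_mem (add_mem ?_ ?_) ?_) ?_) ?_ <;>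
    refine Submodule.smul_mem _ _ (Submodule.subset_span ⟨_, mem_stfMat_iff.2 ?_, rfl⟩) <;>
    simp

theorem span_reIm {κ : Type*} (S : Module.Basis κ ℝ symTraceless) :
    Submodule.span R (Set.range fun a => reIm R (S a : Matrix (Fin 3) (Fin 3) ℂ)) =
      (stfMat R).prod (stfMat R) := by
  apply le_antisymm
  · rw [Submodule.span_le]
    rintro _ ⟨a, rfl⟩
    exact reIm_mem (S a).2
  · set N := Submodule.span R (Set.range fun a => reIm R (S a : Matrix (Fin 3) (Fin 3) ℂ))
    have hN : ∀ T ∈ symTraceless, reIm R T ∈ N := by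
      intro T hT
      have h : (⟨T, hT⟩ : symTraceless) ∈ Submodule.span ℝ (Set.range S) := by
        rw [S.span_eq]; trivial
      have h2 : (⟨T, hT⟩ : symTraceless) ∈
          (N.restrictScalars ℝ).comap (reIm R ∘ₗ symTraceless.subtype) := by
        refine Submodule.span_le.2 ?_ h
        rintro _ ⟨a, rfl⟩
        exact Submodule.subset_span ⟨a, rfl⟩
      exact h2
    have hr : ∀ T ∈ stfMat ℝ, (T.map (algebraMap ℝ R), 0) ∈ N ∧
        (0, T.map (algebraMap ℝ R)) ∈ N := by
      rintro T ⟨hT, hT'⟩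
      constructor
      · have := hN (T.map (fun x : ℝ => (x : ℂ))) ⟨?_, ?_⟩
        · convert this using 1
          refine Prod.ext ?_ ?_
          · ext a b; simp [reIm]
          · ext a b; simp [reIm]
        · exact hT.map _
        · rw [Matrix.trace_fin_three] at hT' ⊢
          simp only [Matrix.map_apply]
          exact_mod_cast congrArg (fun x : ℝ => (x : ℂ)) hT'
      · have := hN (T.map (fun x : ℝ => -(x : ℂ) * Complex.I)) ⟨?_, ?_⟩
        · convert this using 1
          refine Prod.ext ?_ ?_
          · ext a b; simp [reIm]
          · ext a b; simp [reIm]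
        · exact hT.map _
        · rw [Matrix.trace_fin_three] at hT' ⊢
          simp only [Matrix.map_apply]
          have := congrArg (fun x : ℝ => -(x : ℂ) * Complex.I) hT'
          push_cast at this
          rw [← add_mul, ← add_mul, ← neg_add, ← neg_add, this]
          simp
    rintro ⟨P, Q⟩ ⟨hP, hQ⟩
    have e1 : (P, (0 : Matrix (Fin 3) (Fin 3) R)) ∈ N := by
      have := stfMat_le_span hP
      refine (Submodule.span_le (p := N.comap (LinearMap.inl R _ _))).2 ?_ this
      rintro _ ⟨T, hT, rfl⟩
      exact (hr T hT).1
    have e2 : ((0 : Matrix (Fin 3) (Fin 3) R), Q) ∈ N := by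
      have := stfMat_le_span hQ
      refine (Submodule.span_le (p := N.comap (LinearMap.inr R _ _))).2 ?_ this
      rintro _ ⟨T, hT, rfl⟩
      exact (hr T hT).2
    simpa using add_mem e1 e2

/-- Over an algebra whose real characters separate points, a real basis of the symmetric traceless
complex matrices is linearly independent. -/
theorem linearIndependent_reIm (hR : ∀ r : R, (∀ φ : R →ₐ[ℝ] ℝ, φ r = 0) → r = 0) {κ : Type*}
    (S : Module.Basis κ ℝ symTraceless) :
    LinearIndependent R fun a => reIm R (S a : Matrix (Fin 3) (Fin 3) ℂ) := by
  rw [linearIndependent_iff']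
  intro s r hr a ha
  refine hR _ fun φ => ?_
  refine linearIndependent_iff'.1 S.linearIndependent s (fun a => φ (r a)) ?_ a ha
  apply Subtype.ext
  have h1 : ∀ i j, ∑ a ∈ s, φ (r a) * ((S a : Matrix (Fin 3) (Fin 3) ℂ) i j).re = 0 := by
    intro i j
    have := congrArg (fun p : Matrix (Fin 3) (Fin 3) R × Matrix (Fin 3) (Fin 3) R =>
      φ (p.1 i j)) hr
    simpa [Prod.fst_sum, Matrix.sum_apply, reIm] using this
  have h2 : ∀ i j, ∑ a ∈ s, φ (r a) * ((S a : Matrix (Fin 3) (Fin 3) ℂ) i j).im = 0 := by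
    intro i j
    have := congrArg (fun p : Matrix (Fin 3) (Fin 3) R × Matrix (Fin 3) (Fin 3) R =>
      φ (p.2 i j)) hr
    simpa [Prod.snd_sum, Matrix.sum_apply, reIm] using this
  ext i j
  rw [AddSubmonoidClass.coe_finsetSum, Matrix.sum_apply]
  apply Complex.ext
  · rw [Complex.re_sum]
    simpa using h1 i j
  · rw [Complex.im_sum]
    simpa using h2 i j

theorem linearIndependent_weylElt (hR : ∀ r : R, (∀ φ : R →ₐ[ℝ] ℝ, φ r = 0) → r = 0)
    {κ : Type*} (S : Module.Basis κ ℝ symTraceless) :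
    LinearIndependent R fun a => weylElt hC θ hθ' (S a) := by
  obtain ⟨g', hg', hθ⟩ := id hθ'
  have h := (linearIndependent_reIm hR S).map' (weylMap hC hθ')
    (LinearMap.ker_eq_bot.2 (weylMap_injective hC hθ' hθ))
  have h0 : (fun a => weylElt hC θ hθ' (S a)) =
      weylMap hC hθ' ∘ fun a => reIm R (S a : Matrix (Fin 3) (Fin 3) ℂ) :=
    funext fun a => weylElt_eq hC hθ' _
  rwa [h0]

theorem span_weylElt {κ : Type*} (S : Module.Basis κ ℝ symTraceless) :
    Submodule.span R (Set.range fun a => weylElt hC θ hθ' (S a)) = weylSub hC hθ' := by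
  rw [weylSub, ← span_reIm S, Submodule.map_span, ← Set.range_comp]
  congr 2
  exact funext fun a => weylElt_eq hC hθ' _

end WeylBasis

/-! ### Light cones -/

section Lorentz

/-- The Lorentz form on `ℝ⁴`. -/
def lor (x y : Fin 4 → ℝ) : ℝ := -(x 0 * y 0) + (x 1 * y 1 + x 2 * y 2 + x 3 * y 3)

/-- Two timelike vectors lie in the same half of the light cone if their product is negative. -/
theorem lor_neg_iff {x y : Fin 4 → ℝ} (hx : lor x x < 0) (hy : lor y y < 0) :
    lor x y ≠ 0 ∧ (lor x y < 0 ↔ (0 < x 0 ↔ 0 < y 0)) := by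
  unfold lor at *
  set s := x 1 * y 1 + x 2 * y 2 + x 3 * y 3 with hs
  -- the Cauchy-Schwarz inequality for the spatial parts
  have h1 : s ^ 2 ≤ (x 1 * x 1 + x 2 * x 2 + x 3 * x 3) * (y 1 * y 1 + y 2 * y 2 + y 3 * y 3) := by
    nlinarith [sq_nonneg (x 1 * y 2 - x 2 * y 1), sq_nonneg (x 1 * y 3 - x 3 * y 1),
      sq_nonneg (x 2 * y 3 - x 3 * y 2)]
  have h2 : (x 1 * x 1 + x 2 * x 2 + x 3 * x 3) * (y 1 * y 1 + y 2 * y 2 + y 3 * y 3) <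
      (x 0 * x 0) * (y 0 * y 0) :=
    mul_lt_mul'' (by linarith) (by linarith)
      (add_nonneg (add_nonneg (mul_self_nonneg _) (mul_self_nonneg _)) (mul_self_nonneg _))
      (add_nonneg (add_nonneg (mul_self_nonneg _) (mul_self_nonneg _)) (mul_self_nonneg _))
  have h3 : |s| < |x 0 * y 0| := by
    rw [← sq_lt_sq]
    nlinarith
  have hx0 : x 0 ≠ 0 := by
    intro h
    rw [h] at hx
    nlinarith [sq_nonneg (x 1), sq_nonneg (x 2), sq_nonneg (x 3)]
  have hy0 : y 0 ≠ 0 := by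
    intro h
    rw [h] at hy
    nlinarith [sq_nonneg (y 1), sq_nonneg (y 2), sq_nonneg (y 3)]
  obtain ⟨h4, h5⟩ := abs_lt.1 h3
  rcases lt_or_gt_of_ne hx0 with hx1 | hx1 <;> rcases lt_or_gt_of_ne hy0 with hy1 | hy1
  · have h6 := mul_pos_of_neg_of_neg hx1 hy1
    rw [abs_of_pos h6] at h4 h5
    exact ⟨by linarith, by simp only [hx1.not_gt, hy1.not_gt, iff_self, iff_true]; linarith⟩
  · have h6 := mul_neg_of_neg_of_pos hx1 hy1
    rw [abs_of_neg h6] at h4 h5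
    refine ⟨by linarith, ?_⟩
    simp only [hx1.not_gt, hy1, iff_true, iff_false, not_lt]
    linarith
  · have h6 := mul_neg_of_pos_of_neg hx1 hy1
    rw [abs_of_neg h6] at h4 h5
    refine ⟨by linarith, ?_⟩
    simp only [hx1, hy1.not_gt, iff_false, not_lt, not_true_eq_false]
    linarith
  · have h6 := mul_pos hx1 hy1
    rw [abs_of_pos h6] at h4 h5
    exact ⟨by linarith, by simp only [hx1, hy1, iff_true]; linarith⟩

/-- A nonzero vector orthogonal to a timelike vector is spacelike. -/
theorem lor_pos_of_orthogonal {x v : Fin 4 → ℝ} (hv : lor v v < 0) (h : lor x v = 0) (hx : x ≠ 0) :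
    0 < lor x x := by
  by_contra! hx'
  apply hx
  unfold lor at *
  set s := x 1 * v 1 + x 2 * v 2 + x 3 * v 3 with hs
  have h1 : s ^ 2 ≤ (x 1 * x 1 + x 2 * x 2 + x 3 * x 3) * (v 1 * v 1 + v 2 * v 2 + v 3 * v 3) := by
    nlinarith [sq_nonneg (x 1 * v 2 - x 2 * v 1), sq_nonneg (x 1 * v 3 - x 3 * v 1),
      sq_nonneg (x 2 * v 3 - x 3 * v 2)]
  have h2 : (x 1 * x 1 + x 2 * x 2 + x 3 * x 3) * (v 1 * v 1 + v 2 * v 2 + v 3 * v 3) ≤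
      (x 0 * x 0) * (v 1 * v 1 + v 2 * v 2 + v 3 * v 3) :=
    mul_le_mul_of_nonneg_right (by linarith)
      (add_nonneg (add_nonneg (mul_self_nonneg _) (mul_self_nonneg _)) (mul_self_nonneg _))
  have h3 : s = x 0 * v 0 := by linarith
  have h4 : (x 0 * x 0) * (v 0 * v 0 - (v 1 * v 1 + v 2 * v 2 + v 3 * v 3)) ≤ 0 := by
    rw [h3] at h1
    nlinarith
  have h5 : x 0 = 0 := by
    by_contra h0
    have h6 : 0 < x 0 * x 0 := mul_self_pos.2 h0
    nlinarith
  rw [h5] at hx'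
  have h6 : x 1 = 0 := by nlinarith [sq_nonneg (x 1), sq_nonneg (x 2), sq_nonneg (x 3)]
  have h7 : x 2 = 0 := by nlinarith [sq_nonneg (x 1), sq_nonneg (x 2), sq_nonneg (x 3)]
  have h8 : x 3 = 0 := by nlinarith [sq_nonneg (x 1), sq_nonneg (x 2), sq_nonneg (x 3)]
  ext i
  fin_cases i
  · exact h5
  · exact h6
  · exact h7
  · exact h8

/-- A bilinear form on `ℝ⁴` of signature `-+++`. -/
def IsLorentz (B : LinearMap.BilinForm ℝ (Fin 4 → ℝ)) : Prop :=
  ∃ L : (Fin 4 → ℝ) →ₗ[ℝ] (Fin 4 → ℝ), Function.Injective L ∧ ∀ x y, B x y = lor (L x) (L y)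

variable {B : LinearMap.BilinForm ℝ (Fin 4 → ℝ)}

/-- The sign `1` if two timelike vectors lie in the same half of the light cone, and `-1`
otherwise. -/
def coneSign (B : LinearMap.BilinForm ℝ (Fin 4 → ℝ)) (x y : Fin 4 → ℝ) : ℤˣ :=
  if B x y < 0 then 1 else -1

theorem IsLorentz.apply_ne_zero (hB : IsLorentz B) {x y : Fin 4 → ℝ} (hx : B x x < 0)
    (hy : B y y < 0) : B x y ≠ 0 := by
  obtain ⟨L, -, h⟩ := hB
  rw [h] at hx hy ⊢
  exact (lor_neg_iff hx hy).1

theorem IsLorentz.coneSign_mul (hB : IsLorentz B) {x y z : Fin 4 → ℝ} (hx : B x x < 0)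
    (hy : B y y < 0) (hz : B z z < 0) : coneSign B y z * coneSign B x y = coneSign B x z := by
  obtain ⟨L, -, h⟩ := hB
  rw [h] at hx hy hz
  unfold coneSign
  simp only [h, (lor_neg_iff hy hz).2, (lor_neg_iff hx hy).2, (lor_neg_iff hx hz).2]
  by_cases h1 : 0 < L x 0 <;> by_cases h2 : 0 < L y 0 <;> by_cases h3 : 0 < L z 0 <;>
    simp [h1, h2, h3]

theorem IsLorentz.pos_of_orthogonal (hB : IsLorentz B) {x v : Fin 4 → ℝ} (hv : B v v < 0)
    (h : B x v = 0) (hx : x ≠ 0) : 0 < B x x := by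
  obtain ⟨L, hL, h'⟩ := hB
  rw [h'] at hv h ⊢
  exact lor_pos_of_orthogonal hv h fun h0 => hx (hL (h0.trans (map_zero L).symm))

end Lorentz

/-! ### Sections of double coverings -/

section Covering

open FiberBundleCore in
/-- A cocycle of signs on a simply connected space is a coboundary: it defines a double covering,
which has a section. -/
theorem exists_sign_section {M ι : Type*} [TopologicalSpace M] [SimplyConnectedSpace M]
    [LocallyPathConnectedSpace M] (U : ι → Set M) (hU : ∀ i, IsOpen (U i))
    (hcov : ∀ p, ∃ i, p ∈ U i) (s : ι → ι → M → ℤˣ)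
    (hs : ∀ i j, ContinuousOn (s i j) (U i ∩ U j)) (h1 : ∀ i, ∀ p ∈ U i, s i i p = 1)
    (hc : ∀ i j k, ∀ p ∈ U i ∩ U j ∩ U k, s j k p * s i j p = s i k p) :
    ∃ σ : ι → M → ℤˣ, (∀ i, ContinuousOn (σ i) (U i)) ∧
      ∀ i j, ∀ p ∈ U i ∩ U j, σ j p = s i j p * σ i p := by
  choose idx hidx using hcov
  let Z : FiberBundleCore ι M ℤˣ :=
    { baseSet := U
      isOpen_baseSet := hU
      indexAt := idx
      mem_baseSet_at := hidx
      coordChange := fun i j p v => s i j p * v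
      coordChange_self := fun i p hp v => by rw [h1 i p hp, one_mul]
      continuousOn_coordChange := fun i j =>
        ((hs i j).comp continuousOn_fst fun x hx => hx.1).mul continuousOn_snd
      coordChange_comp := fun i j k p hp v => by rw [← mul_assoc, hc i j k p hp] }
  have hcov : IsCoveringMap Z.proj :=
    IsCoveringMap.mk _ (fun _ => ℤˣ) (fun p => Z.localTriv (idx p)) hidx
  obtain ⟨p₀⟩ : Nonempty M := inferInstance
  obtain ⟨F, ⟨-, hF⟩, -⟩ := hcov.existsUnique_continuousMap_lifts (ContinuousMap.id M) p₀
    (⟨p₀, (1 : ℤˣ)⟩ : Z.TotalSpace) rfl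
  have hF' : ∀ p, (F p).1 = p := fun p => congrFun hF p
  refine ⟨fun i p => (Z.localTriv i (F p)).2, fun i => ?_, fun i j p hp => ?_⟩
  · refine continuous_snd.comp_continuousOn
      ((Z.localTriv i).continuousOn_toFun.comp F.continuous.continuousOn fun p hp => ?_)
    change (F p).1 ∈ U i
    rwa [hF']
  · have h : ∀ v : ℤˣ, s (idx (F p).1) j (F p).1 * v =
        s i j p * (s (idx (F p).1) i (F p).1 * v) := fun v => by
      rw [hF' p, ← mul_assoc, hc _ i j p ⟨⟨hidx p, hp.1⟩, hp.2⟩]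
    exact h (F p).2

end Covering

/-! ### The Gram-Schmidt process -/

section GramSchmidt

variable {R W : Type*} [CommRing R] [AddCommGroup W] [Module R W]

/-- The Gram-Schmidt process over a commutative ring: it requires that the squares of the vectors
which it has to normalize have inverse square roots. -/
theorem exists_orthonormal {g : LinearMap.BilinForm R W} (hg : ∀ x y, g x y = g y x) (f : ℕ → W)
    (n : ℕ) (hf : ∀ k < n, ∀ x ∈ Submodule.span R (f '' Set.Iio k),
      ∃ s : R, s * s * g (f k + x) (f k + x) = 1) :
    ∃ θ : ℕ → W, (∀ i < n, θ i ∈ Submodule.span R (f '' Set.Iio n)) ∧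
      ∀ i < n, ∀ j < n, g (θ i) (θ j) = if i = j then 1 else 0 := by
  induction n with
  | zero => exact ⟨0, by simp, by simp⟩
  | succ n ih =>
    obtain ⟨θ, h1, h2⟩ := ih fun k hk => hf k (hk.trans n.lt_succ_self)
    set x : W := -∑ i ∈ Finset.range n, g (f n) (θ i) • θ i with hx
    have hxm : x ∈ Submodule.span R (f '' Set.Iio n) :=
      neg_mem (sum_mem fun i hi => Submodule.smul_mem _ _ (h1 i (Finset.mem_range.1 hi)))
    obtain ⟨s, hs⟩ := hf n n.lt_succ_self x hxm
    have ho : ∀ i < n, g (f n + x) (θ i) = 0 := by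
      intro i hi
      have : ∀ j ∈ Finset.range n, g (f n) (θ j) * g (θ j) (θ i) =
          if j = i then g (f n) (θ i) else 0 := by
        intro j hj
        rw [h2 j (Finset.mem_range.1 hj) i hi]
        split_ifs with h
        · rw [h, mul_one]
        · rw [mul_zero]
      rw [hx, map_add, map_neg, LinearMap.add_apply, LinearMap.neg_apply, map_sum,
        LinearMap.sum_apply]
      simp only [map_smul, LinearMap.smul_apply, smul_eq_mul]
      rw [Finset.sum_congr rfl this, Finset.sum_ite_eq', if_pos (Finset.mem_range.2 hi),
        add_neg_cancel]
    have hm : Submodule.span R (f '' Set.Iio n) ≤ Submodule.span R (f '' Set.Iio (n + 1)) :=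
      Submodule.span_mono (Set.image_mono (Set.Iio_subset_Iio n.le_succ))
    refine ⟨Function.update θ n (s • (f n + x)), fun i hi => ?_, fun i hi j hj => ?_⟩
    · rcases Nat.lt_succ_iff_lt_or_eq.1 hi with h | rfl
      · rw [Function.update_of_ne h.ne]
        exact hm (h1 i h)
      · rw [Function.update_self]
        exact Submodule.smul_mem _ _ (add_mem (Submodule.subset_span
          ⟨i, Set.mem_Iio.2 i.lt_succ_self, rfl⟩) (hm hxm))
    · rcases Nat.lt_succ_iff_lt_or_eq.1 hi with h | rfl <;>
        rcases Nat.lt_succ_iff_lt_or_eq.1 hj with h' | rfl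
      · rw [Function.update_of_ne h.ne, Function.update_of_ne h'.ne]
        exact h2 i h j h'
      · rw [Function.update_of_ne h.ne, Function.update_self, if_neg h.ne, map_smul, hg, ho i h,
          smul_zero]
      · rw [Function.update_of_ne h'.ne, Function.update_self, if_neg h'.ne', map_smul,
          LinearMap.smul_apply, ho j h', smul_zero]
      · rw [Function.update_self, if_pos rfl, map_smul, map_smul, LinearMap.smul_apply, smul_eq_mul,
          smul_eq_mul, ← mul_assoc, hs]

end GramSchmidt

/-! ### Global orthonormal frames -/

section Pointwise

theorem isLorentz_of_frame {B : LinearMap.BilinForm ℝ (Fin 4 → ℝ)} (e : Fin 4 → Fin 4 → ℝ)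
    (h : ∀ i j, B (e i) (e j) = eta i j) : IsLorentz B := by
  have hi : LinearIndependent ℝ e := by
    rw [Fintype.linearIndependent_iff]
    intro c hc j
    have h1 := congrArg (fun x => B x (e j)) hc
    simp only [map_sum, map_smul, LinearMap.sum_apply, LinearMap.smul_apply, h, smul_eq_mul,
      map_zero, LinearMap.zero_apply, eta, Matrix.diagonal_apply, mul_ite, mul_zero,
      Finset.sum_ite_eq', Finset.mem_univ, if_true] at h1
    fin_cases j <;> simpa using h1
  let a : Module.Basis (Fin 4) ℝ (Fin 4 → ℝ) :=
    basisOfLinearIndependentOfCardEqFinrank hi (by simp)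
  have ha : ⇑a = e := coe_basisOfLinearIndependentOfCardEqFinrank hi _
  refine ⟨a.equivFun.toLinearMap, a.equivFun.injective, fun x y => ?_⟩
  conv_lhs => rw [← a.sum_equivFun x, ← a.sum_equivFun y]
  simp only [ha, Fin.sum_univ_four, map_add, map_smul, LinearMap.add_apply, LinearMap.smul_apply, h,
    smul_eq_mul, lor, LinearEquiv.coe_coe]
  simp [eta]
  ring

theorem IsLorentz.exists_timelike {B : LinearMap.BilinForm ℝ (Fin 4 → ℝ)} (hB : IsLorentz B) :
    ∃ x, B x x < 0 := by
  obtain ⟨L, hL, h⟩ := hB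
  obtain ⟨x, hx⟩ := LinearMap.injective_iff_surjective.1 hL (Pi.single 0 1)
  exact ⟨x, by rw [h, hx]; simp [lor]⟩

theorem IsLorentz.symm {B : LinearMap.BilinForm ℝ (Fin 4 → ℝ)} (hB : IsLorentz B)
    (x y : Fin 4 → ℝ) : B x y = B y x := by
  obtain ⟨L, -, h⟩ := hB
  rw [h, h, lor, lor]
  ring

end Pointwise

section Manifold

variable {M : Type*} [TopologicalSpace M] [ChartedSpace (EuclideanSpace ℝ (Fin 4)) M]

/-- A time orientation exists on a simply connected manifold; convexity of the half cones and a
partition of unity then give a global timelike vector field. -/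
theorem exists_timelike_field [IsManifold (𝓡 4) ∞ M]
    (hM : Nonempty (M ≃ₘ⟮𝓡 4, 𝓡 4⟯ EuclideanSpace ℝ (Fin 4)))
    {B : M → LinearMap.BilinForm ℝ (Fin 4 → ℝ)} (hB : ∀ p, IsLorentz (B p))
    (hc : ∀ x y, Continuous fun p => B p x y) :
    ∃ v : C^∞⟮𝓡 4, M; 𝓘(ℝ, Fin 4 → ℝ), Fin 4 → ℝ⟯, ∀ p, B p (v p) (v p) < 0 := by
  obtain ⟨Φ⟩ := hM
  let φ : M ≃ₜ EuclideanSpace ℝ (Fin 4) := Φ.toHomeomorph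
  have : T2Space M := φ.isEmbedding.t2Space
  have : SigmaCompactSpace M := φ.isClosedEmbedding.sigmaCompactSpace
  have : ContractibleSpace M := φ.contractibleSpace
  have : LocallyPathConnectedSpace M := φ.isOpenEmbedding.locallyPathConnectedSpace
  let U : (Fin 4 → ℝ) → Set M := fun x => {p | B p x x < 0}
  have hU : ∀ x, IsOpen (U x) := fun x => isOpen_lt (hc x x) continuous_const
  obtain ⟨σ, hσ, hσ'⟩ := exists_sign_section U hU (fun p => (hB p).exists_timelike)
    (fun x y p => coneSign (B p) x y)
    (fun x y p hp => by
      -- the sign is locally constant since the product does not vanish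
      refine ContinuousAt.continuousWithinAt ?_
      rcases lt_or_gt_of_ne ((hB p).apply_ne_zero hp.1 hp.2) with h | h
      · refine (continuousAt_const (y := (1 : ℤˣ))).congr ?_
        filter_upwards [(isOpen_lt (hc x y) continuous_const).mem_nhds h] with p' hp'
        exact (if_pos hp').symm
      · refine (continuousAt_const (y := (-1 : ℤˣ))).congr ?_
        filter_upwards [(isOpen_lt continuous_const (hc x y)).mem_nhds h] with p' hp'
        exact (if_neg (not_lt.2 (le_of_lt hp'))).symm)
    (fun x p hp => if_pos hp)
    (fun x y z p hp => (hB p).coneSign_mul hp.1.1 hp.1.2 hp.2)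
  refine (exists_contMDiffMap_forall_mem_convex_of_local_const (𝓡 4)
    (t := fun p => {x | B p x x < 0 ∧ σ x p = 1}) ?_ ?_).imp fun v hv p => (hv p).1
  · rintro p x ⟨hx, hx'⟩ y ⟨hy, hy'⟩ a b ha hb hab
    have h1 : B p x y < 0 := by
      have := hσ' x y p ⟨hx, hy⟩
      rw [hx', hy', mul_one] at this
      by_contra h
      rw [coneSign, if_neg h] at this
      exact absurd this (by decide)
    have h2 : B p (a • x + b • y) (a • x + b • y) =
        a * a * B p x x + 2 * (a * b) * B p x y + b * b * B p y y := by
      simp only [map_add, map_smul, LinearMap.add_apply, LinearMap.smul_apply, smul_eq_mul,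
        (hB p).symm y x]
      ring
    have h3 : B p x (a • x + b • y) = a * B p x x + b * B p x y := by
      simp only [map_add, map_smul, smul_eq_mul]
    have h4 : B p x (a • x + b • y) < 0 := by
      rw [h3]
      rcases ha.eq_or_lt with rfl | ha
      · rw [zero_add] at hab
        rw [hab]
        linarith
      · nlinarith [mul_neg_of_pos_of_neg ha hx, mul_nonneg hb (neg_nonneg.2 h1.le)]
    have h5 : B p (a • x + b • y) (a • x + b • y) < 0 := by
      rw [h2]
      have e1 : a * b * B p x y ≤ 0 := mul_nonpos_of_nonneg_of_nonpos (mul_nonneg ha hb) h1.le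
      rcases ha.eq_or_lt with rfl | ha
      · rw [zero_add] at hab
        rw [hab]
        linarith
      · have e2 := mul_neg_of_pos_of_neg (mul_pos ha ha) hx
        have e3 : b * b * B p y y ≤ 0 := mul_nonpos_of_nonneg_of_nonpos (mul_self_nonneg b) hy.le
        linarith
    refine ⟨h5, ?_⟩
    rw [hσ' x _ p ⟨hx, h5⟩, hx', mul_one]
    exact if_pos h4
  · intro p
    have key : ∀ x, B p x x < 0 → σ x p = 1 → ∀ᶠ q in nhds p, x ∈ {x | B q x x < 0 ∧ σ x q = 1} := by
      intro x hx hx'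
      have h1 := ((hσ x).continuousAt ((hU x).mem_nhds hx)).eventually
        ((isOpen_discrete ({1} : Set ℤˣ)).mem_nhds hx')
      filter_upwards [(hU x).mem_nhds hx, h1] with q h2 h3
      exact ⟨h2, h3⟩
    obtain ⟨x, hx⟩ := (hB p).exists_timelike
    rcases Int.units_eq_one_or (σ x p) with h | h
    · exact ⟨x, key x hx h⟩
    · have hn : B p (-x) (-x) < 0 := by simpa using hx
      refine ⟨-x, key _ hn ?_⟩
      rw [hσ' x (-x) p ⟨hx, hn⟩, h, coneSign, if_neg (by simpa using hx.le)]
      rfl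

/-- A positive smooth function has a smooth inverse square root. -/
theorem exists_inv_sqrt {r : Cinf M} (hr : ∀ p, 0 < r p) : ∃ s : Cinf M, s * s * r = 1 := by
  refine ⟨⟨fun p => (Real.sqrt (r p))⁻¹, fun p => ?_⟩, ?_⟩
  · have h : ContDiffAt ℝ ∞ (fun x : ℝ => (Real.sqrt x)⁻¹) (r p) :=
      (Real.contDiffAt_sqrt (hr p).ne').inv (Real.sqrt_pos.2 (hr p)).ne'
    exact h.contMDiffAt.comp p r.contMDiff.contMDiffAt
  · ext p
    change (Real.sqrt (r p))⁻¹ * (Real.sqrt (r p))⁻¹ * r p = 1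
    rw [← mul_inv, Real.mul_self_sqrt (hr p).le, inv_mul_cancel₀ (hr p).ne']

/-- The evaluation of smooth functions at a point. -/
def evalHom (p : M) : Cinf M →ₐ[ℝ] ℝ :=
  { ContMDiffMap.evalRingHom p with commutes' := fun _ => rfl }

theorem evalHom_apply (p : M) (r : Cinf M) : evalHom p r = r p := rfl

variable {W : Type*} [AddCommGroup W] [Module (Cinf M) W]

/-- The bilinear form on `ℝ⁴` which represents `g` at `p` in a basis. -/
def formAt (g : LinearMap.BilinForm (Cinf M) W) (b : Module.Basis (Fin 4) (Cinf M) W) (p : M) :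
    LinearMap.BilinForm ℝ (Fin 4 → ℝ) :=
  Matrix.toBilin' (Matrix.of fun i j => g (b i) (b j) p)

theorem formAt_repr (g : LinearMap.BilinForm (Cinf M) W) (b : Module.Basis (Fin 4) (Cinf M) W)
    (p : M) (x y : W) :
    formAt g b p (fun i => b.repr x i p) (fun i => b.repr y i p) = g x y p := by
  conv_rhs => rw [← b.sum_repr x, ← b.sum_repr y]
  rw [formAt, Matrix.toBilin'_apply, ← evalHom_apply p (g _ _)]
  simp only [map_sum, LinearMap.sum_apply, map_smul, LinearMap.smul_apply, smul_eq_mul, map_mul,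
    Matrix.of_apply, evalHom_apply]
  rw [Finset.sum_comm]
  refine Finset.sum_congr rfl fun i _ => ?_
  rw [Finset.mul_sum]
  exact Finset.sum_congr rfl fun j _ => by ring

theorem formAt_isLorentz {g : LinearMap.BilinForm (Cinf M) W}
    (b : Module.Basis (Fin 4) (Cinf M) W) {p : M}
    (h : ∃ e : Fin 4 → W, ∀ i j, (g (e i) (e j)) p = eta i j) : IsLorentz (formAt g b p) := by
  obtain ⟨e, he⟩ := h
  exact isLorentz_of_frame (fun i k => b.repr (e i) k p) fun i j => by rw [formAt_repr, he]

end Manifold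

section Frame

variable {R W : Type*} [CommRing R] [Algebra ℝ R] [AddCommGroup W] [Module R W]

/-- An orthonormal family of four vectors is a basis. -/
theorem exists_basis_of_orthonormal (g : LinearMap.BilinForm R W) (b : Module.Basis (Fin 4) R W)
    (T : Fin 4 → W) (h : ∀ i j, g (T i) (T j) = algebraMap ℝ R (eta i j)) :
    ∃ θ : Module.Basis (Fin 4) R W, ⇑θ = T := by
  have h1 : (b.toMatrix T).transpose * (Matrix.of fun i j => g (b i) (b j)) * b.toMatrix T =
      eta.map (algebraMap ℝ R) := by
    ext i j
    rw [Matrix.map_apply, ← h]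
    conv_rhs => rw [← b.sum_repr (T i), ← b.sum_repr (T j)]
    simp only [Matrix.mul_apply, Matrix.transpose_apply, Matrix.of_apply, Module.Basis.toMatrix_apply,
      map_sum, LinearMap.sum_apply, map_smul, LinearMap.smul_apply, smul_eq_mul, Finset.sum_mul]
    refine Finset.sum_congr rfl fun k _ => ?_
    rw [Finset.mul_sum]
    exact Finset.sum_congr rfl fun l _ => by ring
  have h2 := congrArg Matrix.det h1
  have h3 : (eta.map (algebraMap ℝ R)).det = -1 := by
    have := (algebraMap ℝ R).map_det eta
    rw [RingHom.mapMatrix_apply] at this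
    rw [← this, eta, Matrix.det_diagonal]
    simp [Fin.prod_univ_four]
  rw [Matrix.det_mul, h3] at h2
  have h4 : IsUnit (b.det T) := by
    rw [Module.Basis.det_apply]
    refine IsUnit.of_mul_eq_one (-(Matrix.det ((b.toMatrix T).transpose *
      (Matrix.of fun i j => g (b i) (b j))))) ?_
    rw [mul_neg, mul_comm, h2, neg_neg]
  obtain ⟨h5, h6⟩ := (Module.Basis.is_basis_iff_det b).2 h4
  exact ⟨Module.Basis.mk h5 h6.ge, Module.Basis.coe_mk _ _⟩

/-- The rows are `v`, `iv`, `jv`, `kv` for the quaternion `v = v₀ + v₁ i + v₂ j + v₃ k`; they are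
orthogonal with the same Euclidean norm. -/
def quatRows (v : Fin 4 → R) : Matrix (Fin 4) (Fin 4) R :=
  !![v 0, v 1, v 2, v 3; -v 1, v 0, -v 3, v 2; -v 2, v 3, v 0, -v 1; -v 3, -v 2, v 1, v 0]

theorem quatRows_mul_transpose (v : Fin 4 → R) (i j : Fin 4) :
    ∑ k, quatRows v i k * quatRows v j k = if i = j then ∑ k, v k * v k else 0 := by
  fin_cases i <;> fin_cases j <;> simp [quatRows, Fin.sum_univ_four] <;> ring

end Frame

section Existence

variable {M : Type*} [TopologicalSpace M] [ChartedSpace (EuclideanSpace ℝ (Fin 4)) M]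
  {W : Type*} [AddCommGroup W] [Module (Cinf M) W]

/-- On a manifold diffeomorphic to `ℝ⁴`, a smooth inner product of signature `-+++` on a trivial
bundle has a global orthonormal frame: a timelike vector field `v` extends to the frame
`v, iv, jv, kv`, to which the Gram-Schmidt process is applied. -/
theorem exists_isON [IsManifold (𝓡 4) ∞ M]
    (hM : Nonempty (M ≃ₘ⟮𝓡 4, 𝓡 4⟯ EuclideanSpace ℝ (Fin 4)))
    (b : Module.Basis (Fin 4) (Cinf M) W) {g : LinearMap.BilinForm (Cinf M) W}
    (hsymm : ∀ x y, g x y = g y x)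
    (hsign : ∀ p : M, ∃ e : Fin 4 → W, ∀ i j, (g (e i) (e j)) p = eta i j) :
    ∃ θ : Module.Basis (Fin 4) (Cinf M) W, IsON g θ := by
  have hL : ∀ p, IsLorentz (formAt g b p) := fun p => formAt_isLorentz b (hsign p)
  obtain ⟨v, hv⟩ := exists_timelike_field hM hL fun x y => by
    simp only [formAt, Matrix.toBilin'_apply, Matrix.of_apply]
    exact continuous_finsetSum _ fun i _ => continuous_finsetSum _ fun j _ =>
      (continuous_const.mul (g (b i) (b j)).contMDiff.continuous).mul continuous_const
  let v' : Fin 4 → Cinf M := fun i => ⟨fun p => v p i,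
    ((ContinuousLinearMap.proj (R := ℝ) (φ := fun _ : Fin 4 => ℝ) i).contMDiff).comp v.contMDiff⟩
  let N : Fin 4 → W := fun k => ∑ i, quatRows v' k i • b i
  have hN : ∀ k i, b.repr (N k) i = quatRows v' k i := fun k i => by
    simp [N, Finsupp.single_apply]
  -- the Euclidean product with `N k`, used to see that no combination of the vectors `f` vanishes
  -- at a point
  let ℓ : Fin 4 → W →ₗ[Cinf M] Cinf M := fun k => ∑ i, quatRows v' k i • b.coord i
  have hℓ : ∀ k w, ℓ k w = ∑ i, quatRows v' k i * b.repr w i := fun k w => by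
    simp [ℓ, LinearMap.sum_apply]
  have hℓN : ∀ k j, ℓ k (N j) = if k = j then ∑ i, v' i * v' i else 0 := fun k j => by
    simp only [hℓ, hN, quatRows_mul_transpose]
  have hN0 : ∀ p, (fun i => b.repr (N 0) i p) = v p := fun p => by
    funext i
    rw [hN]
    fin_cases i <;> rfl
  have hV : ∀ p, g (N 0) (N 0) p < 0 := fun p => by
    rw [← formAt_repr g b, hN0]
    exact hv p
  obtain ⟨s, hs⟩ := exists_inv_sqrt (r := -g (N 0) (N 0)) fun p => neg_pos.2 (hV p)
  -- the projections of `iv`, `jv`, `kv` to the orthogonal complement of `v`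
  let f : ℕ → W := fun k => N (Fin.ofNat 4 (k + 1)) +
    (s * s * g (N (Fin.ofNat 4 (k + 1))) (N 0)) • N 0
  have hf0 : ∀ k, g (f k) (N 0) = 0 := fun k => by
    simp only [f, map_add, LinearMap.add_apply, map_smul, LinearMap.smul_apply, smul_eq_mul]
    linear_combination g (N (Fin.ofNat 4 (k + 1))) (N 0) * (-hs)
  have hspan : ∀ A : Set ℕ, ∀ x ∈ Submodule.span (Cinf M) (f '' A), g x (N 0) = 0 := by
    intro A x hx
    have : Submodule.span (Cinf M) (f '' A) ≤ LinearMap.ker (g.flip (N 0)) := by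
      rw [Submodule.span_le]
      rintro _ ⟨k, -, rfl⟩
      exact hf0 k
    exact this hx
  obtain ⟨θ, h1, h2⟩ := exists_orthonormal hsymm f 3 (by
    intro k hk x hx
    refine exists_inv_sqrt fun p => ?_
    have e1 : g (f k + x) (N 0) = 0 := by
      rw [map_add, LinearMap.add_apply, hf0, hspan _ x hx, add_zero]
    have e2 : ℓ (Fin.ofNat 4 (k + 1)) x = 0 := by
      have : Submodule.span (Cinf M) (f '' Set.Iio k) ≤ LinearMap.ker (ℓ (Fin.ofNat 4 (k + 1))) := by
        rw [Submodule.span_le]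
        rintro _ ⟨j, hj, rfl⟩
        change ℓ _ (f j) = 0
        have hj' : j < k := hj
        simp only [f, map_add, map_smul, hℓN]
        rw [if_neg, if_neg, smul_zero, add_zero]
        · interval_cases k <;> decide
        · interval_cases k <;> interval_cases j <;> decide
      exact this hx
    have e3 : ℓ (Fin.ofNat 4 (k + 1)) (f k + x) = ∑ i, v' i * v' i := by
      rw [map_add, e2, add_zero]
      simp only [f, map_add, map_smul, hℓN]
      rw [if_true, if_neg, smul_zero, add_zero]
      interval_cases k <;> decide
    rw [← formAt_repr g b]
    refine (hL p).pos_of_orthogonal (hv p) ?_ ?_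
    · rw [← hN0, formAt_repr, e1]
      rfl
    · intro h0
      have e4 := congrArg (evalHom p) e3
      rw [hℓ] at e4
      simp only [map_sum, map_mul, evalHom_apply] at e4
      have e5 : ∀ i, b.repr (f k + x) i p = 0 := fun i => congrFun h0 i
      simp only [e5, mul_zero, Finset.sum_const_zero] at e4
      have e6 : v p = 0 := by
        funext i
        have := (Finset.sum_eq_zero_iff_of_nonneg fun i _ => mul_self_nonneg (v' i p)).1 e4.symm i
          (Finset.mem_univ i)
        exact mul_self_eq_zero.1 this
      have := hv p
      rw [e6, map_zero] at this
      exact lt_irrefl _ this)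
  have hT : ∀ i j, g ((Fin.cons (s • N 0) fun j : Fin 3 => θ j : Fin 4 → W) i)
      ((Fin.cons (s • N 0) fun j : Fin 3 => θ j : Fin 4 → W) j) =
        algebraMap ℝ (Cinf M) (eta i j) := by
    refine Fin.cases (Fin.cases ?_ fun j => ?_) fun i => Fin.cases ?_ fun j => ?_
    · rw [Fin.cons_zero, map_smul, map_smul, LinearMap.smul_apply, smul_eq_mul, smul_eq_mul,
        eta_zero_zero, map_neg, map_one]
      linear_combination -hs
    · rw [Fin.cons_zero, Fin.cons_succ, eta_zero_succ, map_zero, map_smul, LinearMap.smul_apply,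
        hsymm, hspan _ _ (h1 j j.2), smul_zero]
    · rw [Fin.cons_zero, Fin.cons_succ, eta_succ_zero, map_zero, map_smul,
        hspan _ _ (h1 i i.2), smul_zero]
    · rw [Fin.cons_succ, Fin.cons_succ, eta_succ_succ, h2 i i.2 j j.2]
      simp only [Fin.val_inj]
      split_ifs <;> simp
  obtain ⟨Θ, hΘ⟩ := exists_basis_of_orthonormal g b _ hT
  exact ⟨Θ, fun i j => by rw [hΘ, hT]⟩

/-- A free module of rank four over the smooth functions on a nonempty manifold has a basis indexed
by `Fin 4`. -/
theorem nonempty_basis [Nonempty M] [Module.Free (Cinf M) W]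
    (hW : Module.finrank (Cinf M) W = 4) : Nonempty (Module.Basis (Fin 4) (Cinf M) W) := by
  obtain ⟨p⟩ := (inferInstance : Nonempty M)
  have : Nontrivial (Cinf M) := (evalHom p).toRingHom.domain_nontrivial
  have : Module.Finite (Cinf M) W := Module.finite_of_finrank_pos (by omega)
  exact ⟨Module.finBasisOfFinrankEq (Cinf M) W hW⟩

variable [Module ℝ W] [IsScalarTower ℝ (Cinf M) W]

/-- The elements `m(S)` of an arbitrary orthonormal frame span `I²`: rescaling the frame makes it
orthonormal for the given representative. -/
theorem iGr_two_eq_weylSub (c : ConformalInnerProduct M W) {g : LinearMap.BilinForm (Cinf M) W}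
    (hg : g ∈ c.reps) (θ : Module.Basis (Fin 4) (Cinf M) W) (hθ : IsConfOrthonormal c.reps θ) :
    iGr c.reps g 2 = weylSub c.proportional hθ := by
  obtain ⟨g', hg', h⟩ := id hθ
  obtain ⟨u, hu, rfl⟩ := (c.conformal g' hg' g).1 hg
  obtain ⟨s, hs⟩ := exists_inv_sqrt hu
  let s' : (Cinf M)ˣ := Units.mkOfMulEqOne s (s * u) (by rw [← mul_assoc, hs])
  have hON : IsON (u • g') (θ.unitsSMul fun _ => s') := fun i j => by
    have h1 : ∀ i, θ.unitsSMul (fun _ => s') i = s • θ i := fun i => by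
      rw [Module.Basis.unitsSMul_apply]
      rfl
    rw [h1, h1, LinearMap.smul_apply, map_smul, map_smul, LinearMap.smul_apply,
      LinearMap.smul_apply, h i j, smul_eq_mul, smul_eq_mul, smul_eq_mul]
    linear_combination algebraMap ℝ (Cinf M) (eta i j) * hs
  exact (iGr_two c.proportional ⟨_, hg, hON⟩ hg hON).trans
    (weylSub_unitsSMul c.proportional hθ s' ⟨_, hg, hON⟩)

end Existence

end CliffordGR

end

theorem mainTheorem7
    {M : Type*} [TopologicalSpace M] [ChartedSpace (EuclideanSpace ℝ (Fin 4)) M]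
    [IsManifold (𝓡 4) ∞ M] (hM : Nonempty (M ≃ₘ⟮𝓡 4, 𝓡 4⟯ EuclideanSpace ℝ (Fin 4)))
    {W : Type*} [AddCommGroup W] [Module (CliffordGR.Cinf M) W] [Module ℝ W]
    [IsScalarTower ℝ (CliffordGR.Cinf M) W] [Module.Free (CliffordGR.Cinf M) W]
    (hW : Module.finrank (CliffordGR.Cinf M) W = 4)
    (c : CliffordGR.ConformalInnerProduct M W)
    (g : LinearMap.BilinForm (CliffordGR.Cinf M) W) (hg : g ∈ c.reps) :
    -- `f` respects filtrations and parities
    (∀ k : ℤ, ∀ x ∈ CliffordGR.lbarTri c.reps g k,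
      CliffordGR.fMor c.reps g x ∈ CliffordGR.pbarTri g k) ∧
    -- `Gr Ī` is a graded direct summand of `Gr L̄`
    (∃ r : (CliffordGR.lbarFil c.reps g).Gr →ₗ[CliffordGR.Cinf M]
        ((CliffordGR.lbarFil c.reps g).sub (CliffordGR.Ibar c.reps g)).Gr,
      (∀ x, r (CliffordGR.grIbar c.reps g x) = x) ∧
      (∀ k : ℤ, ∀ x ∈ (CliffordGR.lbarFil c.reps g).grPiece k,
        r x ∈ ((CliffordGR.lbarFil c.reps g).sub (CliffordGR.Ibar c.reps g)).grPiece k)) ∧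
    -- `Gr L̄ ≃ L` canonically
    Function.Bijective (CliffordGR.canon c.reps g) ∧
    (∀ k : ℤ, (CliffordGR.lGr c.reps k).map
        ((CliffordGR.canon c.reps g).restrictScalars (CliffordGR.Cinf M)) =
      (CliffordGR.lbarFil c.reps g).grPiece k) ∧
    -- `I⁰ = I¹ = 0`
    CliffordGR.iGr c.reps g 0 = ⊥ ∧ CliffordGR.iGr c.reps g 1 = ⊥ ∧
    -- the basis of `I²`
    (∀ (θ : Module.Basis (Fin 4) (CliffordGR.Cinf M) W)
        (hθ : CliffordGR.IsConfOrthonormal c.reps θ) (κ : Type)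
        (S : Module.Basis κ ℝ CliffordGR.symTraceless),
      LinearIndependent (CliffordGR.Cinf M)
        (fun a => CliffordGR.weylElt c.proportional θ hθ (S a)) ∧
      Submodule.span (CliffordGR.Cinf M)
        (Set.range fun a => CliffordGR.weylElt c.proportional θ hθ (S a)) =
          CliffordGR.iGr c.reps g 2) ∧
    -- `I = (⋀ W) I²`
    CliffordGR.idealI c.reps g =
      Submodule.span (ExteriorAlgebra (CliffordGR.Cinf M) W)
        (CliffordGR.iGr c.reps g 2 : Set (CliffordGR.Lmod c.reps)) ∧
    -- `I` lies in the kernel of the anchor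
    CliffordGR.idealI c.reps g ≤ LinearMap.ker (CliffordGR.anchor c.reps) ∧
    -- `[L, I] ⊂ I`
    (∀ x, ∀ y ∈ CliffordGR.idealI c.reps g,
      CliffordGR.bracket c.reps x y ∈ CliffordGR.idealI c.reps g) ∧
    -- `E = L / I ≃ Gr L̄ / Gr Ī ≃ Gr Ē` canonically
    (∃ e : CliffordGR.Emod c.reps g ≃ₗ[ExteriorAlgebra (CliffordGR.Cinf M) W]
        ((CliffordGR.lbarFil c.reps g).Gr ⧸ LinearMap.range (CliffordGR.grIbar c.reps g)),
      ∀ x, e (Submodule.Quotient.mk x) =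
        Submodule.Quotient.mk (CliffordGR.canon c.reps g x)) ∧
    (∃ e : CliffordGR.Emod c.reps g ≃ₗ[ExteriorAlgebra (CliffordGR.Cinf M) W]
        ((CliffordGR.lbarFil c.reps g).quot (CliffordGR.Ibar c.reps g)).Gr,
      (∀ x, e (Submodule.Quotient.mk x) =
        CliffordGR.grEbar c.reps g (CliffordGR.canon c.reps g x)) ∧
      (∀ (k : ℤ) (x : CliffordGR.Emod c.reps g), x ∈ CliffordGR.eGr c.reps g k ↔
        e x ∈ ((CliffordGR.lbarFil c.reps g).quot (CliffordGR.Ibar c.reps g)).grPiece k)) ∧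
    -- `E` is a graded Lie algebroid over `⋀ W`, with the induced bracket and anchor
    (∃ (br : CliffordGR.Emod c.reps g →ₗ[ℝ] CliffordGR.Emod c.reps g →ₗ[ℝ]
          CliffordGR.Emod c.reps g)
        (ρ : CliffordGR.Emod c.reps g →ₗ[ExteriorAlgebra (CliffordGR.Cinf M) W]
          (ExteriorAlgebra (CliffordGR.Cinf M) W →ₗ[ℝ]
            ExteriorAlgebra (CliffordGR.Cinf M) W)),
      (∀ x y, br (Submodule.Quotient.mk x) (Submodule.Quotient.mk y) =
        Submodule.Quotient.mk (CliffordGR.bracket c.reps x y)) ∧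
      (∀ x, ρ (Submodule.Quotient.mk x) = CliffordGR.anchor c.reps x) ∧
      CliffordGR.IsGLaoid
        (fun k => (CliffordGR.extGr (CliffordGR.Cinf M) W k).restrictScalars ℝ)
        (CliffordGR.eGr c.reps g) br ρ) := by
  have : Nonempty M := hM.map fun Φ => Φ.symm 0
  have hb : Nonempty (Module.Basis (Fin 4) (CliffordGR.Cinf M) W) := CliffordGR.nonempty_basis hW
  have hf : ∃ θ : Module.Basis (Fin 4) (CliffordGR.Cinf M) W, CliffordGR.IsON g θ := by
    obtain ⟨b⟩ := hb
    exact CliffordGR.exists_isON hM b (c.symm g hg) (c.signature g hg)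
  obtain ⟨θ, hθ⟩ := hf
  have hθ' : CliffordGR.IsConfOrthonormal c.reps θ := ⟨g, hg, hθ⟩
  have hanchor := CliffordGR.anchor_idealI c.proportional hg hθ
  have hbracket := CliffordGR.bracket_idealI c.proportional hg hθ
  refine ⟨?_, ?_, ?_, ?_, ?_, ?_, ?_, ?_, ?_, ?_, ?_, ?_, ?_⟩
  · exact CliffordGR.fMor_mem_pbarTri
  · exact CliffordGR.exists_graded_leftInverse c.proportional hg hθ
  · exact CliffordGR.canon_bijective c.reps g
  · exact CliffordGR.map_canon_lGr c.reps g
  · exact CliffordGR.iGr_eq_bot c.proportional hg hθ zero_le_one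
  · exact CliffordGR.iGr_eq_bot c.proportional hg hθ le_rfl
  · intro Θ hΘ κ S
    refine ⟨?_, ?_⟩
    · exact CliffordGR.linearIndependent_weylElt c.proportional hΘ
        (fun r hr => ContMDiffMap.ext fun p => hr (CliffordGR.evalHom p)) S
    · exact (CliffordGR.span_weylElt c.proportional hΘ S).trans
        (CliffordGR.iGr_two_eq_weylSub c hg Θ hΘ).symm
  · rw [CliffordGR.idealI_eq_span c.proportional hθ' hg hθ,
      CliffordGR.iGr_two c.proportional hθ' hg hθ]
  · exact hanchor
  · exact hbracket
  · exact CliffordGR.exists_equiv_gr_quotient c.reps g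
  · exact ⟨CliffordGR.emodEquiv c.reps g, CliffordGR.emodEquiv_mk, CliffordGR.mem_eGr_iff⟩
  · exact ⟨CliffordGR.emodBr hbracket, (CliffordGR.idealI c.reps g).liftQ _ hanchor,
      CliffordGR.emodBr_mk hbracket, fun x => rfl, CliffordGR.emod_isGLaoid hbracket hanchor⟩
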